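/- Let $1<p_0<2$, put $p_0^*=2p_0/(2-p_0)$ and $\langle x\rangle=\sqrt{1+|x|^2}$, and let $f\in L^{p_0}(\mathbb{R}^2)$ be real- or complex-valued. Define $$P(x)=-\frac1{2\pi}\int_{\mathbb{R}^2}\log\frac{|x-y|}{|y|}\,f(y)\,dy .$$ (i) The integral defining $P(x)$ converges absolutely for every $x\in\mathbb{R}^2$, and $P(0)=0$. $P$ is locally integrable, and its weak gradient is $$\nabla P(x)=-\frac1{2\pi}\int_{\mathbb{R}^2}\frac{x-y}{|x-y|^2}\,f(y)\,dy\quad\text{for a.e. }x,$$ the integral being absolutely convergent for a.e. $x$. One has $\nabla P\in L^{p_0^*}(\mathbb{R}^2)$, and $P$ is a weak solution of $-\Delta P=f$: $\int\nabla P\cdot\nabla\varphi\,dx=\int f\varphi\,dx$ for all $\varphi\in\mathcal{S}(\mathbb{R}^2)$. Moreover $\nabla P$ tends to $0$ at infinity in $L^{p_0^*}$ and in measure: as $R\to\infty$, $\|\nabla P\|_{L^{p_0^*}(\{|x|>R\})}\to0$ and, for every $\varepsilon>0$, the Lebesgue measure of $\{|x|>R,\ |\nabla P(x)|>\varepsilon\}$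 tends to $0$. If in addition $f\in L^1(\mathbb{R}^2)$, then $$\limsup_{|x|\to\infty}\frac{|P(x)|}{\log\langle x\rangle}\le\frac{\|f\|_{L^1}}{2\pi}.$$ (ii) Suppose in addition that $f$ is continuous and that its weak gradient satisfies $\nabla f\in L^{q_0}(\mathbb{R}^2)$ for some $q_0\in(2,\infty)$. Then $P\in C^2(\mathbb{R}^2)$, and $P$ is the unique $C^2$ solution of $-\Delta P=f$ in $\mathbb{R}^2$ such that $\nabla P$ is bounded, $|\nabla P(x)|\to0$ as $|x|\to\infty$, and $P(0)=0$. Moreover $\nabla P\in L^r(\mathbb{R}^2)$ for all $r\in[p_0^*,\infty]$, $\nabla^2P\in L^p(\mathbb{R}^2)$ for all $p\in[p_0,\infty]$, and the weak third derivatives satisfy $\nabla^3P\in L^{q_0}(\mathbb{R}^2)$. -/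

import Mathlib

open MeasureTheory Filter Topology
open scoped ENNReal SchwartzMap Laplacian ContDiff Real

noncomputable section

/-- The Euclidean plane `ℝ²`. -/
abbrev Plane : Type := EuclideanSpace ℝ (Fin 2)

/-- The standard basis vector `e i` of the plane. -/
def basisVec (i : Fin 2) : Plane := EuclideanSpace.single i (1 : ℝ)

/-- The exponent `p* = 2p / (2 - p)`. -/
def sobolevConj (p : ℝ) : ℝ := 2 * p / (2 - p)

/-- The Japanese bracket `⟨x⟩ = √(1 + |x|²)`. -/
def bracket (x : Plane) : ℝ := Real.sqrt (1 + ‖x‖ ^ 2)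

variable {𝕜 : Type*} [RCLike 𝕜]

/-- The classical partial derivative `∂ᵢ u`. -/
def partialDeriv (i : Fin 2) (u : Plane → 𝕜) (x : Plane) : 𝕜 :=
  fderiv ℝ u x (basisVec i)

/-- The classical gradient `∇u = (∂₁ u, ∂₂ u)`, with the Euclidean norm on `𝕜²`. -/
def grad (u : Plane → 𝕜) (x : Plane) : EuclideanSpace 𝕜 (Fin 2) :=
  WithLp.toLp 2 (fun i => partialDeriv i u x)

/-- `G` is the weak (distributional) gradient of `u`: both are locally integrable and
`∫ u ∂ᵢφ = - ∫ Gᵢ φ` for all test functions `φ ∈ C_c^∞(ℝ²)` and `i = 1, 2`. -/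
def HasWeakGradient (u : Plane → 𝕜) (G : Plane → EuclideanSpace 𝕜 (Fin 2)) : Prop :=
  LocallyIntegrable u volume ∧ LocallyIntegrable G volume ∧
    ∀ (i : Fin 2) (φ : Plane → ℝ), ContDiff ℝ ∞ φ → HasCompactSupport φ →
      ∫ x, partialDeriv i φ x • u x = - ∫ x, φ x • G x i

/-- The integrand `y ↦ log (|x - y| / |y|) f(y)` of the potential. -/
def potentialIntegrand (f : Plane → 𝕜) (x y : Plane) : 𝕜 :=
  Real.log (‖x - y‖ / ‖y‖) • f y

/-- The potential `P(x) = -(1/2π) ∫ log (|x - y| / |y|) f(y) dy`. -/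
def potential (f : Plane → 𝕜) (x : Plane) : 𝕜 :=
  (-(1 / (2 * π)) : ℝ) • ∫ y, potentialIntegrand f x y

/-- The components of the integrand `y ↦ ((x - y) / |x - y|²) f(y)`. -/
def gradIntegrand (f : Plane → 𝕜) (i : Fin 2) (x y : Plane) : 𝕜 :=
  ((x i - y i) / ‖x - y‖ ^ 2) • f y

/-- The vector field `-(1/2π) ∫ ((x - y) / |x - y|²) f(y) dy`. -/
def gradPotential (f : Plane → 𝕜) (x : Plane) : EuclideanSpace 𝕜 (Fin 2) :=
  WithLp.toLp 2 (fun i => (-(1 / (2 * π)) : ℝ) • ∫ y, gradIntegrand f i x y)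

/-- `Q` is a classical solution of `-Δ Q = f` in the plane with `∇Q` bounded,
`|∇Q(x)| → 0` as `|x| → ∞`, and `Q(0) = 0`. -/
structure IsClassicalSolution (f Q : Plane → 𝕜) : Prop where
  contDiff : ContDiff ℝ 2 Q
  poisson : ∀ x, -(Δ Q x) = f x
  grad_bounded : ∃ C : ℝ, ∀ x, ‖grad Q x‖ ≤ C
  grad_tendsto : Tendsto (fun x => ‖grad Q x‖) (Bornology.cobounded Plane) (𝓝 0)
  zero_at_origin : Q 0 = 0

end

/-!
Formally, the potential `P` is, up to an additive constant, the convolution of `f` with the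
fundamental solution `-(1/2π) log |x|` of `-Δ`. Everything rests on two identities for nice `φ`: the
distributional gradient of `log |w|` is `w / |w|²` (`kconv_log_partialDeriv`), and **Green's
representation formula** `∑ᵢ (wᵢ / |w|²) * ∂ᵢφ = 2π φ` (`sum_kconv_gradLog_partialDeriv`). Both are
proved for the regularisation `log √(|w|² + ε²)` and `ε → 0`. The integrals converge absolutely
because `y ↦ log (|x - y| / |y|)` lies in `L^q` for every `q > 2`, in particular for the exponent
conjugate to `p₀` (`memLp_logKernel`), and because `|f(y)| |x - y|⁻¹` is integrable against
functions of `x` in `L¹ ∩ L^q` (`exists_lintegral_riesz_le`). Fubini's theorem then turns the two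
identities into the formula for the weak gradient and the weak form of Poisson's equation.

The Lebesgue norms of the derivatives are estimated without the theory of singular integrals. M.
Riesz's theorem for the regularised Hilbert transforms (`exists_lintegral_conjConv_le`) is proved by
the complex method: the `p`-th power of the Cauchy integral of `f ≥ 0` is holomorphic in the upper
half-plane, so its integral over horizontal lines vanishes, and a trigonometric inequality
(`exists_abs_im_rpow_le`) compares the imaginary part with the real part; duality gives `p > 2`. The
product of two Hilbert transforms along orthogonal axes is then bounded on `L^p` of the
plane, and so is its average over rotations against `sin 2α` or `cos 2α`
(`lintegral_avgKernel_conv_le`). These averages are computed explicitly (`avgKernel_sin`,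
`avgKernel_cos`): as `ε → 0` they are multiples of `(y₀² - y₁²) / |y|⁴` and
`y₀ y₁ / |y|⁴`, the trace-free second derivatives of `log |y|`. The trace is Green's formula. The
result is the Calderón–Zygmund estimate `exists_eLpNorm_kconv_gradLog_partialDeriv_le`. Combined
with the Gagliardo–Nirenberg–Sobolev inequality, applied to the gradient of the potential, it gives
the Hardy–Littlewood–Sobolev inequality `exists_eLpNorm_kconv_gradLog_le`; density and Fatou's lemma
extend it to `f ∈ L^p₀` (`memLp_gradPotential`). The growth of `P` for `f ∈ L¹` follows from
`|log (|x - y| / |y|)| ≤ log (1 + |x|) + O(1)`, the error in the sense of `L^q`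
(`limsup_potential_div_log_le`).

In the classical regime `f` is approximated by test functions `h` in the norm `‖h‖_p + ‖∇h‖_q`.
**Morrey's inequality** (`exists_enorm_le_eLpNorm_add`), a consequence of Green's formula and
Hölder's inequality, bounds the suprema of the first two derivatives of the potential by this norm
(`exists_potential_bounds`), so that these derivatives converge uniformly and the third derivatives
converge in `L^q` (`classical_potential`). The gradient vanishes at infinity since it does so for
test functions. Uniqueness is Liouville's theorem: if `d` is harmonic, then `∂₀d - i ∂₁d` is an
entire function of `x₀ + i x₁`, and it is zero if it tends to zero at infinity
(`eq_zero_of_harmonic`).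
-/

noncomputable section

variable {𝕜 : Type*} [RCLike 𝕜]

/-! ### Jensen's and Young's inequalities -/

/-- Weighted Jensen inequality for the Lebesgue integral. -/
theorem lintegral_mul_rpow_le {α : Type*} [MeasurableSpace α] {μ : Measure α} {p : ℝ}
    (hp : 1 < p) {k F : α → ℝ≥0∞} (hk : AEMeasurable k μ) (hF : AEMeasurable F μ) :
    (∫⁻ a, k a * F a ∂μ) ^ p ≤ (∫⁻ a, k a ∂μ) ^ (p - 1) * ∫⁻ a, k a * F a ^ p ∂μ := by
  have hp0 : 0 < p := by linarith
  have hpq : (Real.conjExponent p).HolderConjugate p :=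
    (Real.HolderConjugate.conjExponent hp).symm
  have h := ENNReal.lintegral_mul_le_Lp_mul_Lq μ hpq (f := fun a => k a ^ (1 - 1 / p))
    (g := fun a => k a ^ (1 / p) * F a) (by fun_prop) (by fun_prop)
  have e1 : ∀ a, k a ^ (1 - 1 / p) * (k a ^ (1 / p) * F a) = k a * F a := by
    intro a
    have h1 : 1 / p < 1 := by rw [div_lt_one hp0]; exact hp
    rw [← mul_assoc, ← ENNReal.rpow_add_of_nonneg _ _ (by linarith) (by positivity)]
    simp
  have e2 : ∀ a, (k a ^ (1 - 1 / p)) ^ (Real.conjExponent p) = k a := by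
    intro a
    rw [← ENNReal.rpow_mul, Real.conjExponent]
    have : (1 - 1 / p) * (p / (p - 1)) = 1 := by
      have : p - 1 ≠ 0 := by linarith
      field_simp
    rw [this, ENNReal.rpow_one]
  have e3 : ∀ a, (k a ^ (1 / p) * F a) ^ p = k a * F a ^ p := by
    intro a
    rw [ENNReal.mul_rpow_of_nonneg _ _ hp0.le, ← ENNReal.rpow_mul, one_div_mul_cancel hp0.ne',
      ENNReal.rpow_one]
  simp only [Pi.mul_apply, e1, e2, e3] at h
  calc (∫⁻ a, k a * F a ∂μ) ^ p ≤ ((∫⁻ a, k a ∂μ) ^ (1 / Real.conjExponent p) *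
        (∫⁻ a, k a * F a ^ p ∂μ) ^ (1 / p)) ^ p := by gcongr
    _ = _ := by
      rw [ENNReal.mul_rpow_of_nonneg _ _ hp0.le, ← ENNReal.rpow_mul, ← ENNReal.rpow_mul,
        one_div_mul_cancel hp0.ne', ENNReal.rpow_one]
      congr 2
      rw [Real.conjExponent]
      have : p - 1 ≠ 0 := by linarith
      field_simp

/-- Young's inequality `‖k * F‖_p ≤ ‖k‖_1 ‖F‖_p` on an additive group, for nonnegative functions. -/
theorem lintegral_conv_rpow_le {G : Type*} [MeasurableSpace G] [AddCommGroup G]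
    [MeasurableAdd₂ G] [MeasurableNeg G] {μ : Measure G} [SFinite μ] [μ.IsAddLeftInvariant]
    {p : ℝ} (hp : 1 < p) {k F : G → ℝ≥0∞} (hk : Measurable k) (hF : Measurable F) :
    ∫⁻ x, (∫⁻ y, k y * F (x - y) ∂μ) ^ p ∂μ ≤ (∫⁻ y, k y ∂μ) ^ p * ∫⁻ x, F x ^ p ∂μ := by
  have hp0 : 0 < p := by linarith
  have hsub : Measurable fun z : G × G => z.1 - z.2 := measurable_fst.sub measurable_snd
  calc ∫⁻ x, (∫⁻ y, k y * F (x - y) ∂μ) ^ p ∂μ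
      ≤ ∫⁻ x, (∫⁻ y, k y ∂μ) ^ (p - 1) * ∫⁻ y, k y * F (x - y) ^ p ∂μ ∂μ := by
        refine lintegral_mono fun x => lintegral_mul_rpow_le hp hk.aemeasurable ?_
        exact (hF.comp (measurable_const.sub measurable_id)).aemeasurable
    _ = (∫⁻ y, k y ∂μ) ^ (p - 1) * ∫⁻ y, ∫⁻ x, k y * F (x - y) ^ p ∂μ ∂μ := by
        rw [lintegral_const_mul, lintegral_lintegral_swap]
        · exact ((hk.comp measurable_snd).mul ((hF.comp hsub).pow_const p)).aemeasurable
        · exact ((hk.comp measurable_snd).mul ((hF.comp hsub).pow_const p)).lintegral_prod_right'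
    _ = (∫⁻ y, k y ∂μ) ^ (p - 1) * ∫⁻ y, k y * ∫⁻ x, F x ^ p ∂μ ∂μ := by
        congr 1
        refine lintegral_congr fun y => ?_
        have hm : Measurable fun x => F (x - y) ^ p :=
          (hF.comp (measurable_id.sub_const y)).pow_const p
        rw [lintegral_const_mul _ hm, lintegral_sub_right_eq_self (fun x => F x ^ p) y]
    _ = _ := by
        rw [lintegral_mul_const _ hk, ← mul_assoc]
        congr 1
        conv_rhs => rw [show p = (p - 1) + 1 by ring,
          ENNReal.rpow_add_of_nonneg _ _ (by linarith) (by norm_num), ENNReal.rpow_one]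

/-! ### The Cauchy integral in the upper half-plane -/

/-- The trigonometric inequality behind M. Riesz's theorem on conjugate functions: on the right
half-plane `|Im z| ^ p` is dominated by `(Re z) ^ p`, up to a multiple of the harmonic function
`Re (z ^ p)`. -/
theorem exists_abs_im_rpow_le {p : ℝ} (hp : 1 < p) (hp2 : p ≤ 2) :
    ∃ A B : ℝ, 0 ≤ A ∧ 0 ≤ B ∧ ∀ z : ℂ, 0 < z.re →
      |z.im| ^ p ≤ A * z.re ^ p - B * (z ^ (p : ℂ)).re := by
  have hp0 : 0 < p := by linarith
  have hπ := Real.pi_pos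
  -- an angle with `φ₀ < π / 2 < p φ₀`
  set φ₀ : ℝ := π / 2 * ((1 + 1 / p) / 2) with hφ₀
  have hip : 1 / p < 1 := by rw [div_lt_one hp0]; exact hp
  have hip0 : 0 < 1 / p := by positivity
  have h1 : φ₀ < π / 2 := by rw [hφ₀]; nlinarith
  have h0 : 0 < φ₀ := by rw [hφ₀]; positivity
  have h2 : π / 2 < p * φ₀ := by
    have : p * φ₀ = π / 2 * ((p + 1) / 2) := by rw [hφ₀]; field_simp
    rw [this]; nlinarith
  have hc : Real.cos (p * φ₀) < 0 := by
    apply Real.cos_neg_of_pi_div_two_lt_of_lt h2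
    nlinarith
  have hd : 0 < Real.cos φ₀ := Real.cos_pos_of_mem_Ioo ⟨by linarith, h1⟩
  set B := (-Real.cos (p * φ₀))⁻¹ with hB
  have hB0 : 0 < B := by rw [hB]; exact inv_pos.2 (by linarith)
  set A := (1 + B) / Real.cos φ₀ ^ p with hA
  have hA0 : 0 < A := by rw [hA]; positivity
  refine ⟨A, B, hA0.le, hB0.le, fun z hz => ?_⟩
  have hz0 : z ≠ 0 := by rintro rfl; simp at hz
  have hn : 0 < ‖z‖ := norm_pos_iff.2 hz0
  set θ := z.arg with hθ
  have hθ2 : |θ| < π / 2 := Complex.abs_arg_lt_pi_div_two_iff.2 (Or.inl hz)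
  have hre : z.re = ‖z‖ * Real.cos θ := by rw [hθ, Complex.norm_mul_cos_arg]
  have him : |z.im| = ‖z‖ * |Real.sin θ| := by
    rw [← Complex.norm_mul_sin_arg z, abs_mul, abs_of_pos hn]
  have hcpow : (z ^ (p : ℂ)).re = ‖z‖ ^ p * Real.cos (p * θ) := by
    rw [Complex.cpow_ofReal_re, mul_comm θ p]
  have hcos : 0 < Real.cos θ := Real.cos_pos_of_mem_Ioo (abs_lt.1 hθ2)
  rw [hre, him, hcpow, Real.mul_rpow hn.le (abs_nonneg _), Real.mul_rpow hn.le hcos.le]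
  have key : |Real.sin θ| ^ p ≤ A * Real.cos θ ^ p - B * Real.cos (p * θ) := by
    have hs : |Real.sin θ| ^ p ≤ 1 := Real.rpow_le_one (abs_nonneg _) (Real.abs_sin_le_one _) hp0.le
    refine hs.trans ?_
    have e1 : Real.cos (p * θ) = Real.cos (p * |θ|) := by
      rw [← Real.cos_abs, abs_mul, abs_of_pos hp0]
    rcases le_total φ₀ |θ| with h | h
    · have : Real.cos (p * |θ|) ≤ Real.cos (p * φ₀) :=
        Real.cos_le_cos_of_nonneg_of_le_pi (by positivity) (by nlinarith) (by gcongr)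
      have h3 : B * Real.cos (p * |θ|) ≤ -1 := by
        calc B * Real.cos (p * |θ|) ≤ B * Real.cos (p * φ₀) := by gcongr
          _ = -1 := by rw [hB, inv_neg, neg_mul, inv_mul_cancel₀ hc.ne]
      rw [e1]
      have : 0 ≤ A * Real.cos θ ^ p := by positivity
      linarith
    · have h3 : Real.cos φ₀ ≤ Real.cos θ := by
        rw [← Real.cos_abs θ]
        exact Real.cos_le_cos_of_nonneg_of_le_pi (abs_nonneg _) (by linarith) h
      have h4 : 1 + B ≤ A * Real.cos θ ^ p := by
        have : Real.cos φ₀ ^ p ≤ Real.cos θ ^ p := Real.rpow_le_rpow hd.le h3 hp0.le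
        calc 1 + B = A * Real.cos φ₀ ^ p := by
              rw [hA, div_mul_cancel₀ _ (Real.rpow_pos_of_pos hd p).ne']
          _ ≤ _ := by gcongr
      have := Real.cos_le_one (p * θ)
      nlinarith
  calc ‖z‖ ^ p * |Real.sin θ| ^ p
      ≤ ‖z‖ ^ p * (A * Real.cos θ ^ p - B * Real.cos (p * θ)) := by gcongr
    _ = _ := by ring

/-- The (unnormalised) conjugate Poisson kernel `t / (t² + ε²)`, a regularisation of `1 / t`. -/
def conjKernel (ε t : ℝ) : ℝ := t / (t ^ 2 + ε ^ 2)

/-- The Cauchy integral `∫ f(t) i / (z - t) dt`. On the line `Im z = ε` its real and imaginary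
parts are the convolutions of `f` with the Poisson kernel and its conjugate. -/
def cauchyIntegral (f : ℝ → ℝ) (z : ℂ) : ℂ := ∫ t, (f t : ℂ) * (Complex.I / (z - t))

theorem sub_ofReal_ne_zero {z : ℂ} (hz : 0 < z.im) (t : ℝ) : z - t ≠ 0 := by
  intro h
  have := congrArg Complex.im h
  simp at this
  exact hz.ne' this

theorem im_le_norm_sub_ofReal (z : ℂ) (t : ℝ) : z.im ≤ ‖z - t‖ := by
  have := (le_abs_self _).trans (Complex.abs_im_le_norm (z - t))
  simpa using this

theorem integrable_cauchyIntegrand {f : ℝ → ℝ} (hf : Continuous f) (hs : HasCompactSupport f)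
    {z : ℂ} (hz : 0 < z.im) : Integrable fun t : ℝ => (f t : ℂ) * (Complex.I / (z - t)) := by
  apply Continuous.integrable_of_hasCompactSupport
  · exact (Complex.continuous_ofReal.comp hf).mul
      (continuous_const.div (by fun_prop) (sub_ofReal_ne_zero hz))
  · refine HasCompactSupport.mul_right ?_
    exact hs.comp_left (g := fun x : ℝ => (x : ℂ)) (by simp)

theorem differentiableAt_cauchyIntegral {f : ℝ → ℝ} (hf : Continuous f) (hs : HasCompactSupport f)
    {z : ℂ} (hz : 0 < z.im) : DifferentiableAt ℂ (cauchyIntegral f) z := by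
  have hball : ∀ w ∈ Metric.ball z (z.im / 2), z.im / 2 ≤ w.im := by
    intro w hw
    have h1 : |(w - z).im| < z.im / 2 :=
      (Complex.abs_im_le_norm _).trans_lt (by simpa [dist_eq_norm] using hw)
    have := (abs_lt.1 h1).1
    simp at this
    linarith
  have h := hasDerivAt_integral_of_dominated_loc_of_deriv_le (μ := volume) (𝕜 := ℂ)
    (F := fun w (t : ℝ) => (f t : ℂ) * (Complex.I / (w - t)))
    (F' := fun w (t : ℝ) => (f t : ℂ) * (-Complex.I / (w - t) ^ 2))
    (x₀ := z) (s := Metric.ball z (z.im / 2))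
    (bound := fun t => |f t| * (1 / (z.im / 2) ^ 2)) (Metric.ball_mem_nhds _ (by positivity))
    ?_ (integrable_cauchyIntegrand hf hs hz) ?_ ?_ ?_ ?_
  · exact h.2.differentiableAt
  · filter_upwards [Metric.ball_mem_nhds z (show 0 < z.im / 2 by positivity)] with w hw
    have := hball w hw
    exact (integrable_cauchyIntegrand hf hs (z := w) (by linarith)).aestronglyMeasurable
  · refine Continuous.aestronglyMeasurable ?_
    exact (Complex.continuous_ofReal.comp hf).mul
      (continuous_const.div (by fun_prop) fun t => pow_ne_zero _ (sub_ofReal_ne_zero hz t))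
  · refine Eventually.of_forall fun t w hw => ?_
    have h1 := hball w hw
    have h2 := im_le_norm_sub_ofReal w t
    rw [norm_mul, norm_div, norm_neg, Complex.norm_I, norm_pow, Complex.norm_real, Real.norm_eq_abs]
    gcongr
    linarith
  · exact (hf.abs.integrable_of_hasCompactSupport hs.abs).mul_const _
  · refine Eventually.of_forall fun t w hw => ?_
    have h1 := hball w hw
    have hne : w - t ≠ 0 := sub_ofReal_ne_zero (by linarith) t
    have := ((hasDerivAt_const w Complex.I).div ((hasDerivAt_id w).sub_const (t : ℂ)) hne).const_mul
      (f t : ℂ)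
    simpa using this

/-- Decay of the Cauchy integral of a compactly supported function. -/
theorem exists_norm_cauchyIntegral_le {f : ℝ → ℝ} (hf : Continuous f) (hs : HasCompactSupport f)
    {ε : ℝ} (hε : 0 < ε) :
    ∃ M, 0 ≤ M ∧ ∀ z : ℂ, ε ≤ z.im → ‖cauchyIntegral f z‖ ≤ M / (1 + ‖z‖) := by
  obtain ⟨R, hR0, hR⟩ : ∃ R : ℝ, 0 < R ∧ ∀ t, f t ≠ 0 → |t| ≤ R := by
    obtain ⟨R, hR⟩ := hs.isCompact.isBounded.subset_closedBall 0
    refine ⟨max R 1, by positivity, fun t ht => ?_⟩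
    have := hR (subset_tsupport f ht)
    simp at this
    exact this.trans (le_max_left _ _)
  -- `1 + |z| ≤ (1 + (1 + R) / ε) |z - t|` for `|t| ≤ R` and `Im z ≥ ε`
  set c := 1 + (1 + R) / ε with hc
  refine ⟨c * ∫ t, |f t|, by positivity, fun z hz => ?_⟩
  have hz0 : 0 < z.im := hε.trans_le hz
  have hint : Integrable fun t => |f t| := hf.abs.integrable_of_hasCompactSupport hs.abs
  rw [cauchyIntegral]
  calc ‖∫ t, (f t : ℂ) * (Complex.I / (z - t))‖ ≤ ∫ t, |f t| * (c / (1 + ‖z‖)) := by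
        refine norm_integral_le_of_norm_le (hint.mul_const _) (Eventually.of_forall fun t => ?_)
        rw [norm_mul, norm_div, Complex.norm_I, Complex.norm_real, Real.norm_eq_abs]
        by_cases ht : f t = 0
        · simp [ht]
        have h1 := hR t ht
        have h2 := im_le_norm_sub_ofReal z t
        have h3 : ‖z‖ ≤ ‖z - t‖ + R := by
          calc ‖z‖ = ‖(z - t) + t‖ := by ring_nf
            _ ≤ ‖z - t‖ + ‖(t : ℂ)‖ := norm_add_le _ _
            _ ≤ _ := by rw [Complex.norm_real, Real.norm_eq_abs]; linarith
        have h4 : 1 + ‖z‖ ≤ c * ‖z - t‖ := by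
          have : (1 + R) ≤ (1 + R) / ε * ‖z - t‖ := by
            rw [div_mul_eq_mul_div, le_div_iff₀ hε]
            have : ε ≤ ‖z - t‖ := hz.trans h2
            gcongr
          rw [hc]; linarith
        have h5 : 0 < ‖z - t‖ := by linarith
        refine mul_le_mul_of_nonneg_left ?_ (abs_nonneg _)
        rw [div_le_div_iff₀ h5 (by positivity)]
        linarith
    _ = _ := by rw [integral_mul_const]; ring

theorem cauchyIntegral_re {f : ℝ → ℝ} (hf : Continuous f) (hs : HasCompactSupport f)
    {z : ℂ} (hz : 0 < z.im) :
    (cauchyIntegral f z).re = ∫ t, f t * (z.im / ((z.re - t) ^ 2 + z.im ^ 2)) := by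
  have h := Complex.reCLM.integral_comp_comm (integrable_cauchyIntegrand hf hs hz)
  simp only [Complex.reCLM_apply] at h
  rw [cauchyIntegral, ← h]
  refine integral_congr_ae (Eventually.of_forall fun t => ?_)
  simp [Complex.div_re, Complex.normSq_apply, ← pow_two]

theorem cauchyIntegral_im {f : ℝ → ℝ} (hf : Continuous f) (hs : HasCompactSupport f)
    {z : ℂ} (hz : 0 < z.im) :
    (cauchyIntegral f z).im = ∫ t, f t * ((z.re - t) / ((z.re - t) ^ 2 + z.im ^ 2)) := by
  have h := Complex.imCLM.integral_comp_comm (integrable_cauchyIntegrand hf hs hz)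
  simp only [Complex.imCLM_apply] at h
  rw [cauchyIntegral, ← h]
  refine integral_congr_ae (Eventually.of_forall fun t => ?_)
  simp [Complex.div_im, Complex.normSq_apply, ← pow_two]

/-- For `f ≥ 0` the Cauchy integral takes its values in the right half-plane, where the principal
branch of the power is holomorphic. -/
theorem cauchyIntegral_re_pos {f : ℝ → ℝ} (hf : Continuous f) (hs : HasCompactSupport f)
    (hf0 : ∀ t, 0 ≤ f t) (hne : f ≠ 0) {z : ℂ} (hz : 0 < z.im) : 0 < (cauchyIntegral f z).re := by
  rw [cauchyIntegral_re hf hs hz]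
  have hpos : ∀ t : ℝ, 0 < z.im / ((z.re - t) ^ 2 + z.im ^ 2) := fun t => by positivity
  obtain ⟨t, ht⟩ := Function.ne_iff.1 hne
  refine Continuous.integral_pos_of_hasCompactSupport_nonneg_nonzero (x := t) ?_ hs.mul_right
    (fun t => mul_nonneg (hf0 t) (hpos t).le) (mul_ne_zero ht (hpos t).ne')
  exact hf.mul (continuous_const.div (by fun_prop) fun t => by positivity)

theorem norm_cpow_cauchyIntegral_le {f : ℝ → ℝ} {p M : ℝ} (hp : 0 < p) {z : ℂ}
    (h : ‖cauchyIntegral f z‖ ≤ M / (1 + ‖z‖)) {r : ℝ} (hr : r ≤ 1 + ‖z‖) (hr0 : 0 < r)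
    (hM : 0 ≤ M) :
    ‖cauchyIntegral f z ^ (p : ℂ)‖ ≤ M ^ p * r ^ (-p) := by
  rw [Complex.norm_cpow_real, Real.rpow_neg hr0.le, ← div_eq_mul_inv, ← Real.div_rpow hM hr0.le]
  refine Real.rpow_le_rpow (norm_nonneg _) (h.trans ?_) hp.le
  gcongr

theorem differentiableOn_cpow_cauchyIntegral {f : ℝ → ℝ} (hf : Continuous f)
    (hs : HasCompactSupport f) (hf0 : ∀ t, 0 ≤ f t) (hne : f ≠ 0) (p : ℝ) :
    DifferentiableOn ℂ (fun z => cauchyIntegral f z ^ (p : ℂ)) {z | 0 < z.im} := by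
  intro z hz
  exact ((differentiableAt_cauchyIntegral hf hs hz).cpow (differentiableAt_const _)
    (Or.inl (cauchyIntegral_re_pos hf hs hf0 hne hz))).differentiableWithinAt

/-- The `p`-th power of the Cauchy integral has vanishing integral over horizontal lines: move the
line to infinity, where the function is `O(|z|⁻ᵖ)` with `p > 1`. -/
theorem integral_cpow_cauchyIntegral_eq_zero {f : ℝ → ℝ} (hf : Continuous f)
    (hs : HasCompactSupport f) (hf0 : ∀ t, 0 ≤ f t) (hne : f ≠ 0) {p : ℝ} (hp : 1 < p)
    {ε : ℝ} (hε : 0 < ε) :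
    Integrable (fun x : ℝ => cauchyIntegral f (x + ε * Complex.I) ^ (p : ℂ)) ∧
      ∫ x : ℝ, cauchyIntegral f (x + ε * Complex.I) ^ (p : ℂ) = 0 := by
  have hp0 : 0 < p := by linarith
  obtain ⟨M, hM, hb⟩ := exists_norm_cauchyIntegral_le hf hs hε
  set G : ℂ → ℂ := fun z => cauchyIntegral f z ^ (p : ℂ) with hG
  have hd : DifferentiableOn ℂ G {z | 0 < z.im} :=
    differentiableOn_cpow_cauchyIntegral hf hs hf0 hne p
  have hc : Continuous fun x : ℝ => G (x + ε * Complex.I) := by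
    refine hd.continuousOn.comp_continuous (by fun_prop) fun x => ?_
    simpa using hε
  have hbound : ∀ z : ℂ, ε ≤ z.im → ∀ r : ℝ, 0 < r → r ≤ 1 + ‖z‖ → ‖G z‖ ≤ M ^ p * r ^ (-p) :=
    fun z hz r hr0 hr => norm_cpow_cauchyIntegral_le hp0 (hb z hz) hr hr0 hM
  have hint : Integrable fun x : ℝ => G (x + ε * Complex.I) := by
    have h1 : Integrable fun x : ℝ => M ^ p * (1 + ‖x‖) ^ (-p) :=
      (integrable_one_add_norm (by simpa using hp)).const_mul _
    refine h1.mono' hc.aestronglyMeasurable (Eventually.of_forall fun x => ?_)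
    refine hbound _ (by simp) _ (by positivity) ?_
    have := Complex.abs_re_le_norm (x + ε * Complex.I)
    simp at this
    simpa using this
  refine ⟨hint, ?_⟩
  have hlim : Tendsto (fun R : ℝ => ∫ x in (-R)..R, G (x + ε * Complex.I)) atTop
      (𝓝 (∫ x : ℝ, G (x + ε * Complex.I))) :=
    intervalIntegral_tendsto_integral hint tendsto_neg_atTop_atBot tendsto_id
  refine tendsto_nhds_unique hlim ?_
  have hzero : Tendsto (fun R : ℝ => 4 * M ^ p * R ^ (-(p - 1))) atTop (𝓝 0) := by
    simpa using (tendsto_rpow_neg_atTop (by linarith : 0 < p - 1)).const_mul (4 * M ^ p)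
  refine squeeze_zero_norm' ?_ hzero
  filter_upwards [eventually_gt_atTop 0] with R hR
  have hrect := Complex.integral_boundary_rect_eq_zero_of_differentiableOn G
    (-R + ε * Complex.I) (R + (ε + R : ℝ) * Complex.I) (hd.mono ?_)
  · simp only [Complex.add_re, Complex.neg_re, Complex.ofReal_re, Complex.mul_re, Complex.I_re,
      mul_zero, Complex.ofReal_im, Complex.I_im, mul_one, sub_self, add_zero, Complex.add_im,
      Complex.neg_im, neg_zero, Complex.mul_im, zero_add] at hrect
    have t1 : ‖∫ x in (-R)..R, G (x + (ε + R : ℝ) * Complex.I)‖ ≤ M ^ p * R ^ (-p) * |R - -R| := by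
      refine intervalIntegral.norm_integral_le_of_norm_le_const fun x _ => ?_
      refine hbound _ (by simp; linarith) _ hR ?_
      have := Complex.abs_im_le_norm (x + (ε + R : ℝ) * Complex.I)
      simp only [Complex.add_im, Complex.ofReal_im, Complex.mul_im, Complex.ofReal_re,
        Complex.I_im, mul_one, Complex.I_re, mul_zero, add_zero, zero_add] at this
      have := (le_abs_self _).trans this
      linarith
    have t2 : ∀ s : ℝ, |s| = R →
        ‖∫ y in ε..(ε + R), G (s + y * Complex.I)‖ ≤ M ^ p * R ^ (-p) * |ε + R - ε| := by
      intro s hs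
      refine intervalIntegral.norm_integral_le_of_norm_le_const fun y hy => ?_
      rw [Set.uIoc_of_le (by linarith)] at hy
      refine hbound _ (by simpa using hy.1.le) _ hR ?_
      have := Complex.abs_re_le_norm (s + y * Complex.I)
      simp only [Complex.add_re, Complex.ofReal_re, Complex.mul_re, Complex.I_re, mul_zero,
        Complex.ofReal_im, Complex.I_im, mul_one, sub_self, add_zero, hs] at this
      linarith
    have t3 := t2 R (abs_of_pos hR)
    have t4 := t2 (-R) (by rw [abs_neg, abs_of_pos hR])
    rw [show |R - -R| = 2 * R by rw [abs_of_pos] <;> linarith] at t1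
    rw [show |ε + R - ε| = R by rw [abs_of_pos] <;> linarith] at t3 t4
    push_cast at t1 t4 hrect
    set X := ∫ x in (-R)..R, G (x + ε * Complex.I)
    set Y := ∫ x in (-R)..R, G (x + (ε + R) * Complex.I)
    set Z := ∫ y in ε..(ε + R), G (R + y * Complex.I)
    set W := ∫ y in ε..(ε + R), G (-R + y * Complex.I)
    have hX : X = Y - Complex.I * Z + Complex.I * W := by
      simp only [smul_eq_mul] at hrect
      linear_combination hrect
    calc ‖X‖ ≤ ‖Y‖ + ‖Z‖ + ‖W‖ := by
          rw [hX]
          refine (norm_add_le _ _).trans ?_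
          refine add_le_add ((norm_sub_le _ _).trans ?_) ?_ <;> simp
      _ ≤ 4 * M ^ p * (R ^ (-p) * R) := by linarith
      _ = _ := by
          congr 1
          rw [← Real.rpow_add_one hR.ne']
          congr 1; ring
  · intro z hz
    have h2 : z.im ∈ Set.uIcc ε (ε + R) := by
      have := hz.2
      simpa using this
    rw [Set.uIcc_of_le (by linarith)] at h2
    exact hε.trans_le h2.1

/-! ### M. Riesz's theorem on conjugate functions -/

theorem lintegral_poissonKernel {ε : ℝ} (hε : 0 < ε) :
    ∫⁻ t : ℝ, ENNReal.ofReal (ε / (t ^ 2 + ε ^ 2)) = ENNReal.ofReal π := by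
  have h1 : ∀ t : ℝ, ε / (t ^ 2 + ε ^ 2) = ε⁻¹ * (1 + (t / ε) ^ 2)⁻¹ := fun t => by field_simp; ring
  have hi : Integrable fun t : ℝ => ε / (t ^ 2 + ε ^ 2) := by
    simp_rw [h1]
    exact (integrable_inv_one_add_sq.comp_div hε.ne').const_mul _
  rw [← ofReal_integral_eq_lintegral_ofReal hi (Eventually.of_forall fun t => by positivity)]
  congr 1
  simp_rw [h1]
  rw [integral_const_mul, Measure.integral_comp_div (fun t : ℝ => (1 + t ^ 2)⁻¹),
    integral_univ_inv_one_add_sq, abs_of_pos hε, smul_eq_mul]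
  field_simp

/-- Convolution of `f` with the conjugate Poisson kernel. -/
def conjConv (ε : ℝ) (f : ℝ → ℝ) (x : ℝ) : ℝ := ∫ y, conjKernel ε y * f (x - y)

theorem continuous_conjKernel {ε : ℝ} (hε : 0 < ε) : Continuous (conjKernel ε) :=
  continuous_id.div (by fun_prop) fun t => by positivity

theorem conjKernel_neg (ε t : ℝ) : conjKernel ε (-t) = -conjKernel ε t := by
  simp [conjKernel, neg_div]

theorem conjConv_eq (ε : ℝ) (f : ℝ → ℝ) (x : ℝ) :
    conjConv ε f x = ∫ t, conjKernel ε (x - t) * f t := by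
  rw [conjConv, ← integral_sub_left_eq_self (fun t => conjKernel ε t * f (x - t)) volume x]
  simp

/-- Convolutions of a continuous kernel with a continuous compactly supported function, depending
on a parameter, are continuous. -/
theorem continuous_integral_mul_of_support {X Y E : Type*} [TopologicalSpace X]
    [FirstCountableTopology X] [LocallyCompactSpace X] [TopologicalSpace Y] [MeasurableSpace Y]
    [OpensMeasurableSpace Y] [SecondCountableTopology Y] {μ : Measure Y}
    [IsLocallyFiniteMeasure μ] [NormedAddCommGroup E] [NormedSpace ℝ E]
    {g : X → Y → E} (hg : Continuous g.uncurry) {s : Set Y} (hs : IsCompact s)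
    (h0 : ∀ x, ∀ y ∉ s, g x y = 0) : Continuous fun x => ∫ y, g x y ∂μ := by
  have : (fun x => ∫ y, g x y ∂μ) = fun x => ∫ y in s, g x y ∂μ := by
    funext x
    exact (setIntegral_eq_integral_of_forall_compl_eq_zero fun y hy => h0 x y hy).symm
  rw [this]
  exact continuous_parametric_integral_of_continuous hg hs

theorem continuous_conjConv {ε : ℝ} (hε : 0 < ε) {f : ℝ → ℝ} (hf : Continuous f)
    (hs : HasCompactSupport f) : Continuous (conjConv ε f) := by
  have : conjConv ε f = fun x => ∫ t, conjKernel ε (x - t) * f t := funext (conjConv_eq ε f)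
  rw [this]
  refine continuous_integral_mul_of_support (s := tsupport f) ?_ hs ?_
  · have := continuous_conjKernel hε
    simp only [Function.uncurry_def]
    fun_prop
  · intro x y hy
    rw [image_eq_zero_of_notMem_tsupport hy, mul_zero]

theorem integrable_conjKernel_mul {ε : ℝ} (hε : 0 < ε) {f : ℝ → ℝ} (hf : Continuous f)
    (hs : HasCompactSupport f) (x : ℝ) : Integrable fun t => conjKernel ε (x - t) * f t := by
  have := continuous_conjKernel hε
  exact Continuous.integrable_of_hasCompactSupport (by fun_prop) hs.mul_left

theorem enorm_rpow_eq_ofReal {E : Type*} [NormedAddCommGroup E] (a : E) {p : ℝ} (hp : 0 ≤ p) :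
    ‖a‖ₑ ^ p = ENNReal.ofReal (‖a‖ ^ p) := by
  rw [← ofReal_norm, ENNReal.ofReal_rpow_of_nonneg (norm_nonneg _) hp]

/-- M. Riesz's theorem for nonnegative functions and `1 < p ≤ 2`. -/
theorem exists_lintegral_conjConv_le_of_nonneg {p : ℝ} (hp : 1 < p) (hp2 : p ≤ 2) :
    ∃ C : ℝ≥0∞, C ≠ ⊤ ∧ ∀ ε : ℝ, 0 < ε → ∀ f : ℝ → ℝ, Continuous f → HasCompactSupport f →
      (∀ t, 0 ≤ f t) → ∫⁻ x, ‖conjConv ε f x‖ₑ ^ p ≤ C * ∫⁻ x, ‖f x‖ₑ ^ p := by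
  have hp0 : 0 < p := by linarith
  obtain ⟨A, B, hA, hB, hAB⟩ := exists_abs_im_rpow_le hp hp2
  refine ⟨ENNReal.ofReal A * ENNReal.ofReal π ^ p, by finiteness, fun ε hε f hf hs hf0 => ?_⟩
  by_cases hne : f = 0
  · subst hne
    have : ∀ x, conjConv ε 0 x = 0 := fun x => by simp [conjConv]
    simp [this, hp0]
  set F : ℝ → ℂ := fun x => cauchyIntegral f (x + ε * Complex.I) with hF
  have him : ∀ x : ℝ, ((x : ℂ) + ε * Complex.I).im = ε := fun x => by simp
  have hre : ∀ x : ℝ, ((x : ℂ) + ε * Complex.I).re = x := fun x => by simp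
  have hpos : ∀ x, 0 < (F x).re := fun x =>
    cauchyIntegral_re_pos hf hs hf0 hne (by rw [him]; exact hε)
  have hv : ∀ x, conjConv ε f x = (F x).im := by
    intro x
    rw [hF, cauchyIntegral_im hf hs (by rw [him]; exact hε), him, hre, conjConv_eq]
    refine integral_congr_ae (Eventually.of_forall fun t => ?_)
    simp [conjKernel, mul_comm]
  have hu : ∀ x, (F x).re = ∫ t, (ε / (t ^ 2 + ε ^ 2)) * f (x - t) := by
    intro x
    rw [hF, cauchyIntegral_re hf hs (by rw [him]; exact hε), him, hre,
      ← integral_sub_left_eq_self _ volume x]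
    refine integral_congr_ae (Eventually.of_forall fun t => ?_)
    simp [mul_comm]
  obtain ⟨hGi, hG0⟩ := integral_cpow_cauchyIntegral_eq_zero hf hs hf0 hne hp hε
  have hFc : Continuous F := by
    rw [continuous_iff_continuousAt]
    intro x
    have h1 := (differentiableAt_cauchyIntegral hf hs
      (z := (x + ε * Complex.I)) (by rw [him]; exact hε)).continuousAt
    exact ContinuousAt.comp (f := fun x : ℝ => (x + ε * Complex.I : ℂ)) h1 (by fun_prop)
  have hnorm : ∀ x, ‖F x ^ (p : ℂ)‖ = ‖F x‖ ^ p := fun x => Complex.norm_cpow_real _ _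
  have hvi : Integrable fun x => |(F x).im| ^ p := by
    refine hGi.norm.mono' ?_ (Eventually.of_forall fun x => ?_)
    · exact (((Complex.continuous_im.comp hFc).abs).rpow_const
        fun x => Or.inr hp0.le).aestronglyMeasurable
    · rw [Real.norm_of_nonneg (by positivity)]
      change _ ≤ ‖F x ^ (p : ℂ)‖
      rw [hnorm]
      exact Real.rpow_le_rpow (abs_nonneg _) (Complex.abs_im_le_norm _) hp0.le
  have hui : Integrable fun x => (F x).re ^ p := by
    refine hGi.norm.mono' ?_ (Eventually.of_forall fun x => ?_)
    · exact ((Complex.continuous_re.comp hFc).rpow_const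
        fun x => Or.inr hp0.le).aestronglyMeasurable
    · rw [Real.norm_of_nonneg (Real.rpow_nonneg (hpos x).le p)]
      change _ ≤ ‖F x ^ (p : ℂ)‖
      rw [hnorm]
      exact Real.rpow_le_rpow (hpos x).le ((le_abs_self _).trans (Complex.abs_re_le_norm _)) hp0.le
  have hRe : ∫ x, (F x ^ (p : ℂ)).re = 0 := by
    have := Complex.reCLM.integral_comp_comm hGi
    simp only [Complex.reCLM_apply] at this
    rw [this, hG0, Complex.zero_re]
  have hGr : Integrable fun x => (F x ^ (p : ℂ)).re := hGi.re
  have hmain : ∫ x, |(F x).im| ^ p ≤ A * ∫ x, (F x).re ^ p := by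
    calc ∫ x, |(F x).im| ^ p ≤ ∫ x, (A * (F x).re ^ p - B * (F x ^ (p : ℂ)).re) := by
          refine integral_mono hvi ((hui.const_mul A).sub (hGr.const_mul B)) fun x => ?_
          exact hAB _ (hpos x)
      _ = _ := by
          rw [integral_sub (hui.const_mul A) (hGr.const_mul B), integral_const_mul,
            integral_const_mul, hRe, mul_zero, sub_zero]
  calc ∫⁻ x, ‖conjConv ε f x‖ₑ ^ p = ENNReal.ofReal (∫ x, |(F x).im| ^ p) := by
        rw [ofReal_integral_eq_lintegral_ofReal hvi (Eventually.of_forall fun x => by positivity)]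
        refine lintegral_congr fun x => ?_
        rw [enorm_rpow_eq_ofReal _ hp0.le, hv, Real.norm_eq_abs]
    _ ≤ ENNReal.ofReal A * ENNReal.ofReal (∫ x, (F x).re ^ p) := by
        rw [← ENNReal.ofReal_mul hA]
        exact ENNReal.ofReal_le_ofReal hmain
    _ = ENNReal.ofReal A * ∫⁻ x, ‖(F x).re‖ₑ ^ p := by
        rw [ofReal_integral_eq_lintegral_ofReal hui
          (Eventually.of_forall fun x => Real.rpow_nonneg (hpos x).le p)]
        congr 1
        refine lintegral_congr fun x => ?_
        rw [enorm_rpow_eq_ofReal _ hp0.le, Real.norm_of_nonneg (hpos x).le]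
    _ ≤ ENNReal.ofReal A *
          ∫⁻ x, (∫⁻ t, ENNReal.ofReal (ε / (t ^ 2 + ε ^ 2)) * ‖f (x - t)‖ₑ) ^ p := by
        gcongr with x
        rw [hu]
        refine (enorm_integral_le_lintegral_enorm _).trans (lintegral_mono fun t => ?_)
        simp only []
        rw [enorm_mul, Real.enorm_of_nonneg (by positivity)]
    _ ≤ ENNReal.ofReal A * ((∫⁻ t, ENNReal.ofReal (ε / (t ^ 2 + ε ^ 2))) ^ p *
          ∫⁻ x, ‖f x‖ₑ ^ p) := by
        gcongr
        exact lintegral_conv_rpow_le hp (by fun_prop) (by fun_prop)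
    _ = _ := by rw [lintegral_poissonKernel hε, mul_assoc]

/-- M. Riesz's theorem for `1 < p ≤ 2`. -/
theorem exists_lintegral_conjConv_le_of_le_two {p : ℝ} (hp : 1 < p) (hp2 : p ≤ 2) :
    ∃ C : ℝ≥0∞, C ≠ ⊤ ∧ ∀ ε : ℝ, 0 < ε → ∀ f : ℝ → ℝ, Continuous f → HasCompactSupport f →
      ∫⁻ x, ‖conjConv ε f x‖ₑ ^ p ≤ C * ∫⁻ x, ‖f x‖ₑ ^ p := by
  have hp0 : 0 < p := by linarith
  obtain ⟨C, hC, h⟩ := exists_lintegral_conjConv_le_of_nonneg hp hp2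
  refine ⟨2 ^ (p - 1) * (C + C), by finiteness, fun ε hε f hf hs => ?_⟩
  set g : ℝ → ℝ := fun t => max (f t) 0
  set k : ℝ → ℝ := fun t => max (-f t) 0
  have hg : Continuous g := by fun_prop
  have hk : Continuous k := by fun_prop
  have hgs : HasCompactSupport g := hs.comp_left (g := fun t : ℝ => max t 0) (by simp)
  have hks : HasCompactSupport k := hs.comp_left (g := fun t : ℝ => max (-t) 0) (by simp)
  have hgk : ∀ t, f t = g t - k t := fun t => by
    rcases le_total (f t) 0 with h | h <;> simp [g, k, h]
  have hgf : ∀ t, ‖g t‖ₑ ≤ ‖f t‖ₑ := fun t => by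
    rw [enorm_le_iff_norm_le, Real.norm_eq_abs, Real.norm_eq_abs]
    rcases le_total (f t) 0 with h | h <;> simp [g, h]
  have hkf : ∀ t, ‖k t‖ₑ ≤ ‖f t‖ₑ := fun t => by
    rw [enorm_le_iff_norm_le, Real.norm_eq_abs, Real.norm_eq_abs]
    rcases le_total (f t) 0 with h | h <;> simp [k, h]
  have hsub : ∀ x, conjConv ε f x = conjConv ε g x - conjConv ε k x := fun x => by
    rw [conjConv_eq, conjConv_eq, conjConv_eq,
      ← integral_sub (integrable_conjKernel_mul hε hg hgs x)
      (integrable_conjKernel_mul hε hk hks x)]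
    refine integral_congr_ae (Eventually.of_forall fun t => ?_)
    simp only [hgk]; ring
  calc ∫⁻ x, ‖conjConv ε f x‖ₑ ^ p
      ≤ ∫⁻ x, 2 ^ (p - 1) * (‖conjConv ε g x‖ₑ ^ p + ‖conjConv ε k x‖ₑ ^ p) := by
        refine lintegral_mono fun x => ?_
        rw [hsub]
        exact (ENNReal.rpow_le_rpow enorm_sub_le hp0.le).trans
          (ENNReal.rpow_add_le_mul_rpow_add_rpow _ _ hp.le)
    _ = 2 ^ (p - 1) * ((∫⁻ x, ‖conjConv ε g x‖ₑ ^ p) + ∫⁻ x, ‖conjConv ε k x‖ₑ ^ p) := by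
        have := continuous_conjConv hε hg hgs
        have := continuous_conjConv hε hk hks
        rw [lintegral_const_mul _ (by fun_prop), lintegral_add_left (by fun_prop)]
    _ ≤ 2 ^ (p - 1) * (C * (∫⁻ x, ‖f x‖ₑ ^ p) + C * ∫⁻ x, ‖f x‖ₑ ^ p) := by
        gcongr
        · refine (h ε hε g hg hgs fun t => le_max_right _ _).trans ?_
          gcongr with x
          exact hgf x
        · refine (h ε hε k hk hks fun t => le_max_right _ _).trans ?_
          gcongr with x
          exact hkf x
    _ = _ := by ring

/-- Regularised Hilbert transforms are antisymmetric. -/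
theorem integral_conjConv_mul {ε : ℝ} (hε : 0 < ε) {f g : ℝ → ℝ} (hf : Continuous f)
    (hfs : HasCompactSupport f) (hg : Continuous g) (hgs : HasCompactSupport g) :
    ∫ x, conjConv ε f x * g x = -∫ x, f x * conjConv ε g x := by
  have hc := continuous_conjKernel hε
  have hsw : ∫ x, ∫ t, conjKernel ε (x - t) * f t * g x =
      ∫ t, ∫ x, conjKernel ε (x - t) * f t * g x := by
    refine integral_integral_swap ?_
    refine Continuous.integrable_of_hasCompactSupport
      (f := fun z : ℝ × ℝ => conjKernel ε (z.1 - z.2) * f z.2 * g z.1) (by fun_prop) ?_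
    refine HasCompactSupport.intro (hgs.prod hfs) fun z hz => ?_
    by_cases h1 : z.1 ∈ tsupport g
    · have h2 : z.2 ∉ tsupport f := fun h2 => hz ⟨h1, h2⟩
      simp [image_eq_zero_of_notMem_tsupport h2]
    · simp [image_eq_zero_of_notMem_tsupport h1]
  calc ∫ x, conjConv ε f x * g x = ∫ x, ∫ t, conjKernel ε (x - t) * f t * g x := by
        refine integral_congr_ae (Eventually.of_forall fun x => ?_)
        simp only [conjConv_eq]
        rw [integral_mul_const]
    _ = ∫ t, ∫ x, conjKernel ε (x - t) * f t * g x := hsw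
    _ = ∫ t, -(f t * conjConv ε g t) := by
        refine integral_congr_ae (Eventually.of_forall fun t => ?_)
        simp only [conjConv_eq]
        rw [← integral_const_mul, ← integral_neg]
        refine integral_congr_ae (Eventually.of_forall fun x => ?_)
        simp only []
        rw [← neg_sub t x, conjKernel_neg]
        ring
    _ = _ := integral_neg _

/-- Duality: if `|∫ u g| ≤ C ‖g‖_q` for all `g ∈ C_c`, where `u` is continuous, then
`‖u‖_p ≤ C`. -/
theorem lintegral_rpow_le_of_forall_integral_mul_le {p q : ℝ} (hpq : p.HolderConjugate q)
    (hp2 : 2 < p) {u : ℝ → ℝ} (hu : Continuous u) {C : ℝ≥0∞}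
    (h : ∀ g : ℝ → ℝ, Continuous g → HasCompactSupport g →
      ‖∫ x, u x * g x‖ₑ ≤ C * (∫⁻ x, ‖g x‖ₑ ^ q) ^ (1 / q)) :
    ∫⁻ x, ‖u x‖ₑ ^ p ≤ C ^ p := by
  have hp := hpq.pos
  have hq := hpq.symm.pos
  have key : ∀ n : ℕ, ∫⁻ x in Metric.closedBall 0 n, ‖u x‖ₑ ^ p ≤ C ^ p := by
    intro n
    obtain ⟨χ, hχ1, -, hχs, hχ01⟩ := exists_continuous_one_zero_of_isCompact
      (isCompact_closedBall (0 : ℝ) (n : ℝ)) (t := ∅) isClosed_empty (Set.disjoint_empty _)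
    -- test with `|u| ^ (p - 2) u`, cut off
    set g : ℝ → ℝ := fun x => |u x| ^ (p - 2) * u x * χ x with hg
    have hpow : Continuous fun x => |u x| ^ (p - 2) :=
      hu.abs.rpow_const fun x => Or.inr (by linarith)
    have hgc : Continuous g := (hpow.mul hu).mul χ.continuous
    have hgs : HasCompactSupport g := hχs.mul_left
    have hug : ∀ x, u x * g x = |u x| ^ p * χ x := by
      intro x
      by_cases hx : u x = 0
      · simp [hg, hx, hp.ne']
      have : 0 < |u x| := abs_pos.2 hx
      have e : |u x| ^ p = |u x| ^ (p - 2) * (u x * u x) := by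
        rw [← abs_mul_abs_self (u x), ← pow_two, ← Real.rpow_natCast, ← Real.rpow_add this]
        congr 1; push_cast; ring
      rw [e]; simp only [hg]; ring
    set J : ℝ → ℝ := fun x => |u x| ^ p * χ x with hJ
    have hJc : Continuous J := (hu.abs.rpow_const fun x => Or.inr hp.le).mul χ.continuous
    have hJi : Integrable J := hJc.integrable_of_hasCompactSupport hχs.mul_left
    have hJ0 : ∀ x, 0 ≤ J x := fun x => mul_nonneg (by positivity) (hχ01 x).1
    set I := ∫⁻ x, ENNReal.ofReal (J x) with hI
    have hIe : ENNReal.ofReal (∫ x, J x) = I :=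
      ofReal_integral_eq_lintegral_ofReal hJi (Eventually.of_forall hJ0)
    have hIfin : I ≠ ⊤ := by rw [← hIe]; exact ENNReal.ofReal_ne_top
    have h1 := h g hgc hgs
    simp only [hug] at h1
    rw [Real.enorm_of_nonneg (integral_nonneg hJ0), hIe] at h1
    have h2 : ∫⁻ x, ‖g x‖ₑ ^ q ≤ I := by
      refine lintegral_mono fun x => ?_
      simp only []
      rw [enorm_rpow_eq_ofReal _ hq.le]
      refine ENNReal.ofReal_le_ofReal ?_
      have hx := hχ01 x
      have e : ‖g x‖ = |u x| ^ (p - 1) * χ x := by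
        rw [hg, Real.norm_eq_abs, abs_mul, abs_mul, abs_of_nonneg hx.1]
        congr 1
        by_cases hx : u x = 0
        · simp [hx, (by linarith : p - 1 ≠ 0)]
        rw [abs_of_nonneg (by positivity), ← Real.rpow_add_one (abs_pos.2 hx).ne']
        congr 1; ring
      rw [e, Real.mul_rpow (by positivity) hx.1, ← Real.rpow_mul (abs_nonneg _)]
      have e2 : (p - 1) * q = p := by
        have := hpq.sub_one_mul_conj
        linarith
      rw [e2]
      have : χ x ^ q ≤ χ x := by
        conv_rhs => rw [← Real.rpow_one (χ x)]
        exact Real.rpow_le_rpow_of_exponent_ge' hx.1 hx.2 zero_le_one hpq.symm.lt.le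
      simp only [hJ]
      gcongr
    have h3 : I ≤ C * I ^ (1 / q) := h1.trans (by gcongr)
    have h4 : I ≤ C ^ p := by
      by_cases h0 : I = 0
      · simp [h0]
      have e3 : (1 : ℝ) / q = 1 - 1 / p := by
        have := hpq.inv_add_inv_eq_one
        simp only [one_div]; linarith
      have h5 : I ^ (1 / p) ≤ C := by
        have hI0 : I ^ (1 / q) ≠ 0 := by simp [h0, hIfin]
        have hIt : I ^ (1 / q) ≠ ⊤ := by finiteness
        have : I ^ (1 / p) * I ^ (1 / q) = I := by
          rw [← ENNReal.rpow_add _ _ h0 hIfin, e3]; simp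
        rw [← ENNReal.mul_le_mul_iff_left hI0 hIt, this]
        exact h3
      calc I = (I ^ (1 / p)) ^ p := by
            rw [← ENNReal.rpow_mul, one_div_mul_cancel hp.ne', ENNReal.rpow_one]
        _ ≤ C ^ p := by gcongr
    refine le_trans ?_ h4
    calc ∫⁻ x in Metric.closedBall 0 n, ‖u x‖ₑ ^ p
        ≤ ∫⁻ x in Metric.closedBall 0 n, ENNReal.ofReal (J x) := by
          refine setLIntegral_mono' measurableSet_closedBall fun x hx => ?_
          rw [enorm_rpow_eq_ofReal _ hp.le]
          have := hχ1 hx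
          simp only [Pi.one_apply] at this
          simp [hJ, this]
      _ ≤ I := setLIntegral_le_lintegral _ _
  have hmono : Monotone fun n : ℕ => Metric.closedBall (0 : ℝ) n := fun m n hmn =>
    Metric.closedBall_subset_closedBall (by exact_mod_cast hmn)
  have := setLIntegral_iUnion_of_directed (μ := volume) (fun x => ‖u x‖ₑ ^ p) hmono.directed_le
  rw [Metric.iUnion_closedBall_nat, setLIntegral_univ] at this
  rw [this]
  exact iSup_le key

/-- **M. Riesz's theorem**: the regularised Hilbert transforms are bounded on `L^p`, `1 < p < ∞`,
uniformly in the regularisation. -/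
theorem exists_lintegral_conjConv_le {p : ℝ} (hp : 1 < p) :
    ∃ C : ℝ≥0∞, C ≠ ⊤ ∧ ∀ ε : ℝ, 0 < ε → ∀ f : ℝ → ℝ, Continuous f → HasCompactSupport f →
      ∫⁻ x, ‖conjConv ε f x‖ₑ ^ p ≤ C * ∫⁻ x, ‖f x‖ₑ ^ p := by
  rcases le_or_gt p 2 with hp2 | hp2
  · exact exists_lintegral_conjConv_le_of_le_two hp hp2
  have hp0 : 0 < p := by linarith
  have hpq : p.HolderConjugate (Real.conjExponent p) := Real.HolderConjugate.conjExponent hp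
  set q := Real.conjExponent p with hq
  have hq2 : q ≤ 2 := by
    rw [hq, Real.conjExponent, div_le_iff₀ (by linarith)]; linarith
  obtain ⟨C, hC, h⟩ := exists_lintegral_conjConv_le_of_le_two hpq.symm.lt hq2
  have hq0 := hpq.symm.pos
  refine ⟨(C ^ (1 / q)) ^ p, by finiteness, fun ε hε f hf hs => ?_⟩
  have := lintegral_rpow_le_of_forall_integral_mul_le hpq hp2 (continuous_conjConv hε hf hs)
    (C := C ^ (1 / q) * (∫⁻ x, ‖f x‖ₑ ^ p) ^ (1 / p)) ?_
  · rwa [ENNReal.mul_rpow_of_nonneg _ _ hp0.le, ← ENNReal.rpow_mul, ← ENNReal.rpow_mul,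
      one_div_mul_cancel hp0.ne', ENNReal.rpow_one, ENNReal.rpow_mul] at this
  · intro g hg hgs
    have hgc := continuous_conjConv hε hg hgs
    rw [integral_conjConv_mul hε hf hs hg hgs, enorm_neg]
    calc ‖∫ x, f x * conjConv ε g x‖ₑ ≤ ∫⁻ x, ‖f x‖ₑ * ‖conjConv ε g x‖ₑ := by
          refine (enorm_integral_le_lintegral_enorm _).trans (lintegral_mono fun x => ?_)
          rw [enorm_mul]
      _ ≤ (∫⁻ x, ‖f x‖ₑ ^ p) ^ (1 / p) * (∫⁻ x, ‖conjConv ε g x‖ₑ ^ q) ^ (1 / q) :=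
          ENNReal.lintegral_mul_le_Lp_mul_Lq _ hpq (by fun_prop) (by fun_prop)
      _ ≤ (∫⁻ x, ‖f x‖ₑ ^ p) ^ (1 / p) * (C * ∫⁻ x, ‖g x‖ₑ ^ q) ^ (1 / q) := by
          gcongr
          exact h ε hε g hg hgs
      _ = _ := by
          rw [ENNReal.mul_rpow_of_nonneg _ _ (by positivity)]; ring

/-! ### Double Hilbert transforms in the plane and their rotations -/

/-- The point of the plane with given Cartesian coordinates. -/
def planeMk (z : ℝ × ℝ) : Plane := !₂[z.1, z.2]

@[simp] theorem planeMk_zero (z : ℝ × ℝ) : planeMk z 0 = z.1 := rfl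

@[simp] theorem planeMk_one (z : ℝ × ℝ) : planeMk z 1 = z.2 := rfl

theorem continuous_planeMk : Continuous planeMk := by
  refine (PiLp.continuous_toLp 2 _).comp (continuous_pi fun i => ?_)
  fin_cases i
  · exact continuous_fst
  · exact continuous_snd

theorem plane_norm_sq (x : Plane) : ‖x‖ ^ 2 = x 0 ^ 2 + x 1 ^ 2 := by
  rw [EuclideanSpace.real_norm_sq_eq, Fin.sum_univ_two]

theorem measurePreserving_planeMk : MeasurePreserving planeMk :=
  (PiLp.volume_preserving_toLp (Fin 2)).comp (volume_preserving_finTwoArrow ℝ).symm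

theorem measurableEmbedding_planeMk : MeasurableEmbedding planeMk :=
  (MeasurableEquiv.toLp 2 (Fin 2 → ℝ)).measurableEmbedding.comp
    (MeasurableEquiv.finTwoArrow (α := ℝ)).symm.measurableEmbedding

theorem lintegral_plane {F : Plane → ℝ≥0∞} (hF : Measurable F) :
    ∫⁻ x, F x = ∫⁻ s, ∫⁻ t, F (planeMk (s, t)) := by
  rw [← measurePreserving_planeMk.lintegral_comp hF, Measure.volume_eq_prod, lintegral_prod]
  exact (hF.comp measurePreserving_planeMk.measurable).aemeasurable

theorem integral_plane {F : Plane → ℝ} (hF : Integrable F) :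
    ∫ x, F x = ∫ s, ∫ t, F (planeMk (s, t)) := by
  rw [← measurePreserving_planeMk.integral_comp measurableEmbedding_planeMk,
    Measure.volume_eq_prod, integral_prod]
  exact (measurePreserving_planeMk.integrable_comp_emb measurableEmbedding_planeMk).2 hF

theorem abs_coord_le_norm (x : Plane) (i : Fin 2) : |x i| ≤ ‖x‖ := by
  simpa using PiLp.norm_apply_le x i

@[fun_prop]
theorem continuous_coord (i : Fin 2) : Continuous fun x : Plane => x i := by fun_prop

/-- The product kernel `q_ε(y₀) q_ε(y₁)`, a regularisation of `1 / (y₀ y₁)`. -/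
def prodKernel (ε : ℝ) (y : Plane) : ℝ := conjKernel ε (y 0) * conjKernel ε (y 1)

/-- The double Hilbert transform along the coordinate axes, regularised. -/
def prodConv (ε : ℝ) (f : Plane → ℝ) (x : Plane) : ℝ := ∫ y, prodKernel ε y * f (x - y)

theorem continuous_prodKernel {ε : ℝ} (hε : 0 < ε) : Continuous (prodKernel ε) := by
  have := continuous_conjKernel hε
  unfold prodKernel
  fun_prop

theorem prodConv_eq (ε : ℝ) (f : Plane → ℝ) (x : Plane) :
    prodConv ε f x = ∫ y, prodKernel ε (x - y) * f y := by
  rw [prodConv, ← integral_sub_left_eq_self (fun t => prodKernel ε t * f (x - t)) volume x]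
  simp

theorem continuous_prodConv {ε : ℝ} (hε : 0 < ε) {f : Plane → ℝ} (hf : Continuous f)
    (hs : HasCompactSupport f) : Continuous (prodConv ε f) := by
  rw [show prodConv ε f = fun x => ∫ y, prodKernel ε (x - y) * f y from funext (prodConv_eq ε f)]
  refine continuous_integral_mul_of_support (s := tsupport f) ?_ hs ?_
  · have := continuous_prodKernel hε
    simp only [Function.uncurry_def]
    fun_prop
  · intro x y hy
    rw [image_eq_zero_of_notMem_tsupport hy, mul_zero]

/-- The double Hilbert transform is bounded on `L^p`, by iterating the one-dimensional estimate. -/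
theorem lintegral_prodConv_le {p : ℝ} (hp : 1 < p) {C : ℝ≥0∞} {ε : ℝ} (hε : 0 < ε)
    (hC : ∀ f : ℝ → ℝ, Continuous f → HasCompactSupport f →
      ∫⁻ x, ‖conjConv ε f x‖ₑ ^ p ≤ C * ∫⁻ x, ‖f x‖ₑ ^ p)
    {f : Plane → ℝ} (hf : Continuous f) (hs : HasCompactSupport f) :
    ∫⁻ x, ‖prodConv ε f x‖ₑ ^ p ≤ C * C * ∫⁻ x, ‖f x‖ₑ ^ p := by
  obtain ⟨R, hR⟩ : ∃ R : ℝ, ∀ x, R < ‖x‖ → f x = 0 := by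
    obtain ⟨R, hR⟩ := hs.isCompact.isBounded.subset_closedBall 0
    refine ⟨R, fun x hx => image_eq_zero_of_notMem_tsupport fun h => ?_⟩
    have := hR h
    simp at this
    linarith
  have hc := continuous_conjKernel hε
  have hmk := continuous_planeMk
  have hRs : ∀ s t, R < |s| → f (planeMk (s, t)) = 0 := fun s t h =>
    hR _ (h.trans_le (by simpa using abs_coord_le_norm (planeMk (s, t)) 0))
  have hRt : ∀ s t, R < |t| → f (planeMk (s, t)) = 0 := fun s t h =>
    hR _ (h.trans_le (by simpa using abs_coord_le_norm (planeMk (s, t)) 1))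
  have hcs1 : ∀ s, HasCompactSupport fun t => f (planeMk (s, t)) := fun s =>
    HasCompactSupport.intro (isCompact_closedBall (0 : ℝ) R) fun t ht => hRt s t (by simpa using ht)
  set G : ℝ × ℝ → ℝ := fun z => conjConv ε (fun t => f (planeMk (z.1, t))) z.2 with hG
  have hGc : Continuous G := by
    have : G = fun z => ∫ t, conjKernel ε (z.2 - t) * f (planeMk (z.1, t)) :=
      funext fun z => conjConv_eq _ _ _
    rw [this]
    refine continuous_integral_mul_of_support (s := Metric.closedBall (0 : ℝ) R) ?_
      (isCompact_closedBall _ _) ?_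
    · simp only [Function.uncurry_def]; fun_prop
    · intro z t ht
      rw [hRt _ _ (by simpa using ht), mul_zero]
  have hGs : ∀ t, HasCompactSupport fun s => G (s, t) := fun t => by
    refine HasCompactSupport.intro (isCompact_closedBall (0 : ℝ) R) fun s hs => ?_
    have : ∀ t, f (planeMk (s, t)) = 0 := fun t => hRs s t (by simpa using hs)
    simp [hG, conjConv, this]
  have hpt : ∀ s t, prodConv ε f (planeMk (s, t)) = conjConv ε (fun s => G (s, t)) s := by
    intro s t
    have hk := continuous_prodKernel hε
    rw [prodConv_eq, integral_plane, conjConv_eq]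
    · refine integral_congr_ae (Eventually.of_forall fun s' => ?_)
      simp only [hG, conjConv_eq]
      rw [← integral_const_mul]
      refine integral_congr_ae (Eventually.of_forall fun t' => ?_)
      simp [prodKernel]
      ring
    · exact Continuous.integrable_of_hasCompactSupport (by fun_prop) hs.mul_left
  have hPc := continuous_prodConv hε hf hs
  have hp0 : 0 ≤ p := by linarith
  calc ∫⁻ x, ‖prodConv ε f x‖ₑ ^ p
      = ∫⁻ t, ∫⁻ s, ‖prodConv ε f (planeMk (s, t))‖ₑ ^ p := by
        rw [lintegral_plane (by fun_prop), lintegral_lintegral_swap]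
        exact ((hPc.comp hmk).enorm.measurable.pow_const p).aemeasurable
    _ ≤ ∫⁻ t, C * ∫⁻ s, ‖G (s, t)‖ₑ ^ p := by
        refine lintegral_mono fun t => ?_
        simp only [hpt]
        exact hC _ (by fun_prop) (hGs t)
    _ = C * ∫⁻ s, ∫⁻ t, ‖G (s, t)‖ₑ ^ p := by
        rw [lintegral_const_mul, lintegral_lintegral_swap]
        · exact ((hGc.comp continuous_swap).enorm.measurable.pow_const p).aemeasurable
        · exact Measurable.lintegral_prod_left' (f := fun z : ℝ × ℝ => ‖G z‖ₑ ^ p) (by fun_prop)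
    _ ≤ C * ∫⁻ s, C * ∫⁻ t, ‖f (planeMk (s, t))‖ₑ ^ p := by
        gcongr with s
        exact hC _ (by fun_prop) (hcs1 s)
    _ = _ := by
        rw [lintegral_const_mul, lintegral_plane (by fun_prop), mul_assoc]
        exact Measurable.lintegral_prod_right' (f := fun z : ℝ × ℝ => ‖f (planeMk z)‖ₑ ^ p)
          ((hf.comp hmk).enorm.measurable.pow_const p)

/-- Rotation of the plane by the angle `α`. -/
def planeRotation (α : ℝ) : Plane ≃ₗᵢ[ℝ] Plane :=
  (Complex.orthonormalBasisOneI.repr.symm.trans (rotation (Circle.exp α))).trans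
    Complex.orthonormalBasisOneI.repr

theorem planeRotation_zero (α : ℝ) (y : Plane) :
    planeRotation α y 0 = Real.cos α * y 0 - Real.sin α * y 1 := by
  simp [planeRotation, Complex.orthonormalBasisOneI_repr_apply]

theorem planeRotation_one (α : ℝ) (y : Plane) :
    planeRotation α y 1 = Real.cos α * y 1 + Real.sin α * y 0 := by
  simp [planeRotation, Complex.orthonormalBasisOneI_repr_apply]

theorem continuous_prodKernel_planeRotation {ε : ℝ} (hε : 0 < ε) :
    Continuous fun z : ℝ × Plane => prodKernel ε (planeRotation z.1 z.2) := by
  have := continuous_conjKernel hε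
  simp only [prodKernel, planeRotation_zero, planeRotation_one]
  fun_prop

theorem integrable_prod_restrict_Ioc {Ψ : Plane × ℝ → ℝ} (hΨ : Continuous Ψ) {K : Set Plane}
    (hK : IsCompact K) (h0 : ∀ y α, y ∉ K → Ψ (y, α) = 0) {a b : ℝ} :
    Integrable Ψ ((volume : Measure Plane).prod (volume.restrict (Set.Ioc a b))) := by
  have h1 : IntegrableOn Ψ (K ×ˢ Set.Icc a b) (volume.prod volume) :=
    hΨ.continuousOn.integrableOn_compact (hK.prod isCompact_Icc)
  have h2 : IntegrableOn Ψ (Set.univ ×ˢ Set.Icc a b) (volume.prod volume) :=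
    h1.of_forall_sdiff_eq_zero (MeasurableSet.univ.prod measurableSet_Icc) fun z hz =>
      h0 z.1 z.2 fun h => hz.2 ⟨h, hz.1.2⟩
  have h3 := h2.mono_set (Set.prod_mono_right (s := Set.univ)
    (Set.Ioc_subset_Icc_self (a := a) (b := b)))
  rwa [IntegrableOn, ← Measure.prod_restrict, Measure.restrict_univ] at h3

/-- The average of the rotated product kernels against an angular weight `w`. -/
def avgKernel (w : ℝ → ℝ) (ε : ℝ) (y : Plane) : ℝ :=
  ∫ α in (0 : ℝ)..(2 * π), w α * prodKernel ε (planeRotation α y)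

/-- Conjugation by a rotation preserves Lebesgue norms, so the rotated kernels are bounded with the
same constant. -/
theorem lintegral_rotated_prodConv_le {p : ℝ} (hp : 1 < p) {C : ℝ≥0∞} {ε : ℝ} (hε : 0 < ε)
    (hC : ∀ f : ℝ → ℝ, Continuous f → HasCompactSupport f →
      ∫⁻ x, ‖conjConv ε f x‖ₑ ^ p ≤ C * ∫⁻ x, ‖f x‖ₑ ^ p)
    {f : Plane → ℝ} (hf : Continuous f) (hs : HasCompactSupport f) (α : ℝ) :
    ∫⁻ x, ‖∫ y, prodKernel ε (planeRotation α y) * f (x - y)‖ₑ ^ p ≤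
      C * C * ∫⁻ x, ‖f x‖ₑ ^ p := by
  set ρ := planeRotation α
  have hρ : MeasurePreserving ρ := ρ.measurePreserving
  have he : MeasurableEmbedding ρ := ρ.toHomeomorph.measurableEmbedding
  set g : Plane → ℝ := fun x => f (ρ.symm x) with hg
  have hgc : Continuous g := hf.comp ρ.symm.continuous
  have hgs : HasCompactSupport g := hs.comp_homeomorph ρ.symm.toHomeomorph
  have h1 : ∀ x, ∫ y, prodKernel ε (ρ y) * f (x - y) = prodConv ε g (ρ x) := by
    intro x
    rw [prodConv, ← hρ.integral_comp he (fun y => prodKernel ε y * g (ρ x - y))]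
    refine integral_congr_ae (Eventually.of_forall fun y => ?_)
    simp [hg]
  simp only [h1]
  rw [hρ.lintegral_comp_emb he (fun x => ‖prodConv ε g x‖ₑ ^ p)]
  refine (lintegral_prodConv_le hp hε hC hgc hgs).trans_eq ?_
  congr 1
  rw [← hρ.lintegral_comp_emb he]
  simp [hg]

/-- Convolution with the averaged kernel is the average of the convolutions with the rotated
kernels, by Fubini. -/
theorem integral_avgKernel_mul {ε : ℝ} (hε : 0 < ε) {w : ℝ → ℝ} (hw : Continuous w)
    {f : Plane → ℝ} (hf : Continuous f) (hs : HasCompactSupport f) (x : Plane) :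
    ∫ y, avgKernel w ε y * f (x - y) = ∫ α in Set.Ioc 0 (2 * π),
      w α * ∫ y, prodKernel ε (planeRotation α y) * f (x - y) := by
  have hk := continuous_prodKernel_planeRotation hε
  have hfx : Continuous fun y => f (x - y) := by fun_prop
  have hK : HasCompactSupport fun y => f (x - y) := by
    have := hs.comp_homeomorph (Homeomorph.subLeft x)
    exact this
  have h2 : Continuous fun z : Plane × ℝ => prodKernel ε (planeRotation z.2 z.1) :=
    Continuous.comp (g := fun z : ℝ × Plane => prodKernel ε (planeRotation z.1 z.2))
      (f := fun z : Plane × ℝ => (z.2, z.1)) hk (by fun_prop)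
  have hprod : Integrable (fun z : Plane × ℝ =>
      w z.2 * prodKernel ε (planeRotation z.2 z.1) * f (x - z.1))
      ((volume : Measure Plane).prod (volume.restrict (Set.Ioc 0 (2 * π)))) := by
    refine integrable_prod_restrict_Ioc ?_ hK.isCompact fun y α hy => ?_
    · exact ((hw.comp continuous_snd).mul h2).mul (hfx.comp continuous_fst)
    · simp only [image_eq_zero_of_notMem_tsupport hy, mul_zero]
  calc ∫ y, avgKernel w ε y * f (x - y)
      = ∫ y, ∫ α in Set.Ioc 0 (2 * π), w α * prodKernel ε (planeRotation α y) * f (x - y) := by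
        refine integral_congr_ae (Eventually.of_forall fun y => ?_)
        simp only [avgKernel]
        rw [intervalIntegral.integral_of_le Real.two_pi_pos.le, integral_mul_const]
    _ = ∫ α in Set.Ioc 0 (2 * π), ∫ y, w α * prodKernel ε (planeRotation α y) * f (x - y) :=
        integral_integral_swap hprod
    _ = _ := by
        refine integral_congr_ae (Eventually.of_forall fun α => ?_)
        simp only []
        rw [← integral_const_mul]
        simp only [mul_assoc]

/-- Averaging over rotations preserves `L^p` boundedness. -/
theorem lintegral_avgKernel_conv_le {p : ℝ} (hp : 1 < p) {C : ℝ≥0∞} {ε : ℝ} (hε : 0 < ε)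
    (hC : ∀ f : ℝ → ℝ, Continuous f → HasCompactSupport f →
      ∫⁻ x, ‖conjConv ε f x‖ₑ ^ p ≤ C * ∫⁻ x, ‖f x‖ₑ ^ p)
    {w : ℝ → ℝ} (hw : Continuous w) (hw1 : ∀ α, |w α| ≤ 1)
    {f : Plane → ℝ} (hf : Continuous f) (hs : HasCompactSupport f) :
    ∫⁻ x, ‖∫ y, avgKernel w ε y * f (x - y)‖ₑ ^ p ≤
      ENNReal.ofReal (2 * π) ^ p * (C * C) * ∫⁻ x, ‖f x‖ₑ ^ p := by
  have hπ := Real.two_pi_pos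
  have hp0 : 0 < p := by linarith
  have hk := continuous_prodKernel_planeRotation hε
  set ν : Measure ℝ := volume.restrict (Set.Ioc 0 (2 * π)) with hν
  have hνu : ν Set.univ = ENNReal.ofReal (2 * π) := by simp [hν]
  set Φ : ℝ → Plane → ℝ := fun α x => ∫ y, prodKernel ε (planeRotation α y) * f (x - y) with hΦ
  have hΦc : Continuous fun z : Plane × ℝ => Φ z.2 z.1 := by
    have : (fun z : Plane × ℝ => Φ z.2 z.1) =
        fun z : Plane × ℝ => ∫ y, prodKernel ε (planeRotation z.2 (z.1 - y)) * f y := by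
      funext z
      simp only [hΦ]
      rw [← integral_sub_left_eq_self (fun t => prodKernel ε (planeRotation z.2 t) * f (z.1 - t))
        volume z.1]
      simp
    rw [this]
    refine continuous_integral_mul_of_support (s := tsupport f) ?_ hs ?_
    · simp only [Function.uncurry_def]
      have : Continuous fun q : (Plane × ℝ) × Plane => (q.1.2, q.1.1 - q.2) := by fun_prop
      exact (hk.comp this).mul (by fun_prop)
    · intro x y hy
      rw [image_eq_zero_of_notMem_tsupport hy, mul_zero]
  have hswap : ∀ x, ∫ y, avgKernel w ε y * f (x - y) = ∫ α, w α * Φ α x ∂ν :=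
    integral_avgKernel_mul hε hw hf hs
  have hm : Measurable fun z : Plane × ℝ => ‖Φ z.2 z.1‖ₑ ^ p := hΦc.enorm.measurable.pow_const p
  calc ∫⁻ x, ‖∫ y, avgKernel w ε y * f (x - y)‖ₑ ^ p
      ≤ ∫⁻ x, (∫⁻ α, 1 * ‖Φ α x‖ₑ ∂ν) ^ p := by
        refine lintegral_mono fun x => ENNReal.rpow_le_rpow ?_ hp0.le
        rw [hswap]
        refine (enorm_integral_le_lintegral_enorm _).trans (lintegral_mono fun α => ?_)
        simp only []
        rw [enorm_mul]
        gcongr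
        rw [← ofReal_norm, Real.norm_eq_abs]
        exact ENNReal.ofReal_le_one.2 (hw1 α)
    _ ≤ ∫⁻ x, (∫⁻ _α, 1 ∂ν) ^ (p - 1) * ∫⁻ α, 1 * ‖Φ α x‖ₑ ^ p ∂ν := by
        refine lintegral_mono fun x => lintegral_mul_rpow_le hp aemeasurable_const ?_
        have : Continuous fun α => Φ α x := Continuous.comp (g := fun z : Plane × ℝ => Φ z.2 z.1)
          (f := fun α : ℝ => (x, α)) hΦc (by fun_prop)
        exact this.enorm.measurable.aemeasurable
    _ = ENNReal.ofReal (2 * π) ^ (p - 1) * ∫⁻ α, (∫⁻ x, ‖Φ α x‖ₑ ^ p) ∂ν := by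
        simp only [one_mul, lintegral_one, hνu]
        rw [lintegral_const_mul, lintegral_lintegral_swap]
        · exact hm.aemeasurable
        · exact Measurable.lintegral_prod_right' (f := fun z : Plane × ℝ => ‖Φ z.2 z.1‖ₑ ^ p) hm
    _ ≤ ENNReal.ofReal (2 * π) ^ (p - 1) * ∫⁻ _α, (C * C * ∫⁻ x, ‖f x‖ₑ ^ p) ∂ν := by
        refine mul_le_mul_right (lintegral_mono fun α => ?_) _
        exact lintegral_rotated_prodConv_le hp hε hC hf hs α
    _ = _ := by
        rw [lintegral_const, hνu, mul_comm (C * C * _), ← mul_assoc, ← mul_assoc]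
        congr 2
        conv_rhs => rw [show p = (p - 1) + 1 by ring,
          ENNReal.rpow_add_of_nonneg _ _ (by linarith) (by norm_num), ENNReal.rpow_one]

/-! ### The averaged kernels -/

/-- The angular integral to which the rotational averages reduce. -/
theorem integral_re_moebius {ρ : ℝ} (hρ0 : 0 ≤ ρ) (hρ1 : ρ < 1) :
    ∫ θ in (0 : ℝ)..(2 * π), (1 - Real.cos (4 * θ)) / (1 + ρ ^ 2 - 2 * ρ * Real.cos (4 * θ)) =
      2 * π / (1 + ρ) := by
  -- the mean value property of `(1 - z ^ 4) / (1 - ρ z ^ 4)` on the unit circle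
  set F : ℂ → ℂ := fun z => (1 - z ^ 4) / (1 - ρ * z ^ 4) with hF
  have hne : ∀ z : ℂ, ‖z‖ ≤ 1 → 1 - ρ * z ^ 4 ≠ 0 := by
    intro z hz h
    have h1 : (ρ : ℂ) * z ^ 4 = 1 := (sub_eq_zero.1 h).symm
    have h2 : ρ * ‖z‖ ^ 4 = 1 := by
      have := congrArg norm h1
      simpa [abs_of_nonneg hρ0] using this
    have h3 : ‖z‖ ^ 4 ≤ 1 := pow_le_one₀ (norm_nonneg _) hz
    nlinarith
  have hd : DiffContOnCl ℂ F (Metric.ball 0 |1|) := by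
    refine DifferentiableOn.diffContOnCl fun z hz => ?_
    rw [abs_one, closure_ball _ one_ne_zero] at hz
    have : ‖z‖ ≤ 1 := by simpa using hz
    have h1 : DifferentiableAt ℂ (fun z : ℂ => 1 - z ^ 4) z := by fun_prop
    have h2 : DifferentiableAt ℂ (fun z : ℂ => 1 - ρ * z ^ 4) z := by fun_prop
    exact (h1.div h2 (hne z this)).differentiableWithinAt
  have hmean := hd.circleAverage
  rw [Real.circleAverage_def] at hmean
  have hF0 : F 0 = 1 := by simp [hF]
  have hcm : ∀ θ : ℝ, circleMap 0 1 θ ^ 4 = Complex.exp ((4 * θ : ℝ) * Complex.I) := by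
    intro θ
    rw [circleMap_zero, Complex.ofReal_one, one_mul, ← Complex.exp_nat_mul]
    congr 1; push_cast; ring
  have hre : ∀ θ : ℝ, (F (circleMap 0 1 θ)).re = (1 + ρ) *
      ((1 - Real.cos (4 * θ)) / (1 + ρ ^ 2 - 2 * ρ * Real.cos (4 * θ))) := by
    intro θ
    have hsc := Real.sin_sq_add_cos_sq (4 * θ)
    have e : Complex.normSq (1 - ρ * (circleMap 0 1 θ) ^ 4) =
        1 + ρ ^ 2 - 2 * ρ * Real.cos (4 * θ) := by
      rw [hcm, Complex.normSq_apply]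
      simp [Complex.exp_ofReal_mul_I_re, Complex.exp_ofReal_mul_I_im, -Complex.ofReal_mul]
      linear_combination ρ ^ 2 * hsc
    have hn : Complex.normSq (1 - ρ * (circleMap 0 1 θ) ^ 4) ≠ 0 := by
      rw [Ne, Complex.normSq_eq_zero]
      exact hne _ (by simp)
    rw [Complex.div_re, e]
    rw [e] at hn
    rw [hcm]
    simp [Complex.exp_ofReal_mul_I_re, Complex.exp_ofReal_mul_I_im, -Complex.ofReal_mul]
    rw [mul_div_assoc', ← add_div]
    congr 1
    linear_combination ρ * hsc
  have hcont : Continuous fun θ : ℝ => F (circleMap 0 1 θ) := by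
    have h1 : Continuous fun θ : ℝ => circleMap 0 1 θ := continuous_circleMap 0 1
    refine Continuous.div (by fun_prop) (by fun_prop) fun θ => hne _ (by simp)
  have h2 : ∫ θ in (0 : ℝ)..(2 * π), (F (circleMap 0 1 θ)).re = 2 * π := by
    have h3 := Complex.reCLM.intervalIntegral_comp_comm
      (hcont.intervalIntegrable (μ := volume) 0 (2 * π))
    simp only [Complex.reCLM_apply] at h3
    rw [h3]
    have h4 : ∫ θ in (0 : ℝ)..(2 * π), F (circleMap 0 1 θ) = (2 * π : ℝ) := by
      rw [hF0, inv_smul_eq_iff₀ Real.two_pi_pos.ne'] at hmean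
      rw [hmean]; simp
    rw [h4, Complex.ofReal_re]
  simp only [hre] at h2
  rw [intervalIntegral.integral_const_mul] at h2
  rw [eq_div_iff (by linarith), mul_comm]; exact h2

/-- The radial factor of the averaged kernels; it tends to `4π / |y|⁴` as `ε → 0`. -/
def profile (ε : ℝ) (y : Plane) : ℝ :=
  4 * π / ((√(ε ^ 2 + ‖y‖ ^ 2) + ε) ^ 2 * ((ε ^ 2 + ‖y‖ ^ 2) + ε ^ 2))

/-- With `v = √(ε² + r²)` and `ρ = ((v - ε) / (v + ε))²` the integrand is a multiple of the one in
`integral_re_moebius`. -/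
theorem integral_sin_sq_div {ε r : ℝ} (hε : 0 < ε) :
    ∫ β in (0 : ℝ)..(2 * π), Real.sin (2 * β) ^ 2 /
        (((r * Real.cos β) ^ 2 + ε ^ 2) * ((r * Real.sin β) ^ 2 + ε ^ 2)) =
      8 * π / ((√(ε ^ 2 + r ^ 2) + ε) ^ 2 * ((ε ^ 2 + r ^ 2) + ε ^ 2)) := by
  set v := √(ε ^ 2 + r ^ 2) with hv
  have hv2 : v ^ 2 = ε ^ 2 + r ^ 2 := Real.sq_sqrt (by positivity)
  have hr2 : r ^ 2 = v ^ 2 - ε ^ 2 := by linarith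
  have hvε : ε ≤ v := Real.le_sqrt_of_sq_le (by nlinarith [sq_nonneg r])
  have hv0 : 0 < v := by linarith
  set ρ := ((v - ε) / (v + ε)) ^ 2 with hρ
  have hρ0 : 0 ≤ ρ := by positivity
  have hρ1 : ρ < 1 := by
    rw [hρ, sq_lt_one_iff_abs_lt_one, abs_of_nonneg (div_nonneg (by linarith) (by linarith)),
      div_lt_one (by linarith)]
    linarith
  have hpt : ∀ β : ℝ, Real.sin (2 * β) ^ 2 /
        (((r * Real.cos β) ^ 2 + ε ^ 2) * ((r * Real.sin β) ^ 2 + ε ^ 2)) =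
      8 / (v + ε) ^ 4 *
        ((1 - Real.cos (4 * β)) / (1 + ρ ^ 2 - 2 * ρ * Real.cos (4 * β))) := by
    intro β
    have h1 : Real.cos (4 * β) = 1 - 2 * Real.sin (2 * β) ^ 2 := by
      rw [show 4 * β = 2 * (2 * β) by ring, Real.cos_two_mul, Real.cos_sq']; ring
    have h2 : Real.sin (2 * β) = 2 * Real.sin β * Real.cos β := Real.sin_two_mul β
    have h3 := Real.sin_sq_add_cos_sq β
    have hden : ((r * Real.cos β) ^ 2 + ε ^ 2) * ((r * Real.sin β) ^ 2 + ε ^ 2) =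
        (v ^ 2 - ε ^ 2) ^ 2 * Real.sin (2 * β) ^ 2 / 4 + ε ^ 2 * v ^ 2 := by
      rw [h2, ← hr2, hv2]
      linear_combination (ε ^ 2 * r ^ 2) * h3
    have hden2 : 1 + ρ ^ 2 - 2 * ρ * Real.cos (4 * β) = 16 / (v + ε) ^ 4 *
        ((v ^ 2 - ε ^ 2) ^ 2 * Real.sin (2 * β) ^ 2 / 4 + ε ^ 2 * v ^ 2) := by
      rw [h1, hρ]
      have : v + ε ≠ 0 := by linarith
      field_simp
      ring
    rw [hden2, hden, h1]
    have hpos : 0 < (v ^ 2 - ε ^ 2) ^ 2 * Real.sin (2 * β) ^ 2 / 4 + ε ^ 2 * v ^ 2 := by positivity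
    have : v + ε ≠ 0 := by linarith
    field_simp
    ring
  simp_rw [hpt]
  rw [intervalIntegral.integral_const_mul, integral_re_moebius hρ0 hρ1, hρ, ← hv2]
  have : v + ε ≠ 0 := by linarith
  field_simp
  ring

/-- The integrand is odd under `β ↦ 2π - β`. -/
theorem integral_sin_cos_div (ε r : ℝ) :
    ∫ β in (0 : ℝ)..(2 * π), Real.cos (2 * β) * Real.sin (2 * β) /
        (((r * Real.cos β) ^ 2 + ε ^ 2) * ((r * Real.sin β) ^ 2 + ε ^ 2)) = 0 := by
  have h := intervalIntegral.integral_comp_sub_left (a := 0) (b := 2 * π)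
    (fun β => Real.cos (2 * β) * Real.sin (2 * β) /
        (((r * Real.cos β) ^ 2 + ε ^ 2) * ((r * Real.sin β) ^ 2 + ε ^ 2))) (2 * π)
  have e : ∀ β : ℝ, Real.cos (2 * (2 * π - β)) * Real.sin (2 * (2 * π - β)) /
        (((r * Real.cos (2 * π - β)) ^ 2 + ε ^ 2) * ((r * Real.sin (2 * π - β)) ^ 2 + ε ^ 2)) =
      -(Real.cos (2 * β) * Real.sin (2 * β) /
        (((r * Real.cos β) ^ 2 + ε ^ 2) * ((r * Real.sin β) ^ 2 + ε ^ 2))) := by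
    intro β
    have h1 : Real.cos (2 * (2 * π - β)) = Real.cos (2 * β) := by
      rw [show 2 * (2 * π - β) = ((2 : ℕ) : ℝ) * (2 * π) - 2 * β by push_cast; ring,
        Real.cos_nat_mul_two_pi_sub]
    have h2 : Real.sin (2 * (2 * π - β)) = -Real.sin (2 * β) := by
      rw [show 2 * (2 * π - β) = ((2 : ℕ) : ℝ) * (2 * π) - 2 * β by push_cast; ring,
        Real.sin_nat_mul_two_pi_sub]
    rw [h1, h2, Real.cos_two_pi_sub, Real.sin_two_pi_sub]
    simp [neg_div]
  simp only [e, sub_self, sub_zero, intervalIntegral.integral_neg] at h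
  linarith

theorem exists_polar (y : Plane) : ∃ φ : ℝ, y 0 = ‖y‖ * Real.cos φ ∧ y 1 = ‖y‖ * Real.sin φ := by
  set z : ℂ := ⟨y 0, y 1⟩
  have hz : ‖z‖ = ‖y‖ := by
    have h1 : ‖z‖ ^ 2 = ‖y‖ ^ 2 := by
      rw [plane_norm_sq, ← Complex.normSq_eq_norm_sq, Complex.normSq_apply]; ring
    exact (pow_left_inj₀ (norm_nonneg _) (norm_nonneg _) two_ne_zero).1 h1
  refine ⟨z.arg, ?_, ?_⟩
  · rw [← hz, Complex.norm_mul_cos_arg]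
  · rw [← hz, Complex.norm_mul_sin_arg]

/-- The rotational average of the product kernels, in polar coordinates: shift the angle of
integration by the polar angle `φ` of `y`. -/
theorem avgKernel_eq_of_polar {w : ℝ → ℝ} (hw : Function.Periodic w (2 * π)) {ε : ℝ}
    {y : Plane} {φ : ℝ} (h0 : y 0 = ‖y‖ * Real.cos φ)
    (h1 : y 1 = ‖y‖ * Real.sin φ) :
    avgKernel w ε y = ‖y‖ ^ 2 / 2 * ∫ β in (0 : ℝ)..(2 * π), w (β - φ) * Real.sin (2 * β) /
        (((‖y‖ * Real.cos β) ^ 2 + ε ^ 2) * ((‖y‖ * Real.sin β) ^ 2 + ε ^ 2)) := by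
  set g : ℝ → ℝ := fun β => w (β - φ) * Real.sin (2 * β) /
        (((‖y‖ * Real.cos β) ^ 2 + ε ^ 2) * ((‖y‖ * Real.sin β) ^ 2 + ε ^ 2)) with hg
  have hper : Function.Periodic g (2 * π) := by
    intro β
    simp only [hg, Real.cos_add_two_pi, Real.sin_add_two_pi]
    rw [show β + 2 * π - φ = (β - φ) + 2 * π by ring, hw,
      show 2 * (β + 2 * π) = 2 * β + ((2 : ℕ) : ℝ) * (2 * π) by push_cast; ring,
      Real.sin_add_nat_mul_two_pi]
  have hpt : ∀ α : ℝ, w α * prodKernel ε (planeRotation α y) = ‖y‖ ^ 2 / 2 * g (α + φ) := by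
    intro α
    have e0 : planeRotation α y 0 = ‖y‖ * Real.cos (α + φ) := by
      rw [planeRotation_zero, h0, h1, Real.cos_add]; ring
    have e1 : planeRotation α y 1 = ‖y‖ * Real.sin (α + φ) := by
      rw [planeRotation_one, h0, h1, Real.sin_add]; ring
    simp only [prodKernel, conjKernel, e0, e1, hg, add_sub_cancel_right, Real.sin_two_mul]
    rw [div_mul_div_comm, mul_div_assoc', mul_div_assoc']
    congr 1; ring
  unfold avgKernel
  simp_rw [hpt]
  rw [intervalIntegral.integral_const_mul, intervalIntegral.integral_comp_add_right, zero_add,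
    add_comm (2 * π) φ, hper.intervalIntegral_add_eq φ 0, zero_add]

theorem intervalIntegrable_angular {ε r : ℝ} (hε : 0 < ε) {g : ℝ → ℝ} (hg : Continuous g)
    (a b : ℝ) : IntervalIntegrable (fun β => g β /
        (((r * Real.cos β) ^ 2 + ε ^ 2) * ((r * Real.sin β) ^ 2 + ε ^ 2))) volume a b :=
  Continuous.intervalIntegrable (hg.div (by fun_prop) fun β => by positivity) a b

/-- In the limit `ε → 0` this kernel is a multiple of `(y₀² - y₁²) / |y|⁴`, the difference of the
pure second derivatives of `log |y|` up to a factor. -/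
theorem avgKernel_sin {ε : ℝ} (hε : 0 < ε) (y : Plane) :
    avgKernel (fun α => Real.sin (2 * α)) ε y = (y 0 * y 0 - y 1 * y 1) * profile ε y := by
  obtain ⟨φ, h0, h1⟩ := exists_polar y
  rw [avgKernel_eq_of_polar ?_ h0 h1]
  · have e : ∀ β : ℝ, Real.sin (2 * (β - φ)) * Real.sin (2 * β) /
        (((‖y‖ * Real.cos β) ^ 2 + ε ^ 2) * ((‖y‖ * Real.sin β) ^ 2 + ε ^ 2)) =
        Real.cos (2 * φ) * (Real.sin (2 * β) ^ 2 /
        (((‖y‖ * Real.cos β) ^ 2 + ε ^ 2) * ((‖y‖ * Real.sin β) ^ 2 + ε ^ 2))) -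
        Real.sin (2 * φ) * (Real.cos (2 * β) * Real.sin (2 * β) /
        (((‖y‖ * Real.cos β) ^ 2 + ε ^ 2) * ((‖y‖ * Real.sin β) ^ 2 + ε ^ 2))) := by
      intro β
      rw [mul_sub, Real.sin_sub]
      ring
    simp_rw [e]
    rw [intervalIntegral.integral_sub, intervalIntegral.integral_const_mul,
      intervalIntegral.integral_const_mul, integral_sin_sq_div hε, integral_sin_cos_div]
    · rw [profile, h0, h1, Real.cos_two_mul']
      ring
    · exact (intervalIntegrable_angular hε (by fun_prop) _ _).const_mul _
    · exact (intervalIntegrable_angular hε (by fun_prop) _ _).const_mul _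
  · intro α
    simp only []
    rw [show 2 * (α + 2 * π) = 2 * α + ((2 : ℕ) : ℝ) * (2 * π) by push_cast; ring,
      Real.sin_add_nat_mul_two_pi]

/-- In the limit `ε → 0` this kernel is a multiple of `y₀ y₁ / |y|⁴`, that is of `∂₀∂₁ log |y|`. -/
theorem avgKernel_cos {ε : ℝ} (hε : 0 < ε) (y : Plane) :
    avgKernel (fun α => Real.cos (2 * α)) ε y = 2 * (y 0 * y 1 * profile ε y) := by
  obtain ⟨φ, h0, h1⟩ := exists_polar y
  rw [avgKernel_eq_of_polar ?_ h0 h1]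
  · have e : ∀ β : ℝ, Real.cos (2 * (β - φ)) * Real.sin (2 * β) /
        (((‖y‖ * Real.cos β) ^ 2 + ε ^ 2) * ((‖y‖ * Real.sin β) ^ 2 + ε ^ 2)) =
        Real.cos (2 * φ) * (Real.cos (2 * β) * Real.sin (2 * β) /
        (((‖y‖ * Real.cos β) ^ 2 + ε ^ 2) * ((‖y‖ * Real.sin β) ^ 2 + ε ^ 2))) +
        Real.sin (2 * φ) * (Real.sin (2 * β) ^ 2 /
        (((‖y‖ * Real.cos β) ^ 2 + ε ^ 2) * ((‖y‖ * Real.sin β) ^ 2 + ε ^ 2))) := by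
      intro β
      rw [mul_sub, Real.cos_sub]
      ring
    simp_rw [e]
    rw [intervalIntegral.integral_add, intervalIntegral.integral_const_mul,
      intervalIntegral.integral_const_mul, integral_sin_sq_div hε, integral_sin_cos_div]
    · rw [profile, h0, h1, Real.sin_two_mul]
      ring
    · exact (intervalIntegrable_angular hε (by fun_prop) _ _).const_mul _
    · exact (intervalIntegrable_angular hε (by fun_prop) _ _).const_mul _
  · intro α
    simp only []
    rw [show 2 * (α + 2 * π) = 2 * α + ((2 : ℕ) : ℝ) * (2 * π) by push_cast; ring,
      Real.cos_add_nat_mul_two_pi]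

/-! ### Kernels in the plane -/

/-- The components `wᵢ / |w|²` of the gradient of `log |w|`. -/
def gradLog (i : Fin 2) (w : Plane) : ℝ := w i / ‖w‖ ^ 2

theorem finrank_plane : Module.finrank ℝ Plane = 2 := by simp

theorem integrableOn_norm_rpow_ball {s : ℝ} (hs : s < 2) (R : ℝ) :
    IntegrableOn (fun w : Plane => ‖w‖ ^ (-s)) (Metric.ball 0 R) := by
  rw [integrableOn_fun_norm_addHaar (volume : Measure Plane) (f := fun r : ℝ => r ^ (-s)),
    finrank_plane]
  rcases le_or_gt R 0 with hR | hR
  · simp [Set.Ioo_eq_empty (not_lt.2 hR)]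
  refine IntegrableOn.congr_fun (f := fun r : ℝ => r ^ (1 - s)) ?_ (fun r hr => ?_)
    measurableSet_Ioo
  · exact (intervalIntegral.integrableOn_Ioo_rpow_iff hR).2 (by linarith)
  · simp only [smul_eq_mul]
    rw [show (2 - 1 : ℕ) = 1 from rfl, pow_one, Real.rpow_sub hr.1, Real.rpow_one,
      Real.rpow_neg hr.1.le, div_eq_mul_inv]

theorem integrableOn_norm_rpow_compl_ball {s : ℝ} (hs : 2 < s) :
    IntegrableOn (fun w : Plane => ‖w‖ ^ (-s)) (Metric.ball 0 1)ᶜ := by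
  rw [← integrable_indicator_iff measurableSet_ball.compl]
  have h : Integrable (fun w : Plane => (Set.Ici (1 : ℝ)).indicator (fun r => r ^ (-s)) ‖w‖) := by
    rw [integrable_fun_norm_addHaar (volume : Measure Plane)
      (f := (Set.Ici (1 : ℝ)).indicator (fun r => r ^ (-s))), finrank_plane]
    have h1 : IntegrableOn (fun r : ℝ => r ^ (1 - s)) (Set.Ici 1) :=
      (integrableOn_Ici_iff_integrableOn_Ioi (by simp)).2
        (integrableOn_Ioi_rpow_of_lt (by linarith) one_pos)
    refine Integrable.integrableOn ?_
    rw [← integrable_indicator_iff measurableSet_Ici] at h1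
    refine h1.congr (Eventually.of_forall fun r => ?_)
    by_cases hr : 1 ≤ r
    · have hr0 : 0 < r := by linarith
      simp only [Set.indicator, Set.mem_Ici, hr, if_true, smul_eq_mul]
      rw [show (2 - 1 : ℕ) = 1 from rfl, pow_one, Real.rpow_sub hr0, Real.rpow_one,
        Real.rpow_neg hr0.le, div_eq_mul_inv]
    · simp [Set.indicator, hr]
  refine h.congr (Eventually.of_forall fun w => ?_)
  simp [Set.indicator]

theorem locallyIntegrable_of_forall_ball {E : Type*} [NormedAddCommGroup E] {g : Plane → E}
    (h : ∀ R : ℝ, IntegrableOn g (Metric.ball 0 R)) : LocallyIntegrable g volume := by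
  intro x
  refine ⟨Metric.ball 0 (‖x‖ + 1), Metric.isOpen_ball.mem_nhds (by simp), h _⟩

theorem locallyIntegrable_norm_inv : LocallyIntegrable (fun w : Plane => ‖w‖⁻¹) volume := by
  refine locallyIntegrable_of_forall_ball fun R => ?_
  simpa [Real.rpow_neg_one] using integrableOn_norm_rpow_ball (s := 1) (by norm_num) R

theorem abs_gradLog_le (i : Fin 2) (w : Plane) : |gradLog i w| ≤ ‖w‖⁻¹ := by
  rw [gradLog, abs_div, abs_of_nonneg (by positivity : (0 : ℝ) ≤ ‖w‖ ^ 2)]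
  by_cases hw : ‖w‖ = 0
  · simp [hw]
  have : 0 < ‖w‖ := lt_of_le_of_ne (norm_nonneg _) (Ne.symm hw)
  rw [div_le_iff₀ (by positivity)]
  calc |w i| ≤ ‖w‖ := abs_coord_le_norm w i
    _ = ‖w‖⁻¹ * ‖w‖ ^ 2 := by field_simp

@[fun_prop]
theorem measurable_gradLog (i : Fin 2) : Measurable (gradLog i) :=
  (continuous_coord i).measurable.div (by fun_prop)

theorem locallyIntegrable_gradLog (i : Fin 2) : LocallyIntegrable (gradLog i) volume :=
  locallyIntegrable_norm_inv.mono (measurable_gradLog i).aestronglyMeasurable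
    (Eventually.of_forall fun w => by simpa using abs_gradLog_le i w)

theorem abs_log_le (r : ℝ) (hr : 0 ≤ r) : |Real.log r| ≤ r⁻¹ + r := by
  rcases hr.eq_or_lt with rfl | hr
  · simp
  have h1 := Real.log_le_sub_one_of_pos hr
  have h2 := Real.log_le_sub_one_of_pos (inv_pos.2 hr)
  rw [Real.log_inv] at h2
  have : 0 < r⁻¹ := inv_pos.2 hr
  rw [abs_le]; constructor <;> linarith

theorem locallyIntegrable_log_norm :
    LocallyIntegrable (fun w : Plane => Real.log ‖w‖) volume := by
  refine (locallyIntegrable_norm_inv.add (continuous_norm.locallyIntegrable)).mono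
    (Real.measurable_log.comp measurable_norm).aestronglyMeasurable
    (Eventually.of_forall fun w => ?_)
  rw [Real.norm_eq_abs]
  refine (abs_log_le _ (norm_nonneg _)).trans (le_abs_self _)

theorem integrable_smul_comp_sub {E : Type*} [NormedAddCommGroup E] [NormedSpace ℝ E]
    {k : Plane → ℝ} (hk : LocallyIntegrable k volume) {g : Plane → E} (hg : Continuous g)
    (hs : HasCompactSupport g) (x : Plane) : Integrable fun w => k w • g (x - w) := by
  have h1 : Continuous fun w => g (x - w) := by fun_prop
  have h2 : HasCompactSupport fun w => g (x - w) := by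
    have := hs.comp_homeomorph (Homeomorph.subLeft x)
    exact this
  exact hk.integrable_smul_right_of_hasCompactSupport h1 h2

theorem fderiv_comp_sub_left {E : Type*} [NormedAddCommGroup E] [NormedSpace ℝ E]
    {f : Plane → E} (hf : Differentiable ℝ f) (x y e : Plane) :
    fderiv ℝ (fun y => f (x - y)) y e = -fderiv ℝ f (x - y) e := by
  have h : HasFDerivAt (fun y => f (x - y)) ((fderiv ℝ f (x - y)).comp
      (-ContinuousLinearMap.id ℝ Plane)) y :=
    (hf (x - y)).hasFDerivAt.comp y ((hasFDerivAt_id y).const_sub x)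
  rw [h.fderiv]
  simp

/-- Integration by parts in a convolution. -/
theorem integral_fderiv_smul_comp_sub {E : Type*} [NormedAddCommGroup E] [NormedSpace ℝ E]
    {k : Plane → ℝ} {f : Plane → E}
    (hk : Differentiable ℝ k) (hf : Differentiable ℝ f) (x e : Plane)
    (h1 : Integrable fun y => fderiv ℝ k y e • f (x - y))
    (h2 : Integrable fun y => k y • fderiv ℝ f (x - y) e)
    (h3 : Integrable fun y => k y • f (x - y)) :
    ∫ y, fderiv ℝ k y e • f (x - y) = ∫ y, k y • fderiv ℝ f (x - y) e := by
  have h := integral_smul_fderiv_eq_neg_fderiv_smul_of_integrable (μ := volume) (𝕜 := ℝ)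
    (f := k) (g := fun y => f (x - y)) (v := e) h1 ?_ h3 (fun x _ => hk x) ?_
  · simp only [fderiv_comp_sub_left hf, smul_neg, integral_neg, neg_inj] at h
    exact h.symm
  · simp only [fderiv_comp_sub_left hf, smul_neg]
    exact h2.neg
  · intro y _
    exact DifferentiableAt.comp y (hf (x - y)) (by fun_prop)

theorem integral_fderiv_smul_comp_sub_of_hasCompactSupport {E : Type*} [NormedAddCommGroup E]
    [NormedSpace ℝ E] {k : Plane → ℝ} {f : Plane → E}
    (hk : ContDiff ℝ 1 k) (hf : ContDiff ℝ 1 f) (hs : HasCompactSupport f) (x e : Plane) :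
    ∫ y, fderiv ℝ k y e • f (x - y) = ∫ y, k y • fderiv ℝ f (x - y) e := by
  have hf' : Continuous fun y => fderiv ℝ f y e :=
    (hf.continuous_fderiv one_ne_zero).clm_apply continuous_const
  have hs' : HasCompactSupport fun y => fderiv ℝ f y e := hs.fderiv_apply (𝕜 := ℝ) e
  have hk' : Continuous fun y => fderiv ℝ k y e :=
    (hk.continuous_fderiv one_ne_zero).clm_apply continuous_const
  exact integral_fderiv_smul_comp_sub (hk.differentiable one_ne_zero)
    (hf.differentiable one_ne_zero) x e
    (integrable_smul_comp_sub hk'.locallyIntegrable hf.continuous hs x)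
    (integrable_smul_comp_sub hk.continuous.locallyIntegrable hf' hs' x)
    (integrable_smul_comp_sub hk.continuous.locallyIntegrable hf.continuous hs x)

/-! ### Primitives of the averaged kernels -/

/-- A radial function whose gradient is `profile ε y • y`. As `ε → 0` it tends to
`-2π / |y|²`. -/
def czPotential (ε : ℝ) (y : Plane) : ℝ :=
  -(2 * π) * (ε ^ 2)⁻¹ *
    (Real.arctan (ε / √(ε ^ 2 + ‖y‖ ^ 2)) - ε / (√(ε ^ 2 + ‖y‖ ^ 2) + ε))

theorem hasFDerivAt_czPotential {ε : ℝ} (hε : 0 < ε) (y : Plane) :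
    HasFDerivAt (czPotential ε) (profile ε y • innerSL ℝ y) y := by
  have hs : HasFDerivAt (fun y : Plane => ‖y‖ ^ 2) ((2 : ℝ) • innerSL ℝ y) y := by
    have := (hasStrictFDerivAt_norm_sq y).hasFDerivAt
    rw [two_smul] at this
    rw [two_smul]; exact this
  set v := √(ε ^ 2 + ‖y‖ ^ 2) with hv
  have hpos : 0 < ε ^ 2 + ‖y‖ ^ 2 := by positivity
  have hv0 : 0 < v := Real.sqrt_pos.2 hpos
  have hv2 : v ^ 2 = ε ^ 2 + ‖y‖ ^ 2 := Real.sq_sqrt hpos.le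
  have hsqrt : HasDerivAt (fun s : ℝ => √(ε ^ 2 + s)) (1 / (2 * v)) (‖y‖ ^ 2) :=
    ((hasDerivAt_id _).const_add (ε ^ 2)).sqrt hpos.ne'
  have h1 : HasDerivAt (fun s : ℝ => -(2 * π) * (ε ^ 2)⁻¹ *
      (Real.arctan (ε / √(ε ^ 2 + s)) - ε / (√(ε ^ 2 + s) + ε)))
      (-(2 * π) * (ε ^ 2)⁻¹ * ((1 / (1 + (ε / v) ^ 2)) * ((0 * v - ε * (1 / (2 * v))) / v ^ 2) -
        (0 * (v + ε) - ε * (1 / (2 * v))) / (v + ε) ^ 2)) (‖y‖ ^ 2) :=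
    ((((hasDerivAt_const _ ε).div hsqrt hv0.ne').arctan).sub
      ((hasDerivAt_const _ ε).div (hsqrt.add_const ε) (by positivity))).const_mul _
  have h2 := h1.comp_hasFDerivAt y hs
  refine h2.congr_fderiv ?_
  rw [smul_smul]
  congr 1
  rw [profile, ← hv, ← hv2]
  field_simp
  ring

theorem hasFDerivAt_coord_mul_czPotential {ε : ℝ} (hε : 0 < ε) (i : Fin 2) (y : Plane) :
    HasFDerivAt (fun y : Plane => y i * czPotential ε y)
      (y i • (profile ε y • innerSL ℝ y) + czPotential ε y • EuclideanSpace.proj (𝕜 := ℝ) i) y :=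
  (EuclideanSpace.proj (𝕜 := ℝ) i : Plane →L[ℝ] ℝ).hasFDerivAt.mul (hasFDerivAt_czPotential hε y)

theorem continuous_profile {ε : ℝ} (hε : 0 < ε) : Continuous (profile ε) := by
  unfold profile
  refine continuous_const.div (by fun_prop) fun y => ?_
  positivity

theorem continuous_czPotential {ε : ℝ} (hε : 0 < ε) : Continuous (czPotential ε) :=
  continuous_iff_continuousAt.2 fun y => (hasFDerivAt_czPotential hε y).continuousAt

theorem contDiff_coord_mul_czPotential {ε : ℝ} (hε : 0 < ε) (i : Fin 2) :
    ContDiff ℝ 1 fun y : Plane => y i * czPotential ε y := by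
  rw [contDiff_one_iff_fderiv]
  refine ⟨fun y => (hasFDerivAt_coord_mul_czPotential hε i y).differentiableAt, ?_⟩
  have h1 := continuous_profile hε
  have h2 := continuous_czPotential hε
  have : fderiv ℝ (fun y : Plane => y i * czPotential ε y) = fun y =>
      (y i • (profile ε y • innerSL ℝ y) + czPotential ε y • EuclideanSpace.proj (𝕜 := ℝ) i) :=
    funext fun y => (hasFDerivAt_coord_mul_czPotential hε i y).fderiv
  rw [this]
  fun_prop

theorem fderiv_coord_mul_czPotential {ε : ℝ} (hε : 0 < ε) (i j : Fin 2) (y : Plane) :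
    fderiv ℝ (fun y : Plane => y i * czPotential ε y) y (basisVec j) =
      y i * y j * profile ε y + if i = j then czPotential ε y else 0 := by
  rw [(hasFDerivAt_coord_mul_czPotential hε i y).fderiv]
  simp [basisVec, EuclideanSpace.inner_single_right, PiLp.single_apply]
  ring

/-- `arctan x - x / (1 + x) = x² + O(x³)` in quantitative form, which controls `czPotential` as `ε
→ 0`. -/
theorem arctan_sub_bounds {x : ℝ} (h0 : 0 ≤ x) :
    x ^ 2 * ((1 - x) / ((1 + x ^ 2) * (1 + x))) ≤ Real.arctan x - x / (1 + x) ∧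
      Real.arctan x - x / (1 + x) ≤ x ^ 2 * (1 / (1 + x)) := by
  have hup : Real.arctan x ≤ x := by
    have h := Real.le_tan (Real.arctan_nonneg.2 h0) (Real.arctan_lt_pi_div_two x)
    rwa [Real.tan_arctan] at h
  have hlo : x / (1 + x ^ 2) ≤ Real.arctan x := by
    have hm : MonotoneOn (fun x : ℝ => Real.arctan x - x / (1 + x ^ 2)) (Set.Ici 0) := by
      have hd : ∀ x : ℝ, HasDerivAt (fun x : ℝ => Real.arctan x - x / (1 + x ^ 2))
          (1 / (1 + x ^ 2) - (1 * (1 + x ^ 2) - x * (2 * x)) / (1 + x ^ 2) ^ 2) x := fun x => by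
        have h2 : HasDerivAt (fun x : ℝ => 1 + x ^ 2) (2 * x) x := by
          simpa using (hasDerivAt_pow 2 x).const_add 1
        exact (Real.hasDerivAt_arctan x).sub ((hasDerivAt_id x).div h2 (by positivity))
      refine monotoneOn_of_deriv_nonneg (convex_Ici 0)
        (fun x _ => (hd x).continuousAt.continuousWithinAt)
        (fun x _ => (hd x).differentiableAt.differentiableWithinAt) fun x _ => ?_
      rw [(hd x).deriv]
      have : 1 / (1 + x ^ 2) - (1 * (1 + x ^ 2) - x * (2 * x)) / (1 + x ^ 2) ^ 2 =
          2 * x ^ 2 / (1 + x ^ 2) ^ 2 := by field_simp; ring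
      rw [this]; positivity
    have := hm (Set.mem_Ici.2 le_rfl) (Set.mem_Ici.2 h0) h0
    simp at this
    linarith
  constructor
  · have : x ^ 2 * ((1 - x) / ((1 + x ^ 2) * (1 + x))) = x / (1 + x ^ 2) - x / (1 + x) := by
      field_simp; ring
    linarith
  · have : x ^ 2 * (1 / (1 + x)) = x - x / (1 + x) := by field_simp; ring
    linarith

/-- `czPotential` in terms of the ratio `x = ε / √(ε² + |y|²)`, ready for `arctan_sub_bounds`. -/
theorem czPotential_eq {ε : ℝ} (hε : 0 < ε) (y : Plane) :
    czPotential ε y = -(2 * π) * ((ε ^ 2 + ‖y‖ ^ 2)⁻¹ *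
      (((ε / √(ε ^ 2 + ‖y‖ ^ 2)) ^ 2)⁻¹ * (Real.arctan (ε / √(ε ^ 2 + ‖y‖ ^ 2)) -
        (ε / √(ε ^ 2 + ‖y‖ ^ 2)) / (1 + ε / √(ε ^ 2 + ‖y‖ ^ 2))))) := by
  have hpos : 0 < ε ^ 2 + ‖y‖ ^ 2 := by positivity
  set v := √(ε ^ 2 + ‖y‖ ^ 2) with hv
  have hv0 : 0 < v := Real.sqrt_pos.2 hpos
  have hv2 : v ^ 2 = ε ^ 2 + ‖y‖ ^ 2 := Real.sq_sqrt hpos.le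
  rw [czPotential, ← hv, ← hv2]
  have e : ε / v / (1 + ε / v) = ε / (v + ε) := by field_simp
  rw [e]
  field_simp

theorem sandwich_arctan {x : ℝ} (h0 : 0 < x) :
    (1 - x) / ((1 + x ^ 2) * (1 + x)) ≤ (x ^ 2)⁻¹ * (Real.arctan x - x / (1 + x)) ∧
      (x ^ 2)⁻¹ * (Real.arctan x - x / (1 + x)) ≤ 1 / (1 + x) := by
  obtain ⟨ha, hb⟩ := arctan_sub_bounds h0.le
  constructor
  · rwa [← div_eq_inv_mul, le_div_iff₀ (by positivity), mul_comm]
  · rwa [← div_eq_inv_mul, div_le_iff₀ (by positivity), mul_comm]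

theorem ratio_le_one {ε : ℝ} (hε : 0 < ε) (y : Plane) :
    0 < ε / √(ε ^ 2 + ‖y‖ ^ 2) ∧ ε / √(ε ^ 2 + ‖y‖ ^ 2) ≤ 1 := by
  have hpos : 0 < ε ^ 2 + ‖y‖ ^ 2 := by positivity
  have hv0 := Real.sqrt_pos.2 hpos
  refine ⟨by positivity, (div_le_one hv0).2 (Real.le_sqrt_of_sq_le ?_)⟩
  nlinarith [sq_nonneg ‖y‖]

/-- A bound uniform in `ε`, for dominated convergence. -/
theorem abs_czPotential_le {ε : ℝ} (hε : 0 < ε) (y : Plane) (hy : y ≠ 0) :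
    |czPotential ε y| ≤ 2 * π * (‖y‖ ^ 2)⁻¹ := by
  obtain ⟨hx0, hx1⟩ := ratio_le_one hε y
  obtain ⟨ha, hb⟩ := sandwich_arctan hx0
  have hy' : 0 < ‖y‖ := norm_pos_iff.2 hy
  rw [czPotential_eq hε, abs_mul, abs_neg, abs_of_pos Real.two_pi_pos, abs_mul,
    abs_of_pos (by positivity : 0 < (ε ^ 2 + ‖y‖ ^ 2)⁻¹)]
  set x := ε / √(ε ^ 2 + ‖y‖ ^ 2)
  have h1 : |(x ^ 2)⁻¹ * (Real.arctan x - x / (1 + x))| ≤ 1 := by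
    rw [abs_of_nonneg]
    · exact hb.trans ((div_le_one (by linarith)).2 (by linarith))
    · refine le_trans ?_ ha
      exact div_nonneg (by linarith) (by positivity)
  calc 2 * π * ((ε ^ 2 + ‖y‖ ^ 2)⁻¹ * |(x ^ 2)⁻¹ * (Real.arctan x - x / (1 + x))|)
      ≤ 2 * π * ((‖y‖ ^ 2)⁻¹ * 1) := by
        gcongr
        nlinarith [sq_nonneg ε]
    _ = _ := by ring

theorem tendsto_czPotential {ε : ℕ → ℝ} (hε : ∀ n, 0 < ε n) (hlim : Tendsto ε atTop (𝓝 0))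
    {y : Plane} (hy : y ≠ 0) :
    Tendsto (fun n => czPotential (ε n) y) atTop (𝓝 (-(2 * π) * (‖y‖ ^ 2)⁻¹)) := by
  have hy' : 0 < ‖y‖ := norm_pos_iff.2 hy
  have hv : Tendsto (fun n => ε n ^ 2 + ‖y‖ ^ 2) atTop (𝓝 (‖y‖ ^ 2)) := by
    simpa using (hlim.pow 2).add_const (‖y‖ ^ 2)
  have hx : Tendsto (fun n => ε n / √(ε n ^ 2 + ‖y‖ ^ 2)) atTop (𝓝 0) := by
    have := hlim.div hv.sqrt (by positivity)
    rw [zero_div] at this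
    exact this
  have hA : Tendsto (fun n => ((ε n / √(ε n ^ 2 + ‖y‖ ^ 2)) ^ 2)⁻¹ *
      (Real.arctan (ε n / √(ε n ^ 2 + ‖y‖ ^ 2)) -
        (ε n / √(ε n ^ 2 + ‖y‖ ^ 2)) / (1 + ε n / √(ε n ^ 2 + ‖y‖ ^ 2)))) atTop (𝓝 1) := by
    refine tendsto_of_tendsto_of_tendsto_of_le_of_le (g := fun n =>
      (1 - (ε n / √(ε n ^ 2 + ‖y‖ ^ 2))) / ((1 + (ε n / √(ε n ^ 2 + ‖y‖ ^ 2)) ^ 2) *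
        (1 + (ε n / √(ε n ^ 2 + ‖y‖ ^ 2))))) (h := fun n => 1 / (1 + ε n / √(ε n ^ 2 + ‖y‖ ^ 2)))
      ?_ ?_ (fun n => (sandwich_arctan (ratio_le_one (hε n) y).1).1)
      (fun n => (sandwich_arctan (ratio_le_one (hε n) y).1).2)
    · have : ContinuousAt (fun x : ℝ => (1 - x) / ((1 + x ^ 2) * (1 + x))) 0 :=
        ContinuousAt.div (by fun_prop) (by fun_prop) (by norm_num)
      have h2 := this.tendsto.comp hx
      simpa [Function.comp_def] using h2
    · have : ContinuousAt (fun x : ℝ => 1 / (1 + x)) 0 :=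
        ContinuousAt.div (by fun_prop) (by fun_prop) (by norm_num)
      have h2 := this.tendsto.comp hx
      simpa [Function.comp_def] using h2
  have := ((hv.inv₀ (by positivity)).mul hA).const_mul (-(2 * π))
  rw [mul_one] at this
  refine this.congr fun n => (czPotential_eq (hε n) y).symm

theorem abs_coord_mul_czPotential_le {ε : ℝ} (hε : 0 < ε) (i : Fin 2) (y : Plane) :
    |y i * czPotential ε y| ≤ 2 * π * ‖y‖⁻¹ := by
  by_cases hy : y = 0
  · simp [hy]
  have hy' : 0 < ‖y‖ := norm_pos_iff.2 hy
  rw [abs_mul]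
  calc |y i| * |czPotential ε y| ≤ ‖y‖ * (2 * π * (‖y‖ ^ 2)⁻¹) :=
        mul_le_mul (abs_coord_le_norm y i) (abs_czPotential_le hε y hy) (abs_nonneg _) hy'.le
    _ = _ := by field_simp

theorem tendsto_coord_mul_czPotential {ε : ℕ → ℝ} (hε : ∀ n, 0 < ε n)
    (hlim : Tendsto ε atTop (𝓝 0)) (i : Fin 2) (y : Plane) :
    Tendsto (fun n => y i * czPotential (ε n) y) atTop (𝓝 (-(2 * π) * gradLog i y)) := by
  by_cases hy : y = 0
  · simp [hy, gradLog]
  have := (tendsto_czPotential hε hlim hy).const_mul (y i)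
  convert this using 2
  rw [gradLog, div_eq_mul_inv]; ring

theorem continuous_partialDeriv {f : Plane → 𝕜} (hf : ContDiff ℝ 1 f) (i : Fin 2) :
    Continuous (partialDeriv i f) :=
  (hf.continuous_fderiv one_ne_zero).clm_apply continuous_const

theorem hasCompactSupport_partialDeriv {f : Plane → 𝕜} (hs : HasCompactSupport f) (i : Fin 2) :
    HasCompactSupport (partialDeriv i f) :=
  hs.fderiv_apply (𝕜 := ℝ) _

/-- Convolution of a real kernel with a function; this is Mathlib's `convolution` with respect to
scalar multiplication, see `kconv_eq_convolution`. -/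
def kconv (k : Plane → ℝ) (f : Plane → 𝕜) (x : Plane) : 𝕜 := ∫ w, k w • f (x - w)

/-! ### Calderón–Zygmund estimates for the averaged kernels -/

theorem tendsto_integral_czPotential {ε : ℕ → ℝ} (hε : ∀ n, 0 < ε n)
    (hlim : Tendsto ε atTop (𝓝 0)) {f : Plane → ℝ} (hf : ContDiff ℝ 1 f)
    (hs : HasCompactSupport f) (i j : Fin 2) (x : Plane) :
    Tendsto (fun n => ∫ y, (y i * czPotential (ε n) y) * partialDeriv j f (x - y)) atTop
      (𝓝 (-(2 * π) * kconv (gradLog i) (partialDeriv j f) x)) := by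
  have hc := continuous_partialDeriv hf j
  have hd := hasCompactSupport_partialDeriv hs j
  rw [kconv, ← integral_const_mul]
  refine tendsto_integral_of_dominated_convergence
    (fun y => 2 * π * (‖y‖⁻¹ • ‖partialDeriv j f (x - y)‖)) (fun n => ?_) ?_ (fun n => ?_) ?_
  · have := (contDiff_coord_mul_czPotential (hε n) i).continuous
    exact Continuous.aestronglyMeasurable (by fun_prop)
  · exact (integrable_smul_comp_sub locallyIntegrable_norm_inv hc.norm hd.norm x).const_mul _
  · refine Eventually.of_forall fun y => ?_
    rw [norm_mul, smul_eq_mul, ← mul_assoc, Real.norm_eq_abs]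
    gcongr
    exact abs_coord_mul_czPotential_le (hε n) i y
  · refine Eventually.of_forall fun y => ?_
    simp only [smul_eq_mul]
    rw [← mul_assoc]
    exact (tendsto_coord_mul_czPotential hε hlim i y).mul_const _

/-- The kernel on the left is `∂ⱼ (yᵢ czPotential ε y)`; the derivative is moved to `f`, leaving a
kernel which is locally integrable uniformly in `ε`. -/
theorem integral_coord_mul_profile {ε : ℝ} (hε : 0 < ε) {f : Plane → ℝ} (hf : ContDiff ℝ 1 f)
    (hs : HasCompactSupport f) (i j : Fin 2) (x : Plane) :
    ∫ y, (y i * y j * profile ε y + if i = j then czPotential ε y else 0) * f (x - y) =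
      ∫ y, (y i * czPotential ε y) * partialDeriv j f (x - y) := by
  have h := integral_fderiv_smul_comp_sub_of_hasCompactSupport
    (contDiff_coord_mul_czPotential hε i) hf hs x (basisVec j)
  simp only [fderiv_coord_mul_czPotential hε, smul_eq_mul] at h
  exact h

theorem integral_avgKernel_cos_mul {ε : ℝ} (hε : 0 < ε) {f : Plane → ℝ} (hf : ContDiff ℝ 1 f)
    (hs : HasCompactSupport f) (x : Plane) :
    ∫ y, avgKernel (fun α => Real.cos (2 * α)) ε y * f (x - y) =
      2 * ∫ y, (y 0 * czPotential ε y) * partialDeriv 1 f (x - y) := by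
  rw [← integral_coord_mul_profile hε hf hs, ← integral_const_mul]
  refine integral_congr_ae (Eventually.of_forall fun y => ?_)
  simp [avgKernel_cos hε]
  ring

theorem integral_avgKernel_sin_mul {ε : ℝ} (hε : 0 < ε) {f : Plane → ℝ} (hf : ContDiff ℝ 1 f)
    (hs : HasCompactSupport f) (x : Plane) :
    ∫ y, avgKernel (fun α => Real.sin (2 * α)) ε y * f (x - y) =
      (∫ y, (y 0 * czPotential ε y) * partialDeriv 0 f (x - y)) -
        ∫ y, (y 1 * czPotential ε y) * partialDeriv 1 f (x - y) := by
  rw [← integral_coord_mul_profile hε hf hs, ← integral_coord_mul_profile hε hf hs,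
    ← integral_sub]
  · refine integral_congr_ae (Eventually.of_forall fun y => ?_)
    simp [avgKernel_sin hε]
    ring
  all_goals
    have h1 := continuous_profile hε
    have h2 := continuous_czPotential hε
    refine integrable_smul_comp_sub (Continuous.locallyIntegrable ?_) hf.continuous hs x
    simp only [if_true]
    fun_prop

/-- Passage to the limit in the `L^p` bounds for the averaged kernels. -/
theorem lintegral_le_of_tendsto_avgKernel {p : ℝ} (hp : 1 < p) :
    ∃ C : ℝ≥0∞, C ≠ ⊤ ∧ ∀ (w : ℝ → ℝ), Continuous w → (∀ α, |w α| ≤ 1) →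
      (∀ ε > 0, Continuous (avgKernel w ε)) → ∀ (f u : Plane → ℝ), Continuous f →
      HasCompactSupport f → (∀ x, Tendsto (fun n : ℕ => ∫ y, avgKernel w (1 / ((n : ℝ) + 1)) y *
        f (x - y)) atTop (𝓝 (u x))) →
      ∫⁻ x, ‖u x‖ₑ ^ p ≤ C * ∫⁻ x, ‖f x‖ₑ ^ p := by
  obtain ⟨C, hC, h⟩ := exists_lintegral_conjConv_le hp
  have hp0 : 0 < p := by linarith
  refine ⟨ENNReal.ofReal (2 * π) ^ p * (C * C), by finiteness, fun w hw hw1 hk f u hf hs hu => ?_⟩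
  set T : ℕ → Plane → ℝ := fun n x => ∫ y, avgKernel w (1 / ((n : ℝ) + 1)) y * f (x - y) with hT
  have hTc : ∀ n, Continuous (T n) := by
    intro n
    have hkn := hk (1 / ((n : ℝ) + 1)) (by positivity)
    have : T n = fun x => ∫ y, avgKernel w (1 / ((n : ℝ) + 1)) (x - y) * f y := by
      funext x
      simp only [hT]
      rw [← integral_sub_left_eq_self (fun t => avgKernel w _ t * f (x - t)) volume x]
      simp
    rw [this]
    refine continuous_integral_mul_of_support (s := tsupport f) ?_ hs ?_
    · simp only [Function.uncurry_def]
      fun_prop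
    · intro x y hy
      rw [image_eq_zero_of_notMem_tsupport hy, mul_zero]
  have hlim : ∀ x, ‖u x‖ₑ ^ p = liminf (fun n => ‖T n x‖ₑ ^ p) atTop := fun x =>
    ((ENNReal.continuous_rpow_const.tendsto _).comp
      ((continuous_enorm.tendsto _).comp (hu x))).liminf_eq.symm
  calc ∫⁻ x, ‖u x‖ₑ ^ p = ∫⁻ x, liminf (fun n => ‖T n x‖ₑ ^ p) atTop := lintegral_congr hlim
    _ ≤ liminf (fun n => ∫⁻ x, ‖T n x‖ₑ ^ p) atTop :=
        lintegral_liminf_le fun n => (hTc n).enorm.measurable.pow_const p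
    _ ≤ _ := by
        refine liminf_le_of_le ?_ fun b hb => ?_
        · isBoundedDefault
        · obtain ⟨n, hn⟩ := hb.exists
          exact hn.trans (lintegral_avgKernel_conv_le hp (by positivity)
            (h _ (by positivity)) hw hw1 hf hs)

theorem tendsto_one_div_nat : Tendsto (fun n : ℕ => 1 / ((n : ℝ) + 1)) atTop (𝓝 0) :=
  tendsto_one_div_add_atTop_nhds_zero_nat

/-- **Calderón–Zygmund estimate**, off-diagonal second derivatives of the logarithmic
potential of a real function. -/
theorem exists_lintegral_gradLog_offdiag_le {p : ℝ} (hp : 1 < p) :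
    ∃ C : ℝ≥0∞, C ≠ ⊤ ∧ ∀ f : Plane → ℝ, ContDiff ℝ 1 f → HasCompactSupport f →
      ∫⁻ x, ‖kconv (gradLog 0) (partialDeriv 1 f) x‖ₑ ^ p ≤ C * ∫⁻ x, ‖f x‖ₑ ^ p := by
  obtain ⟨C, hC, h⟩ := lintegral_le_of_tendsto_avgKernel hp
  have hp0 : 0 ≤ p := by linarith
  refine ⟨C, hC, fun f hf hs => le_trans ?_ (h (fun α => Real.cos (2 * α)) (by fun_prop)
    (fun α => Real.abs_cos_le_one _) (fun ε hε => ?_) f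
    (fun x => 2 * (-(2 * π) * kconv (gradLog 0) (partialDeriv 1 f) x)) hf.continuous hs
    fun x => ?_)⟩
  · refine lintegral_mono fun x => ENNReal.rpow_le_rpow ?_ hp0
    rw [enorm_le_iff_norm_le, norm_mul, norm_mul, ← mul_assoc]
    refine le_mul_of_one_le_left (norm_nonneg _) ?_
    rw [norm_neg, Real.norm_of_nonneg Real.two_pi_pos.le, Real.norm_two]
    nlinarith [Real.pi_gt_three]
  · have := continuous_profile hε
    rw [show avgKernel (fun α => Real.cos (2 * α)) ε = _ from funext (avgKernel_cos hε)]
    fun_prop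
  · have := (tendsto_integral_czPotential (fun n => by positivity) tendsto_one_div_nat hf hs
      0 1 x).const_mul 2
    refine this.congr fun n => (integral_avgKernel_cos_mul (by positivity) hf hs x).symm

/-- **Calderón–Zygmund estimate**, difference of the diagonal second derivatives of the
logarithmic potential of a real function. -/
theorem exists_lintegral_gradLog_diag_le {p : ℝ} (hp : 1 < p) :
    ∃ C : ℝ≥0∞, C ≠ ⊤ ∧ ∀ f : Plane → ℝ, ContDiff ℝ 1 f → HasCompactSupport f →
      ∫⁻ x, ‖kconv (gradLog 0) (partialDeriv 0 f) x - kconv (gradLog 1) (partialDeriv 1 f) x‖ₑ ^ p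
        ≤ C * ∫⁻ x, ‖f x‖ₑ ^ p := by
  obtain ⟨C, hC, h⟩ := lintegral_le_of_tendsto_avgKernel hp
  have hp0 : 0 ≤ p := by linarith
  refine ⟨C, hC, fun f hf hs => le_trans ?_ (h (fun α => Real.sin (2 * α)) (by fun_prop)
    (fun α => Real.abs_sin_le_one _) (fun ε hε => ?_) f
    (fun x => -(2 * π) * kconv (gradLog 0) (partialDeriv 0 f) x -
      -(2 * π) * kconv (gradLog 1) (partialDeriv 1 f) x) hf.continuous hs fun x => ?_)⟩
  · refine lintegral_mono fun x => ENNReal.rpow_le_rpow ?_ hp0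
    rw [enorm_le_iff_norm_le, ← mul_sub, norm_mul]
    refine le_mul_of_one_le_left (norm_nonneg _) ?_
    rw [norm_neg, Real.norm_of_nonneg Real.two_pi_pos.le]
    nlinarith [Real.pi_gt_three]
  · have := continuous_profile hε
    rw [show avgKernel (fun α => Real.sin (2 * α)) ε = _ from funext (avgKernel_sin hε)]
    fun_prop
  · have := (tendsto_integral_czPotential (fun n => by positivity) tendsto_one_div_nat hf hs
      0 0 x).sub (tendsto_integral_czPotential (fun n => by positivity) tendsto_one_div_nat hf hs
      1 1 x)
    refine this.congr fun n => (integral_avgKernel_sin_mul (by positivity) hf hs x).symm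

/-! ### The logarithmic kernel and its gradient -/

/-- The regularisation `log √(|y|² + ε²)` of `log |y|`. -/
def regLog (ε : ℝ) (y : Plane) : ℝ := Real.log (‖y‖ ^ 2 + ε ^ 2) / 2

/-- The components of the gradient of `regLog`. -/
def regGradLog (ε : ℝ) (i : Fin 2) (y : Plane) : ℝ := y i / (‖y‖ ^ 2 + ε ^ 2)

theorem hasFDerivAt_norm_sq_plane (y : Plane) :
    HasFDerivAt (fun y : Plane => ‖y‖ ^ 2) ((2 : ℝ) • innerSL ℝ y) y := by
  have := (hasStrictFDerivAt_norm_sq y).hasFDerivAt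
  rw [two_smul] at this
  rw [two_smul]; exact this

theorem inner_basisVec (y : Plane) (i : Fin 2) : inner ℝ y (basisVec i) = y i := by
  simp [basisVec, EuclideanSpace.inner_single_right]

theorem basisVec_apply (i j : Fin 2) : basisVec j i = if i = j then 1 else 0 := by
  simp [basisVec, PiLp.single_apply]

theorem hasFDerivAt_regLog {ε : ℝ} (hε : 0 < ε) (y : Plane) :
    HasFDerivAt (regLog ε) ((‖y‖ ^ 2 + ε ^ 2)⁻¹ • innerSL ℝ y) y := by
  have h1 := (((hasFDerivAt_norm_sq_plane y).add_const (ε ^ 2)).log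
    (by positivity : ‖y‖ ^ 2 + ε ^ 2 ≠ 0)).mul_const (2 : ℝ)⁻¹
  have e : regLog ε = fun y => Real.log (‖y‖ ^ 2 + ε ^ 2) * 2⁻¹ := by
    funext y; rw [regLog, div_eq_mul_inv]
  rw [e]
  refine h1.congr_fderiv ?_
  rw [smul_smul, smul_smul]
  congr 1
  ring

theorem contDiff_regLog {ε : ℝ} (hε : 0 < ε) : ContDiff ℝ 1 (regLog ε) := by
  unfold regLog
  refine ContDiff.div_const (ContDiff.log ?_ fun y => by positivity) _
  exact (contDiff_norm_sq ℝ).add contDiff_const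

theorem fderiv_regLog {ε : ℝ} (hε : 0 < ε) (y : Plane) (i : Fin 2) :
    fderiv ℝ (regLog ε) y (basisVec i) = regGradLog ε i y := by
  rw [(hasFDerivAt_regLog hε y).fderiv]
  simp only [_root_.smul_apply, innerSL_apply_apply, inner_basisVec, smul_eq_mul]
  rw [regGradLog, div_eq_inv_mul]

theorem abs_regGradLog_le (ε : ℝ) (i : Fin 2) (y : Plane) : |regGradLog ε i y| ≤ ‖y‖⁻¹ := by
  by_cases hy : y = 0
  · simp [hy, regGradLog]
  refine le_trans ?_ (abs_gradLog_le i y)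
  have hy' : 0 < ‖y‖ := norm_pos_iff.2 hy
  rw [regGradLog, gradLog, abs_div, abs_div, abs_of_nonneg (by positivity : 0 ≤ ‖y‖ ^ 2 + ε ^ 2),
    abs_of_nonneg (by positivity : 0 ≤ ‖y‖ ^ 2)]
  gcongr
  nlinarith [sq_nonneg ε]

theorem tendsto_regGradLog {ε : ℕ → ℝ} (hlim : Tendsto ε atTop (𝓝 0)) (i : Fin 2) (y : Plane) :
    Tendsto (fun n => regGradLog (ε n) i y) atTop (𝓝 (gradLog i y)) := by
  by_cases hy : y = 0
  · simp [hy, regGradLog, gradLog]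
  have hy' : 0 < ‖y‖ := norm_pos_iff.2 hy
  have hv : Tendsto (fun n => ‖y‖ ^ 2 + ε n ^ 2) atTop (𝓝 (‖y‖ ^ 2)) := by
    simpa using (hlim.pow 2).const_add (‖y‖ ^ 2)
  exact tendsto_const_nhds.div hv (by positivity)

theorem continuous_regGradLog {ε : ℝ} (hε : 0 < ε) (i : Fin 2) : Continuous (regGradLog ε i) := by
  unfold regGradLog
  exact (continuous_coord i).div (by fun_prop) fun y => by positivity

/-- A bound uniform in `ε`, for dominated convergence. -/
theorem abs_regLog_le {ε : ℝ} (hε : 0 < ε) (hε1 : ε ≤ 1) {y : Plane} (hy : y ≠ 0) :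
    |regLog ε y| ≤ |Real.log ‖y‖| + ‖y‖ ^ 2 := by
  have hy' : 0 < ‖y‖ := norm_pos_iff.2 hy
  have h1 : Real.log ‖y‖ ≤ regLog ε y := by
    rw [regLog, le_div_iff₀ two_pos, mul_comm, ← Real.log_rpow hy']
    refine Real.log_le_log (by positivity) ?_
    rw [Real.rpow_two]; nlinarith [sq_nonneg ε]
  have h2 : regLog ε y ≤ ‖y‖ ^ 2 := by
    have := Real.log_le_sub_one_of_pos (by positivity : 0 < ‖y‖ ^ 2 + ε ^ 2)
    rw [regLog]
    nlinarith
  have h3 := neg_abs_le (Real.log ‖y‖)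
  have h4 := abs_nonneg (Real.log ‖y‖)
  rw [abs_le]
  constructor <;> nlinarith [sq_nonneg ‖y‖]

theorem tendsto_regLog {ε : ℕ → ℝ} (hlim : Tendsto ε atTop (𝓝 0)) {y : Plane} (hy : y ≠ 0) :
    Tendsto (fun n => regLog (ε n) y) atTop (𝓝 (Real.log ‖y‖)) := by
  have hy' : 0 < ‖y‖ := norm_pos_iff.2 hy
  have hv : Tendsto (fun n => ‖y‖ ^ 2 + ε n ^ 2) atTop (𝓝 (‖y‖ ^ 2)) := by
    simpa using (hlim.pow 2).const_add (‖y‖ ^ 2)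
  have := (hv.log (by positivity)).div_const 2
  rw [Real.log_pow] at this
  simpa [regLog] using this

/-- `∇ log |w| = w / |w|²` in the sense of distributions. -/
theorem kconv_log_partialDeriv {f : Plane → 𝕜} (hf : ContDiff ℝ 1 f) (hs : HasCompactSupport f)
    (i : Fin 2) (x : Plane) :
    kconv (fun w => Real.log ‖w‖) (partialDeriv i f) x = kconv (gradLog i) f x := by
  have hc := continuous_partialDeriv hf i
  have hd := hasCompactSupport_partialDeriv hs i
  set ε : ℕ → ℝ := fun n => 1 / ((n : ℝ) + 1) with hεdef
  have hε : ∀ n, 0 < ε n := fun n => by positivity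
  have hε1 : ∀ n, ε n ≤ 1 := fun n => by
    rw [hεdef]; simp only []
    rw [div_le_one (by positivity)]
    have : (0 : ℝ) ≤ n := Nat.cast_nonneg n
    linarith
  have hibp : ∀ n, ∫ y, regGradLog (ε n) i y • f (x - y) =
      ∫ y, regLog (ε n) y • partialDeriv i f (x - y) := fun n => by
    have := integral_fderiv_smul_comp_sub_of_hasCompactSupport (contDiff_regLog (hε n)) hf hs x
      (basisVec i)
    simp only [fderiv_regLog (hε n)] at this
    exact this
  have hae : ∀ᵐ y : Plane, y ≠ 0 := by
    simp [ae_iff, measure_singleton]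
  have l1 : Tendsto (fun n => ∫ y, regGradLog (ε n) i y • f (x - y)) atTop
      (𝓝 (kconv (gradLog i) f x)) := by
    refine tendsto_integral_of_dominated_convergence (fun y => ‖y‖⁻¹ • ‖f (x - y)‖)
      (fun n => ?_) (integrable_smul_comp_sub locallyIntegrable_norm_inv hf.continuous.norm
        hs.norm x) (fun n => ?_) ?_
    · have := continuous_regGradLog (hε n) i
      have := hf.continuous
      exact Continuous.aestronglyMeasurable (by fun_prop)
    · refine Eventually.of_forall fun y => ?_
      rw [norm_smul, smul_eq_mul]
      gcongr
      exact abs_regGradLog_le _ i y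
    · exact Eventually.of_forall fun y =>
        (tendsto_regGradLog tendsto_one_div_nat i y).smul_const _
  have l2 : Tendsto (fun n => ∫ y, regLog (ε n) y • partialDeriv i f (x - y)) atTop
      (𝓝 (kconv (fun w => Real.log ‖w‖) (partialDeriv i f) x)) := by
    have hli : LocallyIntegrable (fun y : Plane => |Real.log ‖y‖| + ‖y‖ ^ 2) volume :=
      (locallyIntegrable_log_norm.mono
        (Real.measurable_log.comp measurable_norm).norm.aestronglyMeasurable
        (Eventually.of_forall fun y => (norm_norm _).le)).add
          (by fun_prop : Continuous fun y : Plane =>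
        ‖y‖ ^ 2).locallyIntegrable
    refine tendsto_integral_of_dominated_convergence
      (fun y => (|Real.log ‖y‖| + ‖y‖ ^ 2) • ‖partialDeriv i f (x - y)‖)
      (fun n => ?_) (integrable_smul_comp_sub hli hc.norm hd.norm x) (fun n => ?_) ?_
    · have := (contDiff_regLog (hε n)).continuous
      exact Continuous.aestronglyMeasurable (by fun_prop)
    · filter_upwards [hae] with y hy
      rw [norm_smul, smul_eq_mul]
      gcongr
      exact abs_regLog_le (hε n) (hε1 n) hy
    · filter_upwards [hae] with y hy
      exact (tendsto_regLog tendsto_one_div_nat hy).smul_const _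
  simp only [hibp] at l1
  exact tendsto_nhds_unique l2 l1

/-! ### Green's representation formula -/

/-- Up to scaling, the divergence of the regularised gradient `regGradLog` is this density: an
approximate identity of mass `2π`. -/
theorem integral_two_div_one_add_norm_sq :
    Integrable (fun z : Plane => 2 / (1 + ‖z‖ ^ 2) ^ 2) ∧
      ∫ z : Plane, 2 / (1 + ‖z‖ ^ 2) ^ 2 = 2 * π := by
  have hd : ∀ r : ℝ, HasDerivAt (fun r : ℝ => -(1 + r ^ 2)⁻¹) (r * (2 / (1 + r ^ 2) ^ 2)) r := by
    intro r
    have h1 : HasDerivAt (fun r : ℝ => 1 + r ^ 2) (2 * r) r := by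
      simpa using (hasDerivAt_pow 2 r).const_add 1
    have := (h1.inv (by positivity)).neg
    refine this.congr_deriv ?_
    field_simp
  have hlim : Tendsto (fun r : ℝ => -(1 + r ^ 2)⁻¹) atTop (𝓝 0) := by
    have : Tendsto (fun r : ℝ => 1 + r ^ 2) atTop atTop :=
      tendsto_atTop_add_const_left _ _ (tendsto_pow_atTop two_ne_zero)
    simpa using this.inv_tendsto_atTop.neg
  have hi : IntegrableOn (fun r : ℝ => r * (2 / (1 + r ^ 2) ^ 2)) (Set.Ioi 0) :=
    integrableOn_Ioi_deriv_of_nonneg' (fun r _ => hd r) (fun r (hr : 0 < r) => by positivity) hlim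
  have hI := integral_Ioi_of_hasDerivAt_of_tendsto' (a := 0) (fun r _ => hd r) hi hlim
  constructor
  · rw [integrable_fun_norm_addHaar (volume : Measure Plane)
      (f := fun r : ℝ => 2 / (1 + r ^ 2) ^ 2), finrank_plane]
    simpa using hi
  · rw [integral_fun_norm_addHaar (volume : Measure Plane)
      (fun r : ℝ => 2 / (1 + r ^ 2) ^ 2), finrank_plane]
    simp only [smul_eq_mul, Nat.reduceSub, pow_one, hI]
    have : (volume : Measure Plane).real (Metric.ball 0 1) = π := by
      simp [Measure.real, EuclideanSpace.volume_ball_fin_two, Real.pi_pos.le]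
    rw [this]
    simp

theorem hasFDerivAt_regGradLog {ε : ℝ} (hε : 0 < ε) (i : Fin 2) (y : Plane) :
    HasFDerivAt (regGradLog ε i)
      (y i • (-((‖y‖ ^ 2 + ε ^ 2) ^ 2)⁻¹ • ((2 : ℝ) • innerSL ℝ y)) +
        (‖y‖ ^ 2 + ε ^ 2)⁻¹ • (EuclideanSpace.proj (𝕜 := ℝ) i : Plane →L[ℝ] ℝ)) y := by
  have h1 : HasFDerivAt (fun y : Plane => (‖y‖ ^ 2 + ε ^ 2)⁻¹)
      (-((‖y‖ ^ 2 + ε ^ 2) ^ 2)⁻¹ • ((2 : ℝ) • innerSL ℝ y)) y :=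
    (hasDerivAt_inv (by positivity : ‖y‖ ^ 2 + ε ^ 2 ≠ 0)).comp_hasFDerivAt y
      ((hasFDerivAt_norm_sq_plane y).add_const (ε ^ 2))
  have h2 := (EuclideanSpace.proj (𝕜 := ℝ) i : Plane →L[ℝ] ℝ).hasFDerivAt.mul h1 (x := y)
  have e : regGradLog ε i = fun y => (EuclideanSpace.proj (𝕜 := ℝ) i : Plane →L[ℝ] ℝ) y *
      (‖y‖ ^ 2 + ε ^ 2)⁻¹ := by
    funext y; simp [regGradLog, div_eq_mul_inv]
  rw [e]
  exact h2

theorem fderiv_regGradLog {ε : ℝ} (hε : 0 < ε) (i : Fin 2) (y : Plane) :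
    fderiv ℝ (regGradLog ε i) y (basisVec i) =
      (‖y‖ ^ 2 + ε ^ 2)⁻¹ - 2 * y i ^ 2 * ((‖y‖ ^ 2 + ε ^ 2) ^ 2)⁻¹ := by
  rw [(hasFDerivAt_regGradLog hε i y).fderiv]
  simp [inner_basisVec, basisVec_apply]
  ring

theorem abs_regGradLog_le_const {ε : ℝ} (hε : 0 < ε) (i : Fin 2) (y : Plane) :
    |regGradLog ε i y| ≤ ε⁻¹ := by
  have h := abs_coord_le_norm y i
  rw [regGradLog, abs_div, abs_of_nonneg (by positivity : 0 ≤ ‖y‖ ^ 2 + ε ^ 2),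
    div_le_iff₀ (by positivity)]
  have : ‖y‖ ≤ ε⁻¹ * (‖y‖ ^ 2 + ε ^ 2) := by
    rw [← div_eq_inv_mul, le_div_iff₀ hε]
    nlinarith [sq_nonneg (‖y‖ - ε), sq_nonneg ‖y‖, sq_nonneg ε]
  linarith

theorem abs_fderiv_regGradLog_le {ε : ℝ} (hε : 0 < ε) (i : Fin 2) (y : Plane) :
    |fderiv ℝ (regGradLog ε i) y (basisVec i)| ≤ 2 * (ε ^ 2)⁻¹ := by
  rw [fderiv_regGradLog hε]
  set s := ‖y‖ ^ 2 + ε ^ 2 with hs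
  have hs0 : 0 < s := by positivity
  have h1 : s⁻¹ ≤ (ε ^ 2)⁻¹ := by
    apply inv_anti₀ (by positivity)
    nlinarith [sq_nonneg ‖y‖]
  have h2 : y i ^ 2 ≤ s := by
    have := sq_le_sq' (neg_le_of_abs_le (abs_coord_le_norm y i))
      (le_of_abs_le (abs_coord_le_norm y i))
    nlinarith [sq_nonneg ε]
  have h3 : y i ^ 2 * (s ^ 2)⁻¹ ≤ s⁻¹ := by
    calc y i ^ 2 * (s ^ 2)⁻¹ ≤ s * (s ^ 2)⁻¹ := by gcongr
      _ = s⁻¹ := by field_simp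
  have h4 : 0 ≤ y i ^ 2 * (s ^ 2)⁻¹ := by positivity
  have h5 : 0 < s⁻¹ := by positivity
  rw [abs_le]
  constructor <;> nlinarith

/-- Test functions for which Green's representation formula is proved: bounded and integrable
together with their gradient. -/
structure IsTame (φ : Plane → 𝕜) : Prop where
  contDiff : ContDiff ℝ 1 φ
  integrable : Integrable φ
  bounded : ∃ C, ∀ x, ‖φ x‖ ≤ C
  integrable_deriv : ∀ i, Integrable (partialDeriv i φ)
  bounded_deriv : ∃ C, ∀ i x, ‖partialDeriv i φ x‖ ≤ C

theorem isTame_of_hasCompactSupport {φ : Plane → 𝕜} (hφ : ContDiff ℝ 1 φ)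
    (hs : HasCompactSupport φ) : IsTame φ where
  contDiff := hφ
  integrable := hφ.continuous.integrable_of_hasCompactSupport hs
  bounded := hφ.continuous.bounded_above_of_compact_support hs |>.imp fun _ h => h
  integrable_deriv i := (continuous_partialDeriv hφ i).integrable_of_hasCompactSupport
    (hasCompactSupport_partialDeriv hs i)
  bounded_deriv := by
    have h := fun i => (continuous_partialDeriv hφ i).bounded_above_of_compact_support
      (hasCompactSupport_partialDeriv hs i)
    choose C hC using h
    exact ⟨max (C 0) (C 1), fun i x => (hC i x).trans (by fin_cases i <;> simp)⟩

theorem integrable_norm_inv_mul {g : Plane → ℝ} (hg : Integrable g) {C : ℝ}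
    (hC : ∀ x, ‖g x‖ ≤ C) (x : Plane) : Integrable fun y => ‖y‖⁻¹ * ‖g (x - y)‖ := by
  have h1 : IntegrableOn (fun y : Plane => C * ‖y‖⁻¹) (Metric.closedBall 0 1) :=
    (locallyIntegrable_norm_inv.integrableOn_isCompact (isCompact_closedBall 0 1)).const_mul C
  have h2 : Integrable fun y => ‖g (x - y)‖ := (hg.comp_sub_left x).norm
  have hC0 : 0 ≤ C := (norm_nonneg _).trans (hC 0)
  rw [← integrable_indicator_iff measurableSet_closedBall] at h1
  refine (h1.add h2).mono' ?_ (Eventually.of_forall fun y => ?_)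
  · exact (measurable_norm.inv.aestronglyMeasurable).mul h2.aestronglyMeasurable
  · rw [norm_mul, norm_norm, norm_inv, norm_norm]
    simp only [Pi.add_apply, Set.indicator, Metric.mem_closedBall, dist_zero_right]
    split_ifs with h
    · have : ‖y‖⁻¹ * ‖g (x - y)‖ ≤ C * ‖y‖⁻¹ := by
        rw [mul_comm]; gcongr; exact hC _
      linarith [norm_nonneg (g (x - y))]
    · have : ‖y‖⁻¹ ≤ 1 := inv_le_one_of_one_le₀ (not_le.1 h).le
      have h3 := norm_nonneg (g (x - y))
      nlinarith

/-- **Green's representation formula**: `∑ᵢ (wᵢ / |w|²) * ∂ᵢφ = 2π φ`. -/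
theorem sum_kconv_gradLog_partialDeriv {φ : Plane → 𝕜} (hφ : IsTame φ) (x : Plane) :
    ∑ i, kconv (gradLog i) (partialDeriv i φ) x = (2 * π) • φ x := by
  set ε : ℕ → ℝ := fun n => 1 / ((n : ℝ) + 1) with hεdef
  have hε : ∀ n, 0 < ε n := fun n => by positivity
  have hdiff := hφ.contDiff.differentiable one_ne_zero
  obtain ⟨C, hC⟩ := hφ.bounded
  obtain ⟨C', hC'⟩ := hφ.bounded_deriv
  have hreg : ∀ n i, Differentiable ℝ (regGradLog (ε n) i) := fun n i y =>
    (hasFDerivAt_regGradLog (hε n) i y).differentiableAt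
  have hφx : Integrable fun y => φ (x - y) := hφ.integrable.comp_sub_left x
  have hint1 : ∀ n i, Integrable fun y =>
      fderiv ℝ (regGradLog (ε n) i) y (basisVec i) • φ (x - y) := fun n i => by
    refine Integrable.bdd_smul (φ := fun y => fderiv ℝ (regGradLog (ε n) i) y (basisVec i))
      hφx (2 * (ε n ^ 2)⁻¹) ?_ (Eventually.of_forall fun y =>
      abs_fderiv_regGradLog_le (hε n) i y)
    exact (measurable_fderiv_apply_const ℝ _ _).aestronglyMeasurable
  have hint2 : ∀ n i, Integrable fun y =>
      regGradLog (ε n) i y • partialDeriv i φ (x - y) := fun n i => by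
    refine Integrable.bdd_smul (φ := regGradLog (ε n) i)
      ((hφ.integrable_deriv i).comp_sub_left x) (ε n)⁻¹ ?_
      (Eventually.of_forall fun y => abs_regGradLog_le_const (hε n) i y)
    exact (continuous_regGradLog (hε n) i).aestronglyMeasurable
  have hibp : ∀ n i, ∫ y, fderiv ℝ (regGradLog (ε n) i) y (basisVec i) • φ (x - y) =
      ∫ y, regGradLog (ε n) i y • partialDeriv i φ (x - y) := fun n i =>
    integral_fderiv_smul_comp_sub (hreg n i) hdiff x (basisVec i) (hint1 n i) (hint2 n i)
      (hφx.bdd_smul (ε n)⁻¹ (continuous_regGradLog (hε n) i).aestronglyMeasurable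
        (Eventually.of_forall fun y => abs_regGradLog_le_const (hε n) i y))
  have l1 : Tendsto (fun n => ∑ i, ∫ y, regGradLog (ε n) i y • partialDeriv i φ (x - y)) atTop
      (𝓝 (∑ i, kconv (gradLog i) (partialDeriv i φ) x)) := by
    refine tendsto_finsetSum _ fun i _ => ?_
    have hpc := continuous_partialDeriv hφ.contDiff i
    refine tendsto_integral_of_dominated_convergence
      (fun y => ‖y‖⁻¹ * ‖‖partialDeriv i φ (x - y)‖‖) (fun n => (hint2 n i).aestronglyMeasurable)
      (integrable_norm_inv_mul (hφ.integrable_deriv i).norm (C := C')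
        (fun y => by rw [norm_norm]; exact hC' i y) x) (fun n => ?_) ?_
    · refine Eventually.of_forall fun y => ?_
      rw [norm_smul, norm_norm]
      gcongr
      exact abs_regGradLog_le _ i y
    · exact Eventually.of_forall fun y =>
        (tendsto_regGradLog tendsto_one_div_nat i y).smul_const _
  obtain ⟨hki, hk⟩ := integral_two_div_one_add_norm_sq
  -- the divergence of `regGradLog ε` is `2 ε² / (|y|² + ε²)²`; substitute `y = ε z`
  have hsum : ∀ n, ∑ i, ∫ y, regGradLog (ε n) i y • partialDeriv i φ (x - y) =
      ∫ z : Plane, (2 / (1 + ‖z‖ ^ 2) ^ 2) • φ (x - ε n • z) := by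
    intro n
    simp only [← hibp]
    rw [← integral_finsetSum _ fun i _ => hint1 n i]
    have := Measure.integral_comp_smul (volume : Measure Plane)
      (fun y => ∑ i, fderiv ℝ (regGradLog (ε n) i) y (basisVec i) • φ (x - y)) (ε n)
    rw [finrank_plane, abs_of_pos (inv_pos.2 (pow_pos (hε n) 2)),
      eq_inv_smul_iff₀ (pow_pos (hε n) 2).ne', ← integral_smul] at this
    rw [← this]
    refine integral_congr_ae (Eventually.of_forall fun z => ?_)
    simp only [fderiv_regGradLog (hε n)]
    rw [← Finset.sum_smul, smul_smul, Fin.sum_univ_two, norm_smul, Real.norm_of_nonneg (hε n).le]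
    congr 1
    have hz := plane_norm_sq z
    simp only [PiLp.smul_apply, smul_eq_mul]
    have hn := hε n
    have h1 : (ε n * ‖z‖) ^ 2 + ε n ^ 2 = ε n ^ 2 * (1 + ‖z‖ ^ 2) := by ring
    rw [h1]
    have h2 : 0 < 1 + ‖z‖ ^ 2 := by positivity
    field_simp
    rw [hz]
    ring
  have l2 : Tendsto (fun n => ∫ z : Plane, (2 / (1 + ‖z‖ ^ 2) ^ 2) • φ (x - ε n • z)) atTop
      (𝓝 (∫ z : Plane, (2 / (1 + ‖z‖ ^ 2) ^ 2) • φ x)) := by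
    have hφc := hφ.contDiff.continuous
    refine tendsto_integral_of_dominated_convergence (fun z => (2 / (1 + ‖z‖ ^ 2) ^ 2) * C)
      (fun n => ?_) (hki.mul_const C) (fun n => ?_) ?_
    · exact hki.aestronglyMeasurable.smul (Continuous.aestronglyMeasurable (by fun_prop))
    · refine Eventually.of_forall fun z => ?_
      rw [norm_smul, Real.norm_of_nonneg (by positivity)]
      gcongr
      exact hC _
    · refine Eventually.of_forall fun z => Tendsto.const_smul ?_ _
      refine (hφc.tendsto x).comp ?_
      have : Tendsto (fun n => x - ε n • z) atTop (𝓝 (x - (0 : ℝ) • z)) :=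
        tendsto_const_nhds.sub (tendsto_one_div_nat.smul_const z)
      simpa using this
  rw [integral_smul_const, hk] at l2
  simp only [hsum] at l1
  exact tendsto_nhds_unique l1 l2

/-! ### The Calderón–Zygmund estimate for the logarithmic potential -/

theorem kconv_eq_convolution (k : Plane → ℝ) (f : Plane → 𝕜) :
    kconv k f = convolution k f (ContinuousLinearMap.lsmul ℝ ℝ) volume := rfl

theorem contDiff_kconv {k : Plane → ℝ} (hk : LocallyIntegrable k volume) {f : Plane → 𝕜}
    (hf : ContDiff ℝ ∞ f) (hs : HasCompactSupport f) : ContDiff ℝ ∞ (kconv k f) := by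
  rw [kconv_eq_convolution]
  exact hs.contDiff_convolution_right (n := (⊤ : ℕ∞)) _ hk hf

theorem partialDeriv_kconv {k : Plane → ℝ} (hk : LocallyIntegrable k volume) {f : Plane → 𝕜}
    (hf : ContDiff ℝ 1 f) (hs : HasCompactSupport f) (j : Fin 2) :
    partialDeriv j (kconv k f) = kconv k (partialDeriv j f) := by
  funext x
  have h := hs.hasFDerivAt_convolution_right (ContinuousLinearMap.lsmul ℝ ℝ) hk hf x
  rw [partialDeriv, kconv_eq_convolution, h.fderiv, convolution_precompR_apply _ hk
    (hs.fderiv (𝕜 := ℝ)) (hf.continuous_fderiv one_ne_zero)]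
  rfl

theorem contDiff_partialDeriv {f : Plane → 𝕜} (hf : ContDiff ℝ ∞ f) (i : Fin 2) :
    ContDiff ℝ ∞ (partialDeriv i f) :=
  (hf.fderiv_right (m := ∞) (by simp)).clm_apply contDiff_const

theorem partialDeriv_comm {f : Plane → 𝕜} (hf : ContDiff ℝ 2 f) (i j : Fin 2) :
    partialDeriv i (partialDeriv j f) = partialDeriv j (partialDeriv i f) := by
  funext x
  have hd : DifferentiableAt ℝ (fderiv ℝ f) x :=
    ((hf.fderiv_right (m := 1) (by norm_num)).differentiable one_ne_zero) x
  have key : ∀ a b : Fin 2, partialDeriv a (partialDeriv b f) x =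
      fderiv ℝ (fderiv ℝ f) x (basisVec a) (basisVec b) := by
    intro a b
    have h := hd.hasFDerivAt.clm_apply (hasFDerivAt_const (basisVec b) x)
    rw [partialDeriv]
    change fderiv ℝ (fun y => fderiv ℝ f y (basisVec b)) x (basisVec a) = _
    rw [h.fderiv]
    simp
  rw [key, key]
  exact (hf.contDiffAt.isSymmSndFDerivAt (by simp)) _ _

/-- Both sides are the second derivative `∂ᵢ∂ⱼ` of `log |·| * f`. -/
theorem kconv_gradLog_partialDeriv_comm {f : Plane → 𝕜} (hf : ContDiff ℝ ∞ f)
    (hs : HasCompactSupport f) (i j : Fin 2) :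
    kconv (gradLog i) (partialDeriv j f) = kconv (gradLog j) (partialDeriv i f) := by
  funext x
  have h1 : ∀ k : Fin 2, ContDiff ℝ 1 (partialDeriv k f) := fun k =>
    (contDiff_partialDeriv hf k).of_le (by simp)
  rw [← kconv_log_partialDeriv (h1 j) (hasCompactSupport_partialDeriv hs j),
    ← kconv_log_partialDeriv (h1 i) (hasCompactSupport_partialDeriv hs i),
    partialDeriv_comm (contDiff_infty.1 hf 2)]

theorem eLpNorm_le_of_lintegral_le {E F : Type*} [NormedAddCommGroup E] [NormedAddCommGroup F]
    {p : ℝ} (hp : 0 < p) {C : ℝ≥0∞} {u : Plane → E} {f : Plane → F}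
    (h : ∫⁻ x, ‖u x‖ₑ ^ p ≤ C * ∫⁻ x, ‖f x‖ₑ ^ p) :
    eLpNorm u (ENNReal.ofReal p) volume ≤ C ^ (1 / p) * eLpNorm f (ENNReal.ofReal p) volume := by
  have hp0 : ENNReal.ofReal p ≠ 0 := by simpa using hp
  rw [eLpNorm_eq_lintegral_rpow_enorm_toReal hp0 ENNReal.ofReal_ne_top,
    eLpNorm_eq_lintegral_rpow_enorm_toReal hp0 ENNReal.ofReal_ne_top,
    ENNReal.toReal_ofReal hp.le, ← ENNReal.mul_rpow_of_nonneg _ _ (by positivity)]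
  gcongr

/-- The off-diagonal second derivatives and the difference of the diagonal ones are bounded by
averaging double Hilbert transforms; the sum of the diagonal ones is `2π f` by Green's formula. -/
theorem exists_eLpNorm_kconv_gradLog_partialDeriv_le_real {p : ℝ} (hp : 1 < p) :
    ∃ C : ℝ≥0∞, C ≠ ⊤ ∧ ∀ f : Plane → ℝ, ContDiff ℝ ∞ f → HasCompactSupport f → ∀ i j,
      eLpNorm (kconv (gradLog i) (partialDeriv j f)) (ENNReal.ofReal p) volume ≤
        C * eLpNorm f (ENNReal.ofReal p) volume := by
  obtain ⟨C₁, hC₁, h₁⟩ := exists_lintegral_gradLog_offdiag_le hp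
  obtain ⟨C₂, hC₂, h₂⟩ := exists_lintegral_gradLog_diag_le hp
  have hp0 : 0 < p := by linarith
  have hp1 : 1 ≤ ENNReal.ofReal p := by simpa using hp.le
  set A := C₁ ^ (1 / p)
  set B := C₂ ^ (1 / p)
  set D := ‖(π : ℝ)‖ₑ + ‖(1 / 2 : ℝ)‖ₑ * B with hD
  have hA : A ≠ ⊤ := by finiteness
  have hB : B ≠ ⊤ := by finiteness
  refine ⟨A + D, by finiteness, fun f hf hs i j => ?_⟩
  have hf1 : ContDiff ℝ 1 f := hf.of_le (by simp)
  have hoff : eLpNorm (kconv (gradLog 0) (partialDeriv 1 f)) (ENNReal.ofReal p) volume ≤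
      (A + D) * eLpNorm f (ENNReal.ofReal p) volume :=
    (eLpNorm_le_of_lintegral_le hp0 (h₁ f hf1 hs)).trans (by gcongr; exact le_self_add)
  have hdiff := eLpNorm_le_of_lintegral_le hp0 (h₂ f hf1 hs)
  have hsum : ∀ x, kconv (gradLog 0) (partialDeriv 0 f) x + kconv (gradLog 1) (partialDeriv 1 f) x =
      2 * π * f x := fun x => by
    have := sum_kconv_gradLog_partialDeriv (isTame_of_hasCompactSupport hf1 hs) x
    rwa [Fin.sum_univ_two, smul_eq_mul] at this
  have hcont : ∀ i, Continuous (kconv (gradLog i) (partialDeriv i f)) := fun i =>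
    (contDiff_kconv (locallyIntegrable_gradLog i) (contDiff_partialDeriv hf i)
      (hasCompactSupport_partialDeriv hs i)).continuous
  -- a diagonal entry is `π f` plus or minus half of the difference of the diagonal entries
  have hdiag : ∀ i, ∃ s : ℝ, ‖s‖ₑ = ‖(1 / 2 : ℝ)‖ₑ ∧ kconv (gradLog i) (partialDeriv i f) =
      π • f + s • fun x => (kconv (gradLog 0) (partialDeriv 0 f) x -
        kconv (gradLog 1) (partialDeriv 1 f) x) := by
    intro i
    fin_cases i
    · refine ⟨1 / 2, rfl, funext fun x => ?_⟩
      have := hsum x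
      simp only [Fin.zero_eta, Pi.add_apply, Pi.smul_apply, smul_eq_mul]
      linarith
    · refine ⟨-(1 / 2), enorm_neg _, funext fun x => ?_⟩
      have := hsum x
      simp only [Fin.mk_one, Pi.add_apply, Pi.smul_apply, smul_eq_mul]
      linarith
  have hdiag' : ∀ i, eLpNorm (kconv (gradLog i) (partialDeriv i f)) (ENNReal.ofReal p) volume ≤
      (A + D) * eLpNorm f (ENNReal.ofReal p) volume := by
    intro i
    obtain ⟨s, hs', he⟩ := hdiag i
    rw [he]
    refine (eLpNorm_add_le ?_ ?_ hp1).trans ?_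
    · exact (hf.continuous.aestronglyMeasurable).const_smul _
    · exact (((hcont 0).sub (hcont 1)).aestronglyMeasurable).const_smul _
    · rw [eLpNorm_const_smul, eLpNorm_const_smul, hs']
      calc _ ≤ ‖π‖ₑ * eLpNorm f (ENNReal.ofReal p) volume +
            ‖(1 / 2 : ℝ)‖ₑ * (B * eLpNorm f (ENNReal.ofReal p) volume) := by gcongr
        _ = D * eLpNorm f (ENNReal.ofReal p) volume := by rw [hD]; ring
        _ ≤ _ := by gcongr; exact le_add_self
  by_cases hij : i = j
  · subst hij; exact hdiag' i
  · have : (i = 0 ∧ j = 1) ∨ (i = 1 ∧ j = 0) := by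
      fin_cases i <;> fin_cases j <;> simp_all
    rcases this with ⟨rfl, rfl⟩ | ⟨rfl, rfl⟩
    · exact hoff
    · rw [kconv_gradLog_partialDeriv_comm hf hs]; exact hoff

theorem partialDeriv_clm_comp {f : Plane → 𝕜} (hf : ContDiff ℝ 1 f) (L : 𝕜 →L[ℝ] ℝ)
    (j : Fin 2) : partialDeriv j (fun x => L (f x)) = fun x => L (partialDeriv j f x) := by
  funext x
  have := L.hasFDerivAt.comp x ((hf.differentiable one_ne_zero) x).hasFDerivAt
  rw [partialDeriv]
  change fderiv ℝ (L ∘ f) x _ = _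
  rw [this.fderiv]
  rfl

theorem kconv_clm_comp {k : Plane → ℝ} (hk : LocallyIntegrable k volume) {f : Plane → 𝕜}
    (hf : Continuous f) (hs : HasCompactSupport f) (L : 𝕜 →L[ℝ] ℝ) (x : Plane) :
    kconv k (fun x => L (f x)) x = L (kconv k f x) := by
  rw [kconv, kconv, ← L.integral_comp_comm (integrable_smul_comp_sub hk hf hs x)]
  simp

/-- **Calderón–Zygmund estimate** for the second derivatives of the logarithmic potential. -/
theorem exists_eLpNorm_kconv_gradLog_partialDeriv_le {p : ℝ} (hp : 1 < p) :
    ∃ C : ℝ≥0∞, C ≠ ⊤ ∧ ∀ f : Plane → 𝕜, ContDiff ℝ ∞ f → HasCompactSupport f → ∀ i j,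
      eLpNorm (kconv (gradLog i) (partialDeriv j f)) (ENNReal.ofReal p) volume ≤
        C * eLpNorm f (ENNReal.ofReal p) volume := by
  obtain ⟨C, hC, h⟩ := exists_eLpNorm_kconv_gradLog_partialDeriv_le_real hp
  have hp1 : 1 ≤ ENNReal.ofReal p := by simpa using hp.le
  refine ⟨C + C, by finiteness, fun f hf hs i j => ?_⟩
  have hf1 : ContDiff ℝ 1 f := hf.of_le (by simp)
  have hpc := continuous_partialDeriv hf1 j
  have hps := hasCompactSupport_partialDeriv hs j
  have part : ∀ L : 𝕜 →L[ℝ] ℝ, (∀ z, ‖L z‖ ≤ ‖z‖) →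
      eLpNorm (fun x => L (kconv (gradLog i) (partialDeriv j f) x)) (ENNReal.ofReal p) volume ≤
        C * eLpNorm f (ENNReal.ofReal p) volume := by
    intro L hL
    have h1 := h (fun x => L (f x)) (L.contDiff.comp hf) (hs.comp_left (map_zero L)) i j
    rw [partialDeriv_clm_comp hf1] at h1
    have h2 : kconv (gradLog i) (fun x => L (partialDeriv j f x)) =
        fun x => L (kconv (gradLog i) (partialDeriv j f) x) := funext fun x =>
      kconv_clm_comp (locallyIntegrable_gradLog i) hpc hps L x
    rw [h2] at h1
    refine h1.trans ?_
    gcongr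
    exact eLpNorm_mono fun x => hL _
  have hcont : Continuous (kconv (gradLog i) (partialDeriv j f)) :=
    (contDiff_kconv (locallyIntegrable_gradLog i) (contDiff_partialDeriv hf j) hps).continuous
  set u := kconv (gradLog i) (partialDeriv j f)
  have e1 : ∀ x, (RCLike.reCLM : 𝕜 →L[ℝ] ℝ) (u x) = RCLike.re (u x) := fun x => rfl
  have e2 : ∀ x, (RCLike.imCLM : 𝕜 →L[ℝ] ℝ) (u x) = RCLike.im (u x) := fun x => rfl
  calc eLpNorm u (ENNReal.ofReal p) volume
      ≤ eLpNorm (fun x => ‖(RCLike.reCLM : 𝕜 →L[ℝ] ℝ) (u x)‖ + ‖(RCLike.imCLM : 𝕜 →L[ℝ] ℝ) (u x)‖)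
          (ENNReal.ofReal p) volume := by
        refine eLpNorm_mono_real fun x => ?_
        rw [e1, e2]
        simp only [Real.norm_eq_abs]
        have h3 := RCLike.norm_sq_eq_def (z := u x)
        refine abs_le_of_sq_le_sq' ?_ (by positivity) |>.2
        nlinarith [abs_nonneg (RCLike.re (u x)), abs_nonneg (RCLike.im (u x)),
          sq_abs (RCLike.re (u x)), sq_abs (RCLike.im (u x)),
          mul_nonneg (abs_nonneg (RCLike.re (u x))) (abs_nonneg (RCLike.im (u x)))]
    _ ≤ C * eLpNorm f (ENNReal.ofReal p) volume + C * eLpNorm f (ENNReal.ofReal p) volume := by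
        refine (eLpNorm_add_le (Continuous.aestronglyMeasurable (by fun_prop))
          (Continuous.aestronglyMeasurable (by fun_prop)) hp1).trans ?_
        rw [eLpNorm_norm, eLpNorm_norm]
        exact add_le_add (part _ fun z => by
          simpa using RCLike.norm_re_le_norm z) (part _ fun z => by
          simpa using RCLike.norm_im_le_norm z)
    _ = _ := by ring

/-! ### Cutoff functions and the Hardy–Littlewood–Sobolev inequality -/

/-- Cutoff functions at scale `R` whose gradient is `O(1 / R)` with a constant independent of `R`,
and supported in `R ≤ |x| ≤ 2R`. -/
theorem exists_cutoff : ∃ M : ℝ, 0 ≤ M ∧ ∀ R : ℝ, 0 < R → ∃ χ : Plane → ℝ, ContDiff ℝ ∞ χ ∧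
    HasCompactSupport χ ∧ (∀ x, 0 ≤ χ x ∧ χ x ≤ 1) ∧ (∀ x, ‖x‖ ≤ R → χ x = 1) ∧
    (∀ x, ‖fderiv ℝ χ x‖ ≤ M / R) ∧ (∀ x, ‖x‖ < R → fderiv ℝ χ x = 0) ∧
    ∀ x, 2 * R < ‖x‖ → fderiv ℝ χ x = 0 := by
  let χ₀ : ContDiffBump (0 : Plane) := ⟨1, 2, one_pos, one_lt_two⟩
  have hsm : ContDiff ℝ ∞ χ₀ := χ₀.contDiff
  have hd : Differentiable ℝ χ₀ := hsm.differentiable (by simp)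
  obtain ⟨M, hM⟩ := (hsm.continuous_fderiv (by simp)).bounded_above_of_compact_support
    (χ₀.hasCompactSupport.fderiv (𝕜 := ℝ))
  have hM0 : 0 ≤ M := (norm_nonneg _).trans (hM 0)
  refine ⟨M, hM0, fun R hR => ?_⟩
  have hR' : R⁻¹ ≠ 0 := (inv_pos.2 hR).ne'
  have hnorm : ∀ x : Plane, ‖R⁻¹ • x‖ = ‖x‖ / R := fun x => by
    rw [norm_smul, norm_inv, Real.norm_of_nonneg hR.le, div_eq_inv_mul]
  have hone : ∀ x : Plane, ‖x‖ ≤ R → χ₀ (R⁻¹ • x) = 1 := fun x hx => by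
    apply χ₀.one_of_mem_closedBall
    rw [Metric.mem_closedBall, dist_zero_right, hnorm]
    exact (div_le_one hR).2 hx
  have hzero : ∀ x : Plane, 2 * R ≤ ‖x‖ → χ₀ (R⁻¹ • x) = 0 := fun x hx => by
    apply χ₀.zero_of_le_dist
    rw [dist_zero_right, hnorm]
    exact (le_div_iff₀ hR).2 hx
  refine ⟨fun x => χ₀ (R⁻¹ • x), hsm.comp (contDiff_const_smul _), ?_, fun x =>
    ⟨χ₀.nonneg, χ₀.le_one⟩, hone, fun x => ?_, fun x hx => ?_, fun x hx => ?_⟩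
  · exact χ₀.hasCompactSupport.comp_homeomorph (Homeomorph.smulOfNeZero R⁻¹ hR')
  · have h1 : HasFDerivAt (fun x : Plane => R⁻¹ • x) (R⁻¹ • ContinuousLinearMap.id ℝ Plane) x :=
      (hasFDerivAt_id x).const_smul R⁻¹
    have h2 := (hd (R⁻¹ • x)).hasFDerivAt.comp x h1
    change ‖fderiv ℝ (χ₀ ∘ fun x => R⁻¹ • x) x‖ ≤ _
    rw [h2.fderiv]
    refine (ContinuousLinearMap.opNorm_comp_le _ _).trans ?_
    rw [div_eq_mul_inv]
    gcongr
    · exact hM _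
    · rw [norm_smul, norm_inv, Real.norm_of_nonneg hR.le]
      exact mul_le_of_le_one_right (inv_pos.2 hR).le ContinuousLinearMap.norm_id_le
  · have : (fun x : Plane => χ₀ (R⁻¹ • x)) =ᶠ[𝓝 x] fun _ => 1 := by
      filter_upwards [(continuous_norm.isOpen_preimage _ isOpen_Iio).mem_nhds
        (show x ∈ norm ⁻¹' Set.Iio R from hx)] with y hy
      exact hone y (le_of_lt hy)
    rw [this.fderiv_eq, fderiv_fun_const]; rfl
  · have : (fun x : Plane => χ₀ (R⁻¹ • x)) =ᶠ[𝓝 x] fun _ => 0 := by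
      filter_upwards [(continuous_norm.isOpen_preimage _ isOpen_Ioi).mem_nhds
        (show x ∈ norm ⁻¹' Set.Ioi (2 * R) from hx)] with y hy
      exact hzero y (le_of_lt hy)
    rw [this.fderiv_eq, fderiv_fun_const]; rfl

theorem norm_fderiv_le (u : Plane → 𝕜) (x : Plane) :
    ‖fderiv ℝ u x‖ ≤ ‖partialDeriv 0 u x‖ + ‖partialDeriv 1 u x‖ := by
  refine ContinuousLinearMap.opNorm_le_bound _ (by positivity) fun v => ?_
  have hv : v = v 0 • basisVec 0 + v 1 • basisVec 1 := by
    ext i; fin_cases i <;> simp [basisVec]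
  have : fderiv ℝ u x v = v 0 • partialDeriv 0 u x + v 1 • partialDeriv 1 u x := by
    conv_lhs => rw [hv]
    simp [partialDeriv]
  rw [this]
  refine (norm_add_le _ _).trans ?_
  rw [norm_smul, norm_smul, Real.norm_eq_abs, Real.norm_eq_abs]
  nlinarith [abs_coord_le_norm v 0, abs_coord_le_norm v 1, norm_nonneg (partialDeriv 0 u x),
    norm_nonneg (partialDeriv 1 u x)]

theorem sobolevConj_inv {p : ℝ} (hp : 1 < p) (hp2 : p < 2) :
    (sobolevConj p)⁻¹ = p⁻¹ - 2⁻¹ := by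
  rw [sobolevConj]
  have : 2 - p ≠ 0 := by linarith
  field_simp

theorem lt_sobolevConj {p : ℝ} (hp : 1 < p) (hp2 : p < 2) : 2 < sobolevConj p := by
  rw [sobolevConj, lt_div_iff₀ (by linarith)]
  linarith

/-- The Gagliardo–Nirenberg–Sobolev inequality for functions which decay like `1 / |x|`, by
truncation: the error `|∇χ| |u| = O(R⁻²)` lives on a ball of radius `2R` and vanishes in `L^p`
as `R → ∞` because `p > 1`. -/
theorem exists_eLpNorm_sobolevConj_le {p : ℝ} (hp : 1 < p) (hp2 : p < 2) :
    ∃ A : ℝ≥0∞, A ≠ ⊤ ∧ ∀ u : Plane → 𝕜, ContDiff ℝ 1 u →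
      (∃ C R₀ : ℝ, ∀ x, R₀ ≤ ‖x‖ → ‖u x‖ ≤ C / ‖x‖) →
      eLpNorm u (ENNReal.ofReal (sobolevConj p)) volume ≤
        A * eLpNorm (fderiv ℝ u) (ENNReal.ofReal p) volume := by
  have hfd : FiniteDimensional ℝ 𝕜 := inferInstance
  have hps := lt_sobolevConj hp hp2
  have hp0 : 0 < p := by linarith
  obtain ⟨M, hM0, hM⟩ := exists_cutoff
  let A' : NNReal := SNormLESNormFDerivOfEqConst 𝕜 (volume : Measure Plane) p.toNNReal
  set A : ℝ≥0∞ := (A' : ℝ≥0∞) with hA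
  refine ⟨A, ENNReal.coe_ne_top, fun u hu ⟨C₀, R₀, hC₀⟩ => ?_⟩
  obtain ⟨C, hC0, hC⟩ : ∃ C : ℝ, 0 ≤ C ∧ ∀ x, R₀ ≤ ‖x‖ → ‖u x‖ ≤ C / ‖x‖ :=
    ⟨|C₀|, abs_nonneg _, fun x hx => (hC₀ x hx).trans (by gcongr; exact le_abs_self _)⟩
  have hRpos : ∀ n : ℕ, 0 < (n : ℝ) + 1 := fun n => by positivity
  choose χ hχs hχc hχb hχ1 hχd hχd0 hχd2 using fun n : ℕ => hM (n + 1) (hRpos n)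
  have hud := hu.differentiable one_ne_zero
  have hcont : ∀ n, ContDiff ℝ 1 fun x => χ n x • u x := fun n =>
    ((hχs n).of_le (by simp)).smul hu
  have hgns : ∀ n, eLpNorm (fun x => χ n x • u x) (ENNReal.ofReal (sobolevConj p)) volume ≤
      A * eLpNorm (fderiv ℝ fun x => χ n x • u x) (ENNReal.ofReal p) volume := fun n => by
    refine eLpNorm_le_eLpNorm_fderiv_of_eq (F := 𝕜) (volume : Measure Plane) (hcont n)
      ((hχc n).smul_right) (p := p.toNNReal) (p' := (sobolevConj p).toNNReal) ?_ ?_ ?_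
    · simpa using hp.le
    · rw [finrank_plane]; norm_num
    · rw [finrank_plane, NNReal.coe_inv, Real.coe_toNNReal _ hp0.le,
        Real.coe_toNNReal _ (by linarith),
        sobolevConj_inv hp hp2]
      norm_num
  have hder : ∀ n : ℕ, R₀ ≤ n + 1 → ∀ x, ‖fderiv ℝ (fun x => χ n x • u x) x‖ ≤
      ‖fderiv ℝ u x‖ + (Metric.closedBall (0 : Plane) (2 * (n + 1))).indicator
        (fun _ => M * C * ((n : ℝ) + 1) ^ (-2 : ℝ)) x := by
    intro n hn x
    have h1 : fderiv ℝ (fun x => χ n x • u x) x =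
        χ n x • fderiv ℝ u x + (fderiv ℝ (χ n) x).smulRight (u x) :=
      fderiv_fun_smul ((hχs n).differentiable (by simp) x) (hud x)
    rw [h1]
    refine (norm_add_le _ _).trans (add_le_add ?_ ?_)
    · rw [norm_smul, Real.norm_of_nonneg (hχb n x).1]
      exact mul_le_of_le_one_left (norm_nonneg _) (hχb n x).2
    · rw [ContinuousLinearMap.norm_smulRight_apply]
      by_cases hx2 : ‖x‖ ≤ 2 * (n + 1)
      · rw [Set.indicator_of_mem (by simpa using hx2)]
        by_cases hx1 : ‖x‖ < n + 1
        · rw [hχd0 n x hx1, norm_zero, zero_mul]; positivity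
        · push Not at hx1
          calc ‖fderiv ℝ (χ n) x‖ * ‖u x‖ ≤ (M / (n + 1)) * (C / ‖x‖) := by
                gcongr
                · exact hχd n x
                · exact hC x (hn.trans hx1)
            _ ≤ (M / (n + 1)) * (C / (n + 1)) := by gcongr
            _ = _ := by
                rw [Real.rpow_neg (hRpos n).le, Real.rpow_two]
                field_simp
      · push Not at hx2
        rw [hχd2 n x hx2, norm_zero, zero_mul]
        exact Set.indicator_nonneg (fun _ _ => by positivity) _
  set V : ℝ≥0∞ := volume (Metric.ball (0 : Plane) 1) with hV
  have hVt : V ≠ ⊤ := measure_ball_lt_top.ne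
  set δ : ℕ → ℝ≥0∞ := fun n =>
    ENNReal.ofReal (M * C * 2 ^ (2 / p) * ((n : ℝ) + 1) ^ (-(2 - 2 / p))) * V ^ (1 / p) with hδ
  have hp1 : 1 ≤ ENNReal.ofReal p := by simpa using hp.le
  have hb : ∀ n : ℕ, R₀ ≤ n + 1 →
      eLpNorm (fderiv ℝ fun x => χ n x • u x) (ENNReal.ofReal p) volume ≤
        eLpNorm (fderiv ℝ u) (ENNReal.ofReal p) volume + δ n := by
    intro n hn
    refine (eLpNorm_mono_real (hder n hn)).trans ((eLpNorm_add_le ?_ ?_ hp1).trans ?_)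
    · exact (hu.continuous_fderiv one_ne_zero).norm.aestronglyMeasurable
    · exact (measurable_const.indicator measurableSet_closedBall).aestronglyMeasurable
    · rw [eLpNorm_norm]
      gcongr
      rw [eLpNorm_indicator_const measurableSet_closedBall (by simpa using hp0)
        ENNReal.ofReal_ne_top, ENNReal.toReal_ofReal hp0.le,
        Measure.addHaar_closedBall _ _ (by positivity), finrank_plane, hδ,
        ENNReal.mul_rpow_of_nonneg _ _ (by positivity), ← mul_assoc,
        ENNReal.ofReal_rpow_of_nonneg (by positivity) (by positivity),
        Real.enorm_eq_ofReal (by positivity), ← ENNReal.ofReal_mul (by positivity)]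
      apply le_of_eq
      congr 2
      rw [← Real.rpow_natCast, ← Real.rpow_mul (by positivity), Real.mul_rpow (by norm_num)
        (by positivity)]
      have e : -(2 - 2 / p) = -2 + 2 * (1 / p) := by ring
      have e2 : 2 / p = 2 * (1 / p) := by ring
      rw [e, Real.rpow_add (hRpos n), e2]
      push_cast
      ring
  have hδ0 : Tendsto δ atTop (𝓝 0) := by
    have hpos : 0 < 2 - 2 / p := by
      rw [sub_pos, div_lt_iff₀ hp0]; linarith
    have h1 : Tendsto (fun n : ℕ => M * C * 2 ^ (2 / p) * ((n : ℝ) + 1) ^ (-(2 - 2 / p))) atTop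
        (𝓝 (M * C * 2 ^ (2 / p) * 0)) :=
      ((tendsto_rpow_neg_atTop hpos).comp
        (tendsto_natCast_atTop_atTop.atTop_add tendsto_const_nhds)).const_mul _
    rw [mul_zero] at h1
    have h2 := ENNReal.Tendsto.mul_const (b := V ^ (1 / p)) (ENNReal.tendsto_ofReal h1)
      (Or.inr (by finiteness))
    rw [ENNReal.ofReal_zero, zero_mul] at h2
    exact h2
  have hlim : ∀ᵐ x ∂(volume : Measure Plane), Tendsto (fun n => χ n x • u x) atTop (𝓝 (u x)) := by
    refine Eventually.of_forall fun x => ?_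
    refine tendsto_const_nhds.congr' ?_
    filter_upwards [eventually_ge_atTop ⌈‖x‖⌉₊] with n hn
    have hn' : (⌈‖x‖⌉₊ : ℝ) ≤ n := by exact_mod_cast hn
    have : ‖x‖ ≤ n + 1 := (Nat.le_ceil _).trans (by linarith)
    rw [hχ1 n x this, one_smul]
  have hfat := Lp.eLpNorm_lim_le_liminf_eLpNorm (p := ENNReal.ofReal (sobolevConj p))
    (fun n => (hcont n).continuous.aestronglyMeasurable (μ := volume)) u hlim
  refine hfat.trans ?_
  have htend : Tendsto (fun n => A * (eLpNorm (fderiv ℝ u) (ENNReal.ofReal p) volume + δ n)) atTop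
      (𝓝 (A * (eLpNorm (fderiv ℝ u) (ENNReal.ofReal p) volume + 0))) :=
    ENNReal.Tendsto.const_mul (hδ0.const_add _) (Or.inr ENNReal.coe_ne_top)
  rw [add_zero] at htend
  rw [← htend.liminf_eq]
  refine liminf_le_liminf ?_
  filter_upwards [eventually_ge_atTop ⌈R₀⌉₊] with n hn
  have hn' : (⌈R₀⌉₊ : ℝ) ≤ n := by exact_mod_cast hn
  have : R₀ ≤ n + 1 := (Nat.le_ceil _).trans (by linarith)
  exact (hgns n).trans (by gcongr; exact hb n this)

/-- The `1 / |x|` decay required in `exists_eLpNorm_sobolevConj_le`. -/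
theorem exists_norm_kconv_gradLog_le {f : Plane → 𝕜} (hf : Continuous f)
    (hs : HasCompactSupport f) (i : Fin 2) :
    ∃ C R₀ : ℝ, ∀ x, R₀ ≤ ‖x‖ → ‖kconv (gradLog i) f x‖ ≤ C / ‖x‖ := by
  obtain ⟨R, hR0, hR⟩ : ∃ R : ℝ, 0 < R ∧ ∀ x, R ≤ ‖x‖ → f x = 0 := by
    obtain ⟨R, hR⟩ := hs.isCompact.isBounded.subset_ball_lt 0 0
    refine ⟨R, hR.1, fun x hx => ?_⟩
    by_contra h
    have := hR.2 (subset_tsupport f h)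
    rw [Metric.mem_ball, dist_zero_right] at this
    linarith
  refine ⟨2 * ∫ y, ‖f y‖, 2 * R, fun x hx => ?_⟩
  have hx0 : 0 < ‖x‖ := by linarith
  have hi : Integrable f := hf.integrable_of_hasCompactSupport hs
  calc ‖kconv (gradLog i) f x‖ ≤ ∫ w, 2 / ‖x‖ * ‖f (x - w)‖ := by
        refine norm_integral_le_of_norm_le ((hi.comp_sub_left x).norm.const_mul _)
          (Eventually.of_forall fun w => ?_)
        rw [norm_smul, Real.norm_eq_abs]
        by_cases h : f (x - w) = 0
        · simp [h]
        · have h1 : ‖x - w‖ < R := by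
            by_contra h2; exact h (hR _ (not_lt.1 h2))
          have h2 : ‖x‖ / 2 ≤ ‖w‖ := by
            have := norm_sub_norm_le x w
            linarith
          gcongr
          refine (abs_gradLog_le i w).trans ?_
          rw [← one_div, div_le_div_iff₀ (by linarith) hx0]
          linarith
    _ = 2 / ‖x‖ * ∫ y, ‖f y‖ := by
        rw [integral_const_mul]
        congr 1
        exact integral_sub_left_eq_self (fun y => ‖f y‖) volume x
    _ = _ := by ring

/-- **Hardy–Littlewood–Sobolev inequality** for the gradient of the logarithmic kernel: by the
Gagliardo–Nirenberg–Sobolev inequality it follows from the Calderón–Zygmund estimate. -/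
theorem exists_eLpNorm_kconv_gradLog_le {p : ℝ} (hp : 1 < p) (hp2 : p < 2) :
    ∃ C : ℝ≥0∞, C ≠ ⊤ ∧ ∀ f : Plane → 𝕜, ContDiff ℝ ∞ f → HasCompactSupport f → ∀ i,
      eLpNorm (kconv (gradLog i) f) (ENNReal.ofReal (sobolevConj p)) volume ≤
        C * eLpNorm f (ENNReal.ofReal p) volume := by
  obtain ⟨A, hA, hGNS⟩ := exists_eLpNorm_sobolevConj_le (𝕜 := 𝕜) hp hp2
  obtain ⟨C, hC, hCZ⟩ := exists_eLpNorm_kconv_gradLog_partialDeriv_le (𝕜 := 𝕜) hp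
  have hp1 : 1 ≤ ENNReal.ofReal p := by simpa using hp.le
  refine ⟨A * (C + C), by finiteness, fun f hf hs i => ?_⟩
  have hsm := contDiff_kconv (locallyIntegrable_gradLog i) hf hs
  refine (hGNS _ (hsm.of_le (by simp)) (exists_norm_kconv_gradLog_le hf.continuous hs i)).trans ?_
  rw [mul_assoc]
  gcongr
  have hpd : ∀ j, partialDeriv j (kconv (gradLog i) f) = kconv (gradLog i) (partialDeriv j f) :=
    partialDeriv_kconv (locallyIntegrable_gradLog i) (hf.of_le (by simp)) hs
  have hc : ∀ j, AEStronglyMeasurable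
      (fun x => ‖partialDeriv j (kconv (gradLog i) f) x‖) volume := fun j =>
    (contDiff_partialDeriv hsm j).continuous.norm.aestronglyMeasurable
  refine (eLpNorm_mono_real (norm_fderiv_le _)).trans ((eLpNorm_add_le (hc 0) (hc 1) hp1).trans ?_)
  rw [eLpNorm_norm, eLpNorm_norm, hpd, hpd, add_mul]
  exact add_le_add (hCZ f hf hs i 0) (hCZ f hf hs i 1)

/-! ### Hölder estimates for convolutions and Morrey's inequality -/

theorem lintegral_enorm_mul_le {F : Type*} [NormedAddCommGroup F] {p q : ℝ}
    (hpq : q.HolderConjugate p) {k : Plane → ℝ}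
    {f : Plane → F} (hk : AEStronglyMeasurable k volume) (hf : AEStronglyMeasurable f volume) :
    ∫⁻ y, ‖k y‖ₑ * ‖f y‖ₑ ≤
      eLpNorm k (ENNReal.ofReal q) volume * eLpNorm f (ENNReal.ofReal p) volume := by
  have hp := hpq.symm.pos
  have hq := hpq.pos
  rw [eLpNorm_eq_lintegral_rpow_enorm_toReal (f := f) (by simpa using hp) ENNReal.ofReal_ne_top,
    eLpNorm_eq_lintegral_rpow_enorm_toReal (f := k) (by simpa using hq) ENNReal.ofReal_ne_top,
    ENNReal.toReal_ofReal hp.le, ENNReal.toReal_ofReal hq.le]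
  exact ENNReal.lintegral_mul_le_Lp_mul_Lq volume hpq hk.enorm hf.enorm

theorem eLpNorm_comp_sub_left {F : Type*} [NormedAddCommGroup F] {f : Plane → F}
    (hf : AEStronglyMeasurable f volume) (p : ℝ≥0∞) (x : Plane) :
    eLpNorm (fun y => f (x - y)) p volume = eLpNorm f p volume :=
  eLpNorm_comp_measurePreserving hf (Measure.measurePreserving_sub_left volume x)

theorem aestronglyMeasurable_comp_sub_left {F : Type*} [NormedAddCommGroup F] {f : Plane → F}
    (hf : AEStronglyMeasurable f volume) (x : Plane) :
    AEStronglyMeasurable (fun y => f (x - y)) volume :=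
  hf.comp_measurePreserving (Measure.measurePreserving_sub_left volume x)

theorem memLp_indicator_norm_rpow {s q : ℝ} (hq : 0 < q) (hsq : s * q < 2) (R : ℝ) :
    MemLp ((Metric.ball (0 : Plane) R).indicator fun w => ‖w‖ ^ (-s)) (ENNReal.ofReal q)
      volume := by
  rw [memLp_indicator_iff_restrict measurableSet_ball,
    ← integrable_norm_rpow_iff (Measurable.aestronglyMeasurable (by fun_prop)) (by simpa using hq)
      ENNReal.ofReal_ne_top, ENNReal.toReal_ofReal hq.le]
  refine (integrableOn_norm_rpow_ball hsq R).congr (Eventually.of_forall fun w => ?_)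
  simp only
  rw [Real.norm_of_nonneg (by positivity), ← Real.rpow_mul (norm_nonneg _), neg_mul]

theorem memLp_indicator_compl_norm_inv {q : ℝ} (hq : 2 < q) :
    MemLp ((Metric.ball (0 : Plane) 1)ᶜ.indicator fun w => ‖w‖⁻¹) (ENNReal.ofReal q)
      volume := by
  have hq0 : 0 < q := by linarith
  rw [memLp_indicator_iff_restrict measurableSet_ball.compl,
    ← integrable_norm_rpow_iff (Measurable.aestronglyMeasurable (by fun_prop))
      (by simpa using hq0) ENNReal.ofReal_ne_top, ENNReal.toReal_ofReal hq0.le]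
  refine (integrableOn_norm_rpow_compl_ball hq).congr (Eventually.of_forall fun w => ?_)
  simp only
  rw [norm_inv, norm_norm, Real.inv_rpow (norm_nonneg _), Real.rpow_neg (norm_nonneg _)]

theorem lt_two_of_holderConjugate {p q : ℝ} (hpq : q.HolderConjugate p) (hp : 2 < p) :
    q < 2 := by
  have h := hpq.inv_add_inv_eq_one
  have h1 : p⁻¹ < 2⁻¹ := inv_strictAnti₀ two_pos hp
  have h2 : 2⁻¹ < q⁻¹ := by linarith
  exact (inv_lt_inv₀ two_pos hpq.pos).1 h2

theorem two_lt_of_holderConjugate {p q : ℝ} (hpq : q.HolderConjugate p) (hp : p < 2) :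
    2 < q := by
  have h := hpq.inv_add_inv_eq_one
  have h1 : 2⁻¹ < p⁻¹ := inv_strictAnti₀ hpq.symm.pos hp
  have h2 : q⁻¹ < 2⁻¹ := by linarith
  exact (inv_lt_inv₀ hpq.pos two_pos).1 h2

/-- **Morrey's inequality**: Green's representation formula is applied to `χ(x - ·) u`, where `χ`
is a cutoff function, and each of the resulting integrals is estimated by Hölder's inequality. -/
theorem exists_enorm_le_eLpNorm_add {a b : ℝ} (ha : 1 < a) (hb : 2 < b) :
    ∃ C : ℝ≥0∞, C ≠ ⊤ ∧ ∀ u : Plane → 𝕜, ContDiff ℝ 1 u → ∀ x, ‖u x‖ₑ ≤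
      C * (eLpNorm u (ENNReal.ofReal a) volume +
        ∑ i, eLpNorm (partialDeriv i u) (ENNReal.ofReal b) volume) := by
  obtain ⟨M, hM0, hM⟩ := exists_cutoff
  obtain ⟨χ, hχs, hχc, hχb, hχ1, -, hχd0, -⟩ := hM 1 one_pos
  have hA : a.conjExponent.HolderConjugate a := (Real.HolderConjugate.conjExponent ha).symm
  have hB : b.conjExponent.HolderConjugate b :=
    (Real.HolderConjugate.conjExponent (by linarith)).symm
  set a' := a.conjExponent
  set b' := b.conjExponent
  have hχ1' : ContDiff ℝ 1 χ := hχs.of_le (by simp)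
  -- the kernel multiplying the derivatives of `u`
  set k₁ : Plane → ℝ := fun w => χ w * ‖w‖⁻¹ with hk₁
  have hk₁m : AEStronglyMeasurable k₁ volume :=
    (hχs.continuous.measurable.mul (by fun_prop)).aestronglyMeasurable
  have hk₁L : MemLp k₁ (ENNReal.ofReal b') volume := by
    obtain ⟨R, hR⟩ := hχc.isCompact.isBounded.subset_ball 0
    have := memLp_indicator_norm_rpow (s := 1) hB.pos
      (by rw [one_mul]; exact lt_two_of_holderConjugate hB hb) R
    refine this.of_le hk₁m (Eventually.of_forall fun w => ?_)
    by_cases hw : w ∈ Metric.ball (0 : Plane) R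
    · rw [Set.indicator_of_mem hw, hk₁, Real.rpow_neg_one, norm_mul]
      refine mul_le_of_le_one_left (norm_nonneg _) ?_
      rw [Real.norm_of_nonneg (hχb w).1]
      exact (hχb w).2
    · have : χ w = 0 := by
        by_contra h
        exact hw (hR (subset_tsupport χ h))
      simp [hk₁, this]
  -- the kernels multiplying `u`
  set k₂ : Fin 2 → Plane → ℝ := fun i w => partialDeriv i χ w with hk₂
  have hk₂c : ∀ i, Continuous (k₂ i) := fun i => continuous_partialDeriv hχ1' i
  have hk₂L : ∀ i, MemLp (k₂ i) (ENNReal.ofReal a') volume := fun i =>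
    (hk₂c i).memLp_of_hasCompactSupport (hasCompactSupport_partialDeriv hχc i)
  set C := eLpNorm k₁ (ENNReal.ofReal b') volume + ∑ i, eLpNorm (k₂ i) (ENNReal.ofReal a') volume
    with hC
  have hCt : C ≠ ⊤ := ENNReal.add_ne_top.2 ⟨hk₁L.eLpNorm_ne_top,
    ENNReal.sum_ne_top.2 fun i _ => (hk₂L i).eLpNorm_ne_top⟩
  refine ⟨C, hCt, fun u hu x => ?_⟩
  have hud := hu.differentiable one_ne_zero
  set φ : Plane → 𝕜 := fun y => χ (x - y) • u y with hφ
  have hχx : ContDiff ℝ 1 fun y => χ (x - y) := hχ1'.comp (contDiff_const.sub contDiff_id)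
  have hφ1 : ContDiff ℝ 1 φ := hχx.smul hu
  have hφs : HasCompactSupport φ := by
    have : HasCompactSupport fun y => χ (x - y) := hχc.comp_homeomorph (Homeomorph.subLeft x)
    exact this.smul_right
  have hrep := sum_kconv_gradLog_partialDeriv (isTame_of_hasCompactSupport hφ1 hφs) x
  have hφx : φ x = u x := by simp [hφ, hχ1 0 (by simp)]
  have hder : ∀ i w, partialDeriv i φ (x - w) =
      χ w • partialDeriv i u (x - w) - k₂ i w • u (x - w) := by
    intro i w
    have hd1 : DifferentiableAt ℝ (fun y => χ (x - y)) (x - w) :=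
      (hχx.differentiable one_ne_zero) _
    have h1 : fderiv ℝ (fun y => χ (x - y)) (x - w) (basisVec i) = - k₂ i w := by
      rw [fderiv_comp_sub_left (hχ1'.differentiable one_ne_zero)]
      simp [hk₂, partialDeriv]
    rw [partialDeriv, hφ, fderiv_fun_smul hd1 (hud _)]
    simp only [add_apply, _root_.smul_apply, ContinuousLinearMap.smulRight_apply, h1]
    rw [sub_sub_cancel, neg_smul, partialDeriv]
    exact (sub_eq_add_neg _ _).symm
  have hpt : ∀ i w, ‖gradLog i w • partialDeriv i φ (x - w)‖ₑ ≤
      ‖k₁ w‖ₑ * ‖partialDeriv i u (x - w)‖ₑ + ‖k₂ i w‖ₑ * ‖u (x - w)‖ₑ := by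
    intro i w
    simp only [← ofReal_norm]
    rw [← ENNReal.ofReal_mul (norm_nonneg _), ← ENNReal.ofReal_mul (norm_nonneg _),
      ← ENNReal.ofReal_add (by positivity) (by positivity)]
    apply ENNReal.ofReal_le_ofReal
    rw [norm_smul, hder]
    have hg := abs_gradLog_le i w
    have e1 : ‖k₁ w‖ = ‖χ w‖ * ‖w‖⁻¹ := by simp [hk₁]
    calc ‖gradLog i w‖ * ‖χ w • partialDeriv i u (x - w) - k₂ i w • u (x - w)‖
        ≤ ‖w‖⁻¹ * (‖χ w‖ * ‖partialDeriv i u (x - w)‖ + ‖k₂ i w‖ * ‖u (x - w)‖) := by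
          gcongr
          · exact hg
          · refine (norm_sub_le _ _).trans ?_
            rw [norm_smul, norm_smul]
      _ = ‖k₁ w‖ * ‖partialDeriv i u (x - w)‖ + ‖w‖⁻¹ * ‖k₂ i w‖ * ‖u (x - w)‖ := by
          rw [e1]; ring
      _ ≤ ‖k₁ w‖ * ‖partialDeriv i u (x - w)‖ + ‖k₂ i w‖ * ‖u (x - w)‖ := by
          gcongr
          by_cases hw : ‖w‖ < 1
          · have : k₂ i w = 0 := by simp [hk₂, partialDeriv, hχd0 w hw]
            simp [this]
          · exact mul_le_of_le_one_left (norm_nonneg _) (inv_le_one_of_one_le₀ (not_lt.1 hw))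
  have hpc : ∀ i, Continuous (partialDeriv i u) := continuous_partialDeriv hu
  have hest : ∀ i, ‖kconv (gradLog i) (partialDeriv i φ) x‖ₑ ≤
      eLpNorm k₁ (ENNReal.ofReal b') volume *
          eLpNorm (partialDeriv i u) (ENNReal.ofReal b) volume +
        eLpNorm (k₂ i) (ENNReal.ofReal a') volume * eLpNorm u (ENNReal.ofReal a) volume := by
    intro i
    refine (enorm_integral_le_lintegral_enorm _).trans ((lintegral_mono (hpt i)).trans ?_)
    have hm : AEMeasurable fun w => ‖k₁ w‖ₑ * ‖partialDeriv i u (x - w)‖ₑ := hk₁m.enorm.mul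
      (aestronglyMeasurable_comp_sub_left (hpc i).aestronglyMeasurable x).enorm
    rw [lintegral_add_left' hm]
    refine add_le_add ((lintegral_enorm_mul_le hB hk₁m
      (aestronglyMeasurable_comp_sub_left (hpc i).aestronglyMeasurable x)).trans_eq ?_)
      ((lintegral_enorm_mul_le hA (hk₂c i).aestronglyMeasurable
      (aestronglyMeasurable_comp_sub_left hu.continuous.aestronglyMeasurable x)).trans_eq ?_)
    · rw [eLpNorm_comp_sub_left (hpc i).aestronglyMeasurable]
    · rw [eLpNorm_comp_sub_left hu.continuous.aestronglyMeasurable]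
  have hone : ‖u x‖ₑ ≤ ‖(2 * π) • φ x‖ₑ := by
    rw [hφx, enorm_smul]
    refine le_mul_of_one_le_left zero_le ?_
    rw [Real.enorm_eq_ofReal (by positivity), ENNReal.one_le_ofReal]
    linarith [Real.pi_gt_three]
  rw [← hrep] at hone
  calc ‖u x‖ₑ ≤ ∑ i, ‖kconv (gradLog i) (partialDeriv i φ) x‖ₑ := hone.trans (enorm_sum_le _ _)
    _ ≤ ∑ i, (C * eLpNorm (partialDeriv i u) (ENNReal.ofReal b) volume +
        eLpNorm (k₂ i) (ENNReal.ofReal a') volume * eLpNorm u (ENNReal.ofReal a) volume) := by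
        refine Finset.sum_le_sum fun i _ => (hest i).trans ?_
        gcongr
        exact le_self_add
    _ ≤ _ := by
        rw [Finset.sum_add_distrib, ← Finset.mul_sum, ← Finset.sum_mul, mul_add, add_comm]
        gcongr
        exact le_add_self

/-! ### The two parts of the Riesz kernel -/

/-- For `f ∈ L^p` with `1 < p < 2` and `φ ∈ L¹ ∩ L^{p'}`, the double integral of
`|f(y)| |x - y|⁻¹ |φ(x)|` is finite: near the origin the kernel is integrable, away from it the
kernel lies in `L^{p'}`. -/
theorem exists_lintegral_riesz_le {F : Type*} [NormedAddCommGroup F] {p q : ℝ}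
    (hpq : q.HolderConjugate p) (hp2 : p < 2) :
    ∃ C : ℝ≥0∞, C ≠ ⊤ ∧ ∀ f : Plane → 𝕜, AEStronglyMeasurable f volume → ∀ φ : Plane → F,
      AEStronglyMeasurable φ volume →
      ∫⁻ x, (∫⁻ y, ‖‖x - y‖⁻¹‖ₑ * ‖f y‖ₑ) * ‖φ x‖ₑ ≤
        C * eLpNorm f (ENNReal.ofReal p) volume *
          (eLpNorm φ (ENNReal.ofReal q) volume + eLpNorm φ 1 volume) := by
  have hp : 1 < p := hpq.symm.lt
  have hp0 : 0 < p := hpq.symm.pos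
  set k₁ : Plane → ℝ := (Metric.ball (0 : Plane) 1).indicator fun w => ‖w‖⁻¹ with hk₁
  set k₂ : Plane → ℝ := (Metric.ball (0 : Plane) 1)ᶜ.indicator fun w => ‖w‖⁻¹ with hk₂
  have hk₁m : Measurable k₁ := Measurable.indicator (by fun_prop) measurableSet_ball
  have hk₂m : Measurable k₂ := Measurable.indicator (by fun_prop) measurableSet_ball.compl
  have hk₂L : MemLp k₂ (ENNReal.ofReal q) volume :=
    memLp_indicator_compl_norm_inv (two_lt_of_holderConjugate hpq hp2)
  have hk₁L : MemLp k₁ 1 volume := by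
    have := memLp_indicator_norm_rpow (s := 1) (q := 1) one_pos (by norm_num) 1
    simpa [Real.rpow_neg_one, hk₁] using this
  have hsplit : ∀ w : Plane, ‖‖w‖⁻¹‖ₑ = ‖k₁ w‖ₑ + ‖k₂ w‖ₑ := fun w => by
    by_cases hw : w ∈ Metric.ball (0 : Plane) 1
    · simp [hk₁, hk₂, hw]
    · simp only [hk₁, hk₂, Set.indicator_of_notMem hw, Set.indicator_of_mem
        (show w ∈ (Metric.ball (0 : Plane) 1)ᶜ from hw), enorm_zero, zero_add]
  refine ⟨eLpNorm k₁ 1 volume + eLpNorm k₂ (ENNReal.ofReal q) volume,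
    ENNReal.add_ne_top.2 ⟨hk₁L.eLpNorm_ne_top, hk₂L.eLpNorm_ne_top⟩, fun f₀ hf₀ φ hφ => ?_⟩
  -- replace `f` by a measurable representative
  set f := hf₀.mk f₀ with hfdef
  have hf : Measurable f := hf₀.stronglyMeasurable_mk.measurable
  have hae : f₀ =ᵐ[volume] f := hf₀.ae_eq_mk
  rw [eLpNorm_congr_ae hae]
  have hin : ∀ x, ∫⁻ y, ‖‖x - y‖⁻¹‖ₑ * ‖f₀ y‖ₑ = (∫⁻ y, ‖k₁ y‖ₑ * ‖f (x - y)‖ₑ) +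
      ∫⁻ y, ‖k₂ (x - y)‖ₑ * ‖f y‖ₑ := by
    intro x
    have h1 : ∫⁻ y, ‖k₁ y‖ₑ * ‖f (x - y)‖ₑ = ∫⁻ y, ‖k₁ (x - y)‖ₑ * ‖f y‖ₑ := by
      rw [← lintegral_sub_left_eq_self _ x]
      simp
    have hm : Measurable fun y => ‖k₁ (x - y)‖ₑ * ‖f y‖ₑ :=
      (hk₁m.comp (measurable_const.sub measurable_id)).enorm.mul hf.enorm
    rw [h1, ← lintegral_add_left hm]
    refine lintegral_congr_ae (hae.mono fun y hy => ?_)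
    simp only
    rw [hy, hsplit, add_mul]
  simp only [hin]
  have hconvm : Measurable fun x => ∫⁻ y, ‖k₁ y‖ₑ * ‖f (x - y)‖ₑ :=
    Measurable.lintegral_prod_right ((hk₁m.comp measurable_snd).enorm.mul
      (hf.comp (measurable_fst.sub measurable_snd)).enorm)
  have hφe := hφ.enorm
  calc ∫⁻ x, ((∫⁻ y, ‖k₁ y‖ₑ * ‖f (x - y)‖ₑ) + ∫⁻ y, ‖k₂ (x - y)‖ₑ * ‖f y‖ₑ) * ‖φ x‖ₑ
      ≤ ∫⁻ x, ((∫⁻ y, ‖k₁ y‖ₑ * ‖f (x - y)‖ₑ) * ‖φ x‖ₑ +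
          eLpNorm k₂ (ENNReal.ofReal q) volume * eLpNorm f (ENNReal.ofReal p) volume *
            ‖φ x‖ₑ) := by
        refine lintegral_mono fun x => ?_
        rw [add_mul]
        gcongr
        refine (lintegral_enorm_mul_le hpq
          (aestronglyMeasurable_comp_sub_left hk₂m.aestronglyMeasurable x)
          hf₀.stronglyMeasurable_mk.aestronglyMeasurable).trans_eq ?_
        rw [eLpNorm_comp_sub_left hk₂m.aestronglyMeasurable]
    _ = (∫⁻ x, (∫⁻ y, ‖k₁ y‖ₑ * ‖f (x - y)‖ₑ) * ‖φ x‖ₑ) +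
          eLpNorm k₂ (ENNReal.ofReal q) volume * eLpNorm f (ENNReal.ofReal p) volume *
            eLpNorm φ 1 volume := by
        have hm : AEMeasurable fun x => (∫⁻ y, ‖k₁ y‖ₑ * ‖f (x - y)‖ₑ) * ‖φ x‖ₑ :=
          hconvm.aemeasurable.mul hφe
        rw [lintegral_add_left' hm, lintegral_const_mul'' _ hφe,
          eLpNorm_one_eq_lintegral_enorm]
    _ ≤ eLpNorm k₁ 1 volume * eLpNorm f (ENNReal.ofReal p) volume *
            eLpNorm φ (ENNReal.ofReal q) volume +
          eLpNorm k₂ (ENNReal.ofReal q) volume * eLpNorm f (ENNReal.ofReal p) volume *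
            eLpNorm φ 1 volume := by
        gcongr
        refine (ENNReal.lintegral_mul_le_Lp_mul_Lq volume hpq.symm hconvm.aemeasurable
          hφe).trans ?_
        rw [eLpNorm_eq_lintegral_rpow_enorm_toReal (f := φ) (by simpa using hpq.pos)
          ENNReal.ofReal_ne_top, ENNReal.toReal_ofReal hpq.nonneg]
        gcongr
        rw [eLpNorm_eq_lintegral_rpow_enorm_toReal (by simpa using hp0) ENNReal.ofReal_ne_top,
          ENNReal.toReal_ofReal hp0.le, eLpNorm_one_eq_lintegral_enorm]
        refine (ENNReal.rpow_le_rpow (lintegral_conv_rpow_le hp (k := fun y => ‖k₁ y‖ₑ)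
          (F := fun y => ‖f y‖ₑ) hk₁m.enorm hf.enorm) (by positivity)).trans_eq ?_
        rw [ENNReal.mul_rpow_of_nonneg _ _ (by positivity), ← ENNReal.rpow_mul,
          mul_one_div_cancel hp0.ne', ENNReal.rpow_one]
    _ ≤ _ := by
        rw [add_mul, add_mul]
        refine add_le_add ?_ ?_
        · gcongr; exact le_self_add
        · gcongr; exact le_add_self

/-! ### The logarithmic kernel and the potential of an `L^p` function -/

/-- A majorant of the logarithmic kernel, which lies in `L^q` for `q > 2`: the negative power is
`1 / q` near the origin and `1` away from it. -/
def logMajorant (q : ℝ) (w : Plane) : ℝ :=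
  if ‖w‖ < 1 then ‖w‖ ^ (-(1 / q)) else ‖w‖⁻¹

theorem logMajorant_nonneg (q : ℝ) (w : Plane) : 0 ≤ logMajorant q w := by
  rw [logMajorant]; split_ifs <;> positivity

theorem memLp_logMajorant {q : ℝ} (hq : 2 < q) :
    MemLp (logMajorant q) (ENNReal.ofReal q) volume := by
  have h1 := memLp_indicator_norm_rpow (s := 1 / q) (q := q) (by linarith)
    (by rw [one_div_mul_cancel (by linarith)]; norm_num) 1
  have h2 := memLp_indicator_compl_norm_inv hq
  have h3 := h1.add h2
  have e : logMajorant q = (Metric.ball (0 : Plane) 1).indicator (fun w => ‖w‖ ^ (-(1 / q))) +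
      (Metric.ball (0 : Plane) 1)ᶜ.indicator fun w => ‖w‖⁻¹ := by
    funext w
    by_cases hw : ‖w‖ < 1
    · simp [logMajorant, hw]
    · simp [logMajorant, hw]
  rwa [e]

theorem log_one_add_le_rpow {t s : ℝ} (ht : 0 ≤ t) (hs : 0 < s) (hs1 : s ≤ 1) :
    Real.log (1 + t) ≤ t ^ s / s := by
  have h1 : (1 + t) ^ s ≤ 1 + t ^ s := by
    simpa using Real.rpow_add_le_add_rpow zero_le_one ht hs.le hs1
  have h2 : s * Real.log (1 + t) ≤ t ^ s := by
    rw [← Real.log_rpow (by linarith)]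
    calc Real.log ((1 + t) ^ s) ≤ (1 + t) ^ s - 1 := Real.log_le_sub_one_of_pos (by positivity)
      _ ≤ t ^ s := by linarith
  rw [le_div_iff₀ hs]
  linarith

/-- From `log (1 + t) ≤ tˢ / s` with `t = d / |w|`, where `s = 1 / q` for `|w| < 1`, and `s = 1`
otherwise. -/
theorem log_norm_div_le {q : ℝ} (hq : 1 ≤ q) {v w : Plane} {d : ℝ} (hw : 0 < ‖w‖)
    (hvw : ‖w‖ ≤ ‖v‖) (hd : ‖v‖ ≤ ‖w‖ + d) :
    Real.log (‖v‖ / ‖w‖) ≤ (d + q * d ^ (1 / q)) * logMajorant q w := by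
  have hq0 : 0 < q := by linarith
  have hd0 : 0 ≤ d := by linarith
  have ht : 0 ≤ d / ‖w‖ := by positivity
  have h0 : Real.log (‖v‖ / ‖w‖) ≤ Real.log (1 + d / ‖w‖) := by
    apply Real.log_le_log (by apply div_pos <;> linarith)
    rw [div_le_iff₀ hw, add_mul, div_mul_cancel₀ _ hw.ne', one_mul]
    exact hd
  refine h0.trans ?_
  rw [logMajorant, add_mul]
  have hdq : 0 ≤ q * d ^ (1 / q) := by positivity
  split_ifs with h
  · have h1 := log_one_add_le_rpow ht (s := 1 / q) (by positivity)
      (by rw [div_le_one hq0]; exact hq)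
    have h2 : 0 ≤ d * ‖w‖ ^ (-(1 / q)) := by positivity
    rw [Real.div_rpow hd0 hw.le, div_div_eq_mul_div, div_one] at h1
    rw [Real.rpow_neg hw.le] at h2 ⊢
    calc _ ≤ d ^ (1 / q) / ‖w‖ ^ (1 / q) * q := h1
      _ = q * d ^ (1 / q) * (‖w‖ ^ (1 / q))⁻¹ := by ring
      _ ≤ _ := by linarith
  · have h1 := Real.log_le_sub_one_of_pos (show 0 < 1 + d / ‖w‖ by linarith)
    have h2 : 0 ≤ q * d ^ (1 / q) * ‖w‖⁻¹ := by positivity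
    rw [div_eq_mul_inv] at h1 ⊢
    linarith

/-- The logarithmic kernel, as a function of `y`, is dominated by an `L^q` function for every `q >
2`; the coefficient is locally bounded in `x`. -/
theorem abs_log_norm_sub_div_le {q : ℝ} (hq : 1 ≤ q) (x y : Plane) :
    |Real.log (‖x - y‖ / ‖y‖)| ≤
      (‖x‖ + q * ‖x‖ ^ (1 / q)) * (logMajorant q (x - y) + logMajorant q y) := by
  have hc : 0 ≤ ‖x‖ + q * ‖x‖ ^ (1 / q) := by positivity
  have n1 := mul_nonneg hc (logMajorant_nonneg q (x - y))
  have n2 := mul_nonneg hc (logMajorant_nonneg q y)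
  rw [mul_add]
  rcases (norm_nonneg y).eq_or_lt with h | hy
  · simp only [← h, div_zero, Real.log_zero, abs_zero]
    linarith
  rcases (norm_nonneg (x - y)).eq_or_lt with h | hxy
  · simp only [← h, zero_div, Real.log_zero, abs_zero]
    linarith
  rcases le_total ‖y‖ ‖x - y‖ with h | h
  · have h1 := log_norm_div_le hq hy h (d := ‖x‖)
      (by have := norm_sub_le x y; linarith)
    rw [abs_of_nonneg (Real.log_nonneg (by rwa [le_div_iff₀ hy, one_mul]))]
    linarith
  · have h1 := log_norm_div_le hq hxy h (d := ‖x‖)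
      (by have := norm_sub_norm_le y (y - x); rw [norm_sub_rev y x] at this; simp at this; linarith)
    rw [← inv_div, Real.log_inv, abs_neg,
      abs_of_nonneg (Real.log_nonneg (by rwa [le_div_iff₀ hxy, one_mul]))]
    linarith

theorem measurable_logKernel :
    Measurable fun z : Plane × Plane => Real.log (‖z.1 - z.2‖ / ‖z.2‖) := by
  fun_prop

theorem eLpNorm_logKernel_le {q : ℝ} (hq : 2 < q) (x : Plane) :
    eLpNorm (fun y => Real.log (‖x - y‖ / ‖y‖)) (ENNReal.ofReal q) volume ≤
      ENNReal.ofReal (‖x‖ + q * ‖x‖ ^ (1 / q)) *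
        (2 * eLpNorm (logMajorant q) (ENNReal.ofReal q) volume) := by
  have hN := memLp_logMajorant hq
  have hc : 0 ≤ ‖x‖ + q * ‖x‖ ^ (1 / q) := by positivity
  have hq1 : (1 : ℝ≥0∞) ≤ ENNReal.ofReal q := by
    rw [ENNReal.one_le_ofReal]; linarith
  have e : eLpNorm (fun y => Real.log (‖x - y‖ / ‖y‖)) (ENNReal.ofReal q) volume ≤
      eLpNorm ((‖x‖ + q * ‖x‖ ^ (1 / q)) •
        ((fun y => logMajorant q (x - y)) + logMajorant q)) (ENNReal.ofReal q) volume := by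
    refine eLpNorm_mono_real fun y => ?_
    exact abs_log_norm_sub_div_le (by linarith) x y
  refine e.trans ?_
  rw [eLpNorm_const_smul, Real.enorm_eq_ofReal hc]
  gcongr
  refine (eLpNorm_add_le (aestronglyMeasurable_comp_sub_left hN.1 x) hN.1 hq1).trans_eq ?_
  rw [eLpNorm_comp_sub_left hN.1, two_mul]

theorem memLp_logKernel {q : ℝ} (hq : 2 < q) (x : Plane) :
    MemLp (fun y => Real.log (‖x - y‖ / ‖y‖)) (ENNReal.ofReal q) volume :=
  ⟨(measurable_logKernel.comp (measurable_const.prodMk measurable_id)).aestronglyMeasurable,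
    (eLpNorm_logKernel_le hq x).trans_lt (ENNReal.mul_lt_top ENNReal.ofReal_lt_top
      (ENNReal.mul_lt_top (by simp) (memLp_logMajorant hq).eLpNorm_lt_top))⟩

theorem lintegral_potentialIntegrand_le {p q : ℝ} (hpq : q.HolderConjugate p) (hp2 : p < 2)
    {f : Plane → 𝕜} (hf : AEStronglyMeasurable f volume) (x : Plane) :
    ∫⁻ y, ‖potentialIntegrand f x y‖ₑ ≤ ENNReal.ofReal (‖x‖ + q * ‖x‖ ^ (1 / q)) *
      (2 * eLpNorm (logMajorant q) (ENNReal.ofReal q) volume *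
        eLpNorm f (ENNReal.ofReal p) volume) := by
  have hq := two_lt_of_holderConjugate hpq hp2
  simp only [potentialIntegrand, enorm_smul]
  refine (lintegral_enorm_mul_le hpq (memLp_logKernel hq x).1 hf).trans ?_
  rw [← mul_assoc]
  gcongr
  exact eLpNorm_logKernel_le hq x

theorem integrable_potentialIntegrand {p q : ℝ} (hpq : q.HolderConjugate p) (hp2 : p < 2)
    {f : Plane → 𝕜} (hf : MemLp f (ENNReal.ofReal p) volume) (x : Plane) :
    Integrable (potentialIntegrand f x) volume := by
  have hq := two_lt_of_holderConjugate hpq hp2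
  refine ⟨(memLp_logKernel hq x).1.smul hf.1, ?_⟩
  refine (lintegral_potentialIntegrand_le hpq hp2 hf.1 x).trans_lt ?_
  exact ENNReal.mul_lt_top ENNReal.ofReal_lt_top (ENNReal.mul_lt_top
    (ENNReal.mul_lt_top (by simp) (memLp_logMajorant hq).eLpNorm_lt_top) hf.eLpNorm_lt_top)

theorem enorm_neg_one_div_two_pi_le : ‖(-(1 / (2 * π)) : ℝ)‖ₑ ≤ 1 := by
  rw [← ofReal_norm, norm_neg, Real.norm_of_nonneg (by positivity), ENNReal.ofReal_le_one,
    div_le_one (by positivity)]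
  linarith [Real.pi_gt_three]

theorem enorm_potential_le {p q : ℝ} (hpq : q.HolderConjugate p) (hp2 : p < 2)
    {f : Plane → 𝕜} (hf : AEStronglyMeasurable f volume) (x : Plane) :
    ‖potential f x‖ₑ ≤ ENNReal.ofReal (‖x‖ + q * ‖x‖ ^ (1 / q)) *
      (2 * eLpNorm (logMajorant q) (ENNReal.ofReal q) volume *
        eLpNorm f (ENNReal.ofReal p) volume) := by
  rw [potential, enorm_smul]
  calc _ ≤ 1 * ‖∫ y, potentialIntegrand f x y‖ₑ := by
        gcongr; exact enorm_neg_one_div_two_pi_le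
    _ ≤ ∫⁻ y, ‖potentialIntegrand f x y‖ₑ := by
        rw [one_mul]; exact enorm_integral_le_lintegral_enorm _
    _ ≤ _ := lintegral_potentialIntegrand_le hpq hp2 hf x

theorem aestronglyMeasurable_potentialIntegrand {f : Plane → 𝕜}
    (hf : AEStronglyMeasurable f volume) :
    AEStronglyMeasurable (fun z : Plane × Plane => potentialIntegrand f z.1 z.2)
      (volume.prod volume) :=
  (measurable_logKernel.aestronglyMeasurable).smul hf.comp_snd

theorem aestronglyMeasurable_gradIntegrand {f : Plane → 𝕜}
    (hf : AEStronglyMeasurable f volume) (i : Fin 2) :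
    AEStronglyMeasurable (fun z : Plane × Plane => gradIntegrand f i z.1 z.2)
      (volume.prod volume) := by
  have : Measurable fun z : Plane × Plane => gradLog i (z.1 - z.2) :=
    (measurable_gradLog i).comp (measurable_fst.sub measurable_snd)
  exact this.aestronglyMeasurable.smul hf.comp_snd

theorem locallyIntegrable_potential {p q : ℝ} (hpq : q.HolderConjugate p) (hp2 : p < 2)
    {f : Plane → 𝕜} (hf : MemLp f (ENNReal.ofReal p) volume) :
    LocallyIntegrable (potential f) volume := by
  have hq := two_lt_of_holderConjugate hpq hp2
  set D := (2 * eLpNorm (logMajorant q) (ENNReal.ofReal q) volume *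
    eLpNorm f (ENNReal.ofReal p) volume) with hD
  have hDt : D ≠ ⊤ := (ENNReal.mul_lt_top
    (ENNReal.mul_lt_top (by simp) (memLp_logMajorant hq).eLpNorm_lt_top) hf.eLpNorm_lt_top).ne
  have hc : Continuous fun x : Plane => (‖x‖ + q * ‖x‖ ^ (1 / q)) * D.toReal :=
    (continuous_norm.add (continuous_const.mul
      (continuous_norm.rpow_const fun _ => Or.inr (by have := hpq.pos; positivity)))).mul
      continuous_const
  refine hc.locallyIntegrable.mono
    ((aestronglyMeasurable_potentialIntegrand hf.1).integral_prod_right'.const_smul _)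
    (Eventually.of_forall fun x => ?_)
  have hc0 : 0 ≤ ‖x‖ + q * ‖x‖ ^ (1 / q) := by have := hpq.pos; positivity
  rw [Real.norm_of_nonneg (by positivity), ← ENNReal.ofReal_le_ofReal_iff (by positivity),
    ofReal_norm, ENNReal.ofReal_mul hc0, ENNReal.ofReal_toReal hDt]
  exact enorm_potential_le hpq hp2 hf.1 x

theorem integrable_prod_of_lintegral {E : Type*} [NormedAddCommGroup E] {g : Plane → Plane → E}
    (hm : AEStronglyMeasurable (Function.uncurry g) (volume.prod volume))
    (h : ∫⁻ x, ∫⁻ y, ‖g x y‖ₑ < ⊤) : Integrable (Function.uncurry g) (volume.prod volume) := by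
  refine ⟨hm, ?_⟩
  rw [HasFiniteIntegral, lintegral_prod _ hm.enorm]
  exact h

/-- The integrability on the product space that justifies every exchange of integrals below. -/
theorem integrable_prod_of_enorm_le_riesz {E F : Type*} [NormedAddCommGroup E]
    [NormedAddCommGroup F] {p q : ℝ} (hpq : q.HolderConjugate p) (hp2 : p < 2) {f : Plane → 𝕜}
    (hf : MemLp f (ENNReal.ofReal p) volume) {φ : Plane → F}
    (hφ : MemLp φ (ENNReal.ofReal q) volume) (hφ1 : MemLp φ 1 volume) {g : Plane → Plane → E}
    (hm : AEStronglyMeasurable (Function.uncurry g) (volume.prod volume))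
    (hg : ∀ x y, ‖g x y‖ₑ ≤ ‖‖x - y‖⁻¹‖ₑ * ‖f y‖ₑ * ‖φ x‖ₑ) :
    Integrable (Function.uncurry g) (volume.prod volume) := by
  obtain ⟨C, hC, h⟩ := exists_lintegral_riesz_le (𝕜 := 𝕜) (F := F) hpq hp2
  refine integrable_prod_of_lintegral hm (lt_of_le_of_lt ?_ ((h f hf.1 φ hφ.1).trans_lt
    (ENNReal.mul_lt_top (ENNReal.mul_lt_top hC.lt_top hf.eLpNorm_lt_top)
      (ENNReal.add_lt_top.2 ⟨hφ.eLpNorm_lt_top, hφ1.eLpNorm_lt_top⟩))))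
  refine lintegral_mono fun x => ?_
  rw [← lintegral_mul_const' _ _ enorm_ne_top]
  exact lintegral_mono fun y => hg x y

theorem gradIntegrand_eq (f : Plane → 𝕜) (i : Fin 2) (x y : Plane) :
    gradIntegrand f i x y = gradLog i (x - y) • f y := rfl

theorem enorm_gradIntegrand_le (f : Plane → 𝕜) (i : Fin 2) (x y : Plane) :
    ‖gradIntegrand f i x y‖ₑ ≤ ‖‖x - y‖⁻¹‖ₑ * ‖f y‖ₑ := by
  rw [gradIntegrand_eq, enorm_smul]
  gcongr
  rw [← ofReal_norm, ← ofReal_norm, norm_inv, norm_norm]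
  exact ENNReal.ofReal_le_ofReal (abs_gradLog_le i _)

theorem gradLog_neg (i : Fin 2) (w : Plane) : gradLog i (-w) = - gradLog i w := by
  simp [gradLog, neg_div]

/-- Integrating the gradient of the kernel against a test function in the *first* variable
reverses the sign, the kernel being odd. -/
theorem integral_gradLog_sub_smul {F : Type*} [NormedAddCommGroup F] [NormedSpace ℝ F]
    (φ : Plane → F) (i : Fin 2) (y : Plane) :
    ∫ x, gradLog i (x - y) • φ x = - ∫ w, gradLog i w • φ (y - w) := by
  rw [← integral_sub_left_eq_self _ volume y, ← integral_neg]
  refine integral_congr_ae (Eventually.of_forall fun w => ?_)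
  simp only
  rw [show y - w - y = -w by abel, gradLog_neg, neg_smul]

theorem integral_partialDeriv_eq_zero {φ : Plane → 𝕜} (hφ : ContDiff ℝ 1 φ)
    (hs : HasCompactSupport φ) (i : Fin 2) : ∫ x, partialDeriv i φ x = 0 := by
  have h := congrFun (partialDeriv_kconv (k := fun _ => 1)
    (continuous_const.locallyIntegrable) hφ hs i) 0
  have h1 : kconv (fun _ => 1) φ = fun _ => ∫ x, φ x := by
    funext x
    simp only [kconv, one_smul]
    exact integral_sub_left_eq_self φ volume x
  rw [h1, partialDeriv, fderiv_fun_const, kconv] at h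
  simp only [one_smul, zero_sub, Pi.zero_apply, zero_apply] at h
  rw [integral_neg_eq_self (fun x => partialDeriv i φ x)] at h
  exact h.symm

/-- The term `log |y|` of the kernel drops out because `∫ ∂ᵢφ = 0`. -/
theorem integral_partialDeriv_mul_log {φ : Plane → ℝ} (hφ : ContDiff ℝ 1 φ)
    (hs : HasCompactSupport φ) (i : Fin 2) {y : Plane} (hy : y ≠ 0) :
    ∫ x, partialDeriv i φ x * Real.log (‖x - y‖ / ‖y‖) =
      - ∫ x, gradLog i (x - y) * φ x := by
  have h0 := integral_gradLog_sub_smul φ i y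
  simp only [smul_eq_mul] at h0
  rw [h0, neg_neg]
  have hA : kconv (fun w => Real.log ‖w‖) (partialDeriv i φ) y = kconv (gradLog i) φ y :=
    kconv_log_partialDeriv hφ hs i y
  have hpc := continuous_partialDeriv hφ i
  have hps := hasCompactSupport_partialDeriv hs i
  have hi : Integrable fun w => Real.log ‖w‖ • partialDeriv i φ (y - w) :=
    integrable_smul_comp_sub locallyIntegrable_log_norm hpc hps y
  have hi2 : Integrable fun w => partialDeriv i φ (y - w) :=
    (hpc.integrable_of_hasCompactSupport hps).comp_sub_left y
  simp only [kconv, smul_eq_mul] at hA hi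
  rw [← hA, ← integral_sub_left_eq_self _ volume y]
  have hz : ∫ w, partialDeriv i φ (y - w) = 0 := by
    rw [integral_sub_left_eq_self (fun x => partialDeriv i φ x),
      integral_partialDeriv_eq_zero hφ hs]
  have : ∫ w, Real.log ‖w‖ * partialDeriv i φ (y - w) =
      ∫ w, (Real.log ‖w‖ * partialDeriv i φ (y - w) - Real.log ‖y‖ * partialDeriv i φ (y - w)) := by
    rw [integral_sub hi (hi2.const_mul _), integral_const_mul, hz, mul_zero, sub_zero]
  rw [this]
  refine integral_congr_ae ?_
  filter_upwards [compl_mem_ae_iff.2 (measure_singleton (μ := (volume : Measure Plane)) 0)]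
    with w hw
  have hw0 : ‖w‖ ≠ 0 := norm_ne_zero_iff.2 hw
  rw [show y - w - y = -w by abel, norm_neg, Real.log_div hw0 (norm_ne_zero_iff.2 hy)]
  ring

theorem integrable_prod_potentialIntegrand {p q : ℝ} (hpq : q.HolderConjugate p) (hp2 : p < 2)
    {f : Plane → 𝕜} (hf : MemLp f (ENNReal.ofReal p) volume) {ψ : Plane → ℝ}
    (hψ : Continuous ψ) (hs : HasCompactSupport ψ) :
    Integrable (Function.uncurry fun x y => ψ x • potentialIntegrand f x y)
      (volume.prod volume) := by
  have hq := two_lt_of_holderConjugate hpq hp2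
  have hq0 := hpq.pos
  refine integrable_prod_of_lintegral ((hψ.aestronglyMeasurable (μ := volume)).comp_fst.smul
    (aestronglyMeasurable_potentialIntegrand hf.1)) ?_
  set D := (2 * eLpNorm (logMajorant q) (ENNReal.ofReal q) volume *
    eLpNorm f (ENNReal.ofReal p) volume) with hD
  have hDt : D < ⊤ := ENNReal.mul_lt_top
    (ENNReal.mul_lt_top (by simp) (memLp_logMajorant hq).eLpNorm_lt_top) hf.eLpNorm_lt_top
  set g : Plane → ℝ := fun x => ‖x‖ + q * ‖x‖ ^ (1 / q) with hg
  have hg0 : ∀ x, 0 ≤ g x := fun x => by positivity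
  have hgc : Continuous g := continuous_norm.add (continuous_const.mul
    (continuous_norm.rpow_const fun _ => Or.inr (by positivity)))
  have hcs : HasCompactSupport (g • ψ) := hs.smul_left
  have hci : Integrable (g • ψ) volume := (hgc.smul hψ).integrable_of_hasCompactSupport hcs
  calc ∫⁻ x, ∫⁻ y, ‖ψ x • potentialIntegrand f x y‖ₑ
      ≤ ∫⁻ x, ‖(g • ψ) x‖ₑ * D := by
        refine lintegral_mono fun x => ?_
        simp only [enorm_smul, Pi.smul_apply', smul_eq_mul, enorm_mul]
        rw [lintegral_const_mul' _ _ enorm_ne_top, mul_comm ‖g x‖ₑ, mul_assoc,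
          Real.enorm_eq_ofReal (hg0 x)]
        gcongr
        exact lintegral_potentialIntegrand_le hpq hp2 hf.1 x
    _ = (∫⁻ x, ‖(g • ψ) x‖ₑ) * D := lintegral_mul_const' _ _ hDt.ne
    _ < ⊤ := ENNReal.mul_lt_top hci.2 hDt

/-- The integration by parts defining the weak gradient of the potential. -/
theorem integral_partialDeriv_smul_potential {p q : ℝ} (hpq : q.HolderConjugate p) (hp2 : p < 2)
    {f : Plane → 𝕜} (hf : MemLp f (ENNReal.ofReal p) volume) (i : Fin 2) {φ : Plane → ℝ}
    (hφ : ContDiff ℝ ∞ φ) (hs : HasCompactSupport φ) :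
    ∫ x, partialDeriv i φ x • potential f x = - ∫ x, φ x • gradPotential f x i := by
  have hq := two_lt_of_holderConjugate hpq hp2
  have hφ1 : ContDiff ℝ 1 φ := hφ.of_le (by simp)
  have hpc := continuous_partialDeriv hφ1 i
  have hps := hasCompactSupport_partialDeriv hs i
  set c : ℝ := -(1 / (2 * π)) with hc
  have i1 := integrable_prod_potentialIntegrand hpq hp2 hf hpc hps
  have i2 : Integrable (Function.uncurry fun x y => φ x • gradIntegrand f i x y)
      (volume.prod volume) := by
    refine integrable_prod_of_enorm_le_riesz hpq hp2 hf
      (hφ.continuous.memLp_of_hasCompactSupport hs)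
      (hφ.continuous.memLp_of_hasCompactSupport hs) ?_ fun x y => ?_
    · exact (hφ.continuous.aestronglyMeasurable (μ := volume)).comp_fst.smul
        (aestronglyMeasurable_gradIntegrand hf.1 i)
    · rw [enorm_smul, mul_comm]
      gcongr
      exact enorm_gradIntegrand_le f i x y
  calc ∫ x, partialDeriv i φ x • potential f x
      = c • ∫ x, ∫ y, partialDeriv i φ x • potentialIntegrand f x y := by
        rw [← integral_smul]
        refine integral_congr_ae (Eventually.of_forall fun x => ?_)
        simp only [potential]
        rw [integral_smul, smul_comm]
    _ = c • ∫ y, ∫ x, partialDeriv i φ x • potentialIntegrand f x y := by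
        rw [integral_integral_swap i1]
    _ = c • ∫ y, - ∫ x, φ x • gradIntegrand f i x y := by
        congr 1
        refine integral_congr_ae ?_
        filter_upwards [compl_mem_ae_iff.2 (measure_singleton (μ := (volume : Measure Plane)) 0)]
          with y hy
        have h := integral_partialDeriv_mul_log hφ1 hs i hy
        simp only [potentialIntegrand, gradIntegrand_eq, smul_smul]
        rw [integral_smul_const, h, integral_smul_const, neg_smul]
        simp only [mul_comm]
    _ = - ∫ x, φ x • gradPotential f x i := by
        rw [integral_neg, ← integral_integral_swap i2, smul_neg, ← integral_smul]
        congr 1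
        refine integral_congr_ae (Eventually.of_forall fun x => ?_)
        simp only [gradPotential]
        rw [integral_smul, smul_comm]

/-! ### Exponents above that of a bounded function -/

theorem memLp_of_le_exponent_of_bounded {F : Type*} [NormedAddCommGroup F] {f : Plane → F}
    {p r : ℝ≥0∞} (hp0 : p ≠ 0) (hpr : p ≤ r) (hf : MemLp f p volume) {C : ℝ}
    (hC : ∀ x, ‖f x‖ ≤ C) : MemLp f r volume := by
  rcases eq_or_ne r ⊤ with rfl | hr
  · exact memLp_top_of_bound hf.1 C (Eventually.of_forall hC)
  have hpt : p ≠ ⊤ := ne_top_of_le_ne_top hr hpr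
  have hr0 : r ≠ 0 := fun h => hp0 (le_antisymm (h ▸ hpr) zero_le)
  refine ⟨hf.1, ?_⟩
  have hfin := (eLpNorm_lt_top_iff_lintegral_rpow_enorm_lt_top hp0 hpt).1 hf.2
  rw [eLpNorm_lt_top_iff_lintegral_rpow_enorm_lt_top hr0 hr]
  have hle : p.toReal ≤ r.toReal := ENNReal.toReal_mono hr hpr
  have hs : 0 ≤ r.toReal - p.toReal := by linarith
  calc ∫⁻ x, ‖f x‖ₑ ^ r.toReal
      ≤ ∫⁻ x, ENNReal.ofReal C ^ (r.toReal - p.toReal) * ‖f x‖ₑ ^ p.toReal := by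
        refine lintegral_mono fun x => ?_
        calc ‖f x‖ₑ ^ r.toReal = ‖f x‖ₑ ^ (r.toReal - p.toReal) * ‖f x‖ₑ ^ p.toReal := by
              rw [← ENNReal.rpow_add_of_nonneg _ _ hs ENNReal.toReal_nonneg, sub_add_cancel]
          _ ≤ _ := by
              gcongr
              rw [← ofReal_norm]
              exact ENNReal.ofReal_le_ofReal (hC x)
    _ = ENNReal.ofReal C ^ (r.toReal - p.toReal) * ∫⁻ x, ‖f x‖ₑ ^ p.toReal :=
        lintegral_const_mul' _ _ (by finiteness)
    _ < ⊤ := ENNReal.mul_lt_top (by finiteness) hfin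

/-! ### The weak form of Poisson's equation -/

theorem isTame_schwartz (φ : 𝓢(Plane, 𝕜)) : IsTame φ := by
  have hd : ∀ i, partialDeriv i φ = LineDeriv.lineDerivOp (basisVec i) φ := fun i => rfl
  have hb : ∀ ψ : 𝓢(Plane, 𝕜), ∃ C, ∀ x, ‖ψ x‖ ≤ C := fun ψ =>
    ⟨_, ψ.toBoundedContinuousFunction.norm_coe_le_norm⟩
  refine ⟨φ.smooth 1, φ.integrable, hb φ, fun i => ?_, ?_⟩
  · rw [hd]; exact SchwartzMap.integrable _
  · choose C hC using fun i => hb (LineDeriv.lineDerivOp (basisVec i) φ)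
    exact ⟨max (C 0) (C 1), fun i x => by
      rw [hd]; exact (hC i x).trans (by fin_cases i <;> simp)⟩

theorem integrable_prod_gradIntegrand_mul {p q : ℝ} (hpq : q.HolderConjugate p) (hp2 : p < 2)
    {f : Plane → 𝕜} (hf : MemLp f (ENNReal.ofReal p) volume) {ψ : Plane → 𝕜}
    (hψ : MemLp ψ (ENNReal.ofReal q) volume) (hψ1 : MemLp ψ 1 volume) (i : Fin 2) :
    Integrable (Function.uncurry fun x y => gradIntegrand f i x y * ψ x)
      (volume.prod volume) := by
  refine integrable_prod_of_enorm_le_riesz hpq hp2 hf hψ hψ1 ?_ fun x y => ?_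
  · exact (aestronglyMeasurable_gradIntegrand hf.1 i).mul hψ.1.comp_fst
  · rw [enorm_mul]
    gcongr
    exact enorm_gradIntegrand_le f i x y

/-- The weak form of Poisson's equation: after exchanging the order of integration it is Green's
representation formula for the test function. -/
theorem integral_sum_gradPotential_mul_partialDeriv {p q : ℝ} (hpq : q.HolderConjugate p)
    (hp2 : p < 2) {f : Plane → 𝕜} (hf : MemLp f (ENNReal.ofReal p) volume) {φ : Plane → 𝕜}
    (hφ : IsTame φ) :
    ∫ x, ∑ i, gradPotential f x i * partialDeriv i φ x = ∫ x, f x * φ x := by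
  set c : ℝ := -(1 / (2 * π)) with hc
  have hq1 : (1 : ℝ≥0∞) ≤ ENNReal.ofReal q := by
    rw [ENNReal.one_le_ofReal]; exact hpq.lt.le
  obtain ⟨C, hC⟩ := hφ.bounded_deriv
  have hm1 : ∀ i, MemLp (partialDeriv i φ) 1 volume := fun i =>
    memLp_one_iff_integrable.2 (hφ.integrable_deriv i)
  have hi := fun i => integrable_prod_gradIntegrand_mul hpq hp2 hf
    (memLp_of_le_exponent_of_bounded one_ne_zero hq1 (hm1 i) (hC i)) (hm1 i) i
  have hG : ∀ i x, gradPotential f x i * partialDeriv i φ x =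
      c • ∫ y, gradIntegrand f i x y * partialDeriv i φ x := fun i x => by
    simp only [gradPotential]
    rw [integral_mul_const, smul_mul_assoc]
  have hinner : ∀ i y, ∫ x, gradIntegrand f i x y * partialDeriv i φ x =
      - (f y * kconv (gradLog i) (partialDeriv i φ) y) := fun i y => by
    have h := integral_gradLog_sub_smul (partialDeriv i φ) i y
    rw [kconv, ← mul_neg, ← h, ← integral_const_mul]
    refine integral_congr_ae (Eventually.of_forall fun x => ?_)
    simp only [gradIntegrand_eq]
    rw [smul_mul_assoc, mul_smul_comm]
  calc ∫ x, ∑ i, gradPotential f x i * partialDeriv i φ x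
      = ∑ i, c • ∫ x, ∫ y, gradIntegrand f i x y * partialDeriv i φ x := by
        simp only [hG]
        have h1 : ∀ i, Integrable fun x =>
            c • ∫ y, gradIntegrand f i x y * partialDeriv i φ x := fun i =>
          (hi i).integral_prod_left.smul c
        rw [integral_finsetSum _ fun i _ => h1 i]
        simp only [integral_smul]
    _ = ∑ i, c • ∫ y, ∫ x, gradIntegrand f i x y * partialDeriv i φ x := by
        simp only [integral_integral_swap (hi _)]
    _ = ∫ y, ∑ i, c • ∫ x, gradIntegrand f i x y * partialDeriv i φ x := by
        have h1 : ∀ i, Integrable fun y =>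
            c • ∫ x, gradIntegrand f i x y * partialDeriv i φ x := fun i =>
          (hi i).integral_prod_right.smul c
        rw [integral_finsetSum _ fun i _ => h1 i]
        simp only [integral_smul]
    _ = ∫ x, f x * φ x := by
        refine integral_congr_ae (Eventually.of_forall fun y => ?_)
        simp only [hinner]
        rw [← Finset.smul_sum, Finset.sum_neg_distrib, ← Finset.mul_sum,
          sum_kconv_gradLog_partialDeriv hφ, hc, smul_neg, neg_smul, neg_neg, mul_smul_comm,
          smul_smul, one_div, inv_mul_cancel₀ (by positivity), one_smul]

/-! ### Almost everywhere convergence and integrability of the gradient -/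

/-- The absolute Riesz integral `∫ |x - y|⁻¹ |f(y)| dy`, as an extended nonnegative number. -/
def rieszIntegral (f : Plane → 𝕜) (x : Plane) : ℝ≥0∞ := ∫⁻ y, ‖‖x - y‖⁻¹‖ₑ * ‖f y‖ₑ

/-- Integrated against an everywhere positive weight in `L¹ ∩ L^q`, the sum is finite. -/
theorem ae_tsum_rieszIntegral_ne_top {ι : Type*} [Countable ι] {p q : ℝ}
    (hpq : q.HolderConjugate p) (hp2 : p < 2) {f : ι → Plane → 𝕜}
    (hf : ∀ n, AEStronglyMeasurable (f n) volume)
    (hsum : ∑' n, eLpNorm (f n) (ENNReal.ofReal p) volume ≠ ⊤) :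
    ∀ᵐ x ∂(volume : Measure Plane), ∑' n, rieszIntegral (f n) x ≠ ⊤ := by
  obtain ⟨C, hC, h⟩ := exists_lintegral_riesz_le (𝕜 := 𝕜) (F := ℝ) hpq hp2
  -- an everywhere positive weight in `L¹ ∩ L^q`
  set φ : Plane → ℝ := fun z => 2 / (1 + ‖z‖ ^ 2) ^ 2 with hφ
  have hφpos : ∀ x, 0 < φ x := fun x => by positivity
  have hφ1 : MemLp φ 1 volume := memLp_one_iff_integrable.2 integral_two_div_one_add_norm_sq.1
  have hφq : MemLp φ (ENNReal.ofReal q) volume := by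
    refine memLp_of_le_exponent_of_bounded one_ne_zero
      (by rw [ENNReal.one_le_ofReal]; exact hpq.lt.le) hφ1 (C := 2) fun x => ?_
    rw [Real.norm_of_nonneg (hφpos x).le, div_le_iff₀ (by positivity)]
    nlinarith [sq_nonneg ‖x‖, sq_nonneg (‖x‖ ^ 2)]
  have hm : ∀ n, AEMeasurable (rieszIntegral (f n)) volume := fun n => by
    have h1 : AEMeasurable (fun z : Plane × Plane => ‖‖z.1 - z.2‖⁻¹‖ₑ)
        (volume.prod volume) := Measurable.aemeasurable (by fun_prop)
    exact (h1.mul (hf n).comp_snd.enorm).lintegral_prod_right'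
  have hm2 : ∀ n, AEMeasurable (fun x => rieszIntegral (f n) x * ‖φ x‖ₑ) volume := fun n =>
    (hm n).mul hφ1.1.enorm
  have hfin : ∫⁻ x, ∑' n, rieszIntegral (f n) x * ‖φ x‖ₑ ≠ ⊤ := by
    rw [lintegral_tsum hm2]
    refine ne_top_of_le_ne_top ?_ (ENNReal.tsum_le_tsum fun n => h (f n) (hf n) φ hφ1.1)
    rw [ENNReal.tsum_mul_right, ENNReal.tsum_mul_left]
    exact ENNReal.mul_ne_top (ENNReal.mul_ne_top hC hsum)
      (ENNReal.add_ne_top.2 ⟨hφq.eLpNorm_ne_top, hφ1.eLpNorm_ne_top⟩)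
  filter_upwards [ae_lt_top' (AEMeasurable.tsum hm2) hfin] with x hx
  rw [ENNReal.tsum_mul_right] at hx
  intro htop
  rw [htop, ENNReal.top_mul (by rw [enorm_ne_zero]; exact (hφpos x).ne')] at hx
  exact lt_irrefl _ hx

theorem integrable_gradIntegrand_of_rieszIntegral_ne_top {f : Plane → 𝕜}
    (hf : AEStronglyMeasurable f volume) {x : Plane} (hx : rieszIntegral f x ≠ ⊤) (i : Fin 2) :
    Integrable (gradIntegrand f i x) volume := by
  have hm : Measurable fun y => gradLog i (x - y) :=
    (measurable_gradLog i).comp (measurable_const.sub measurable_id)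
  exact ⟨hm.aestronglyMeasurable.smul hf,
    (lintegral_mono fun y => enorm_gradIntegrand_le f i x y).trans_lt hx.lt_top⟩

theorem ae_integrable_gradIntegrand {p q : ℝ} (hpq : q.HolderConjugate p) (hp2 : p < 2)
    {f : Plane → 𝕜} (hf : MemLp f (ENNReal.ofReal p) volume) :
    ∀ᵐ x ∂(volume : Measure Plane), ∀ i, Integrable (gradIntegrand f i x) volume := by
  have h := ae_tsum_rieszIntegral_ne_top hpq hp2 (ι := Unit) (f := fun _ => f) (fun _ => hf.1)
    (by simpa using hf.eLpNorm_ne_top)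
  filter_upwards [h] with x hx i
  exact integrable_gradIntegrand_of_rieszIntegral_ne_top hf.1 (by simpa using hx) i

theorem gradPotential_apply_eq_kconv (f : Plane → 𝕜) (x : Plane) (i : Fin 2) :
    gradPotential f x i = (-(1 / (2 * π)) : ℝ) • kconv (gradLog i) f x := by
  simp only [gradPotential]
  rw [kconv, ← integral_sub_left_eq_self _ volume x]
  simp only [gradIntegrand_eq, sub_sub_cancel]

/-- Rapidly converging smooth approximations of an `L^p` function. -/
theorem exists_contDiff_seq_eLpNorm_sub_le {p : ℝ} (hp : 1 ≤ p) {f : Plane → 𝕜}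
    (hf : MemLp f (ENNReal.ofReal p) volume) :
    ∃ g : ℕ → Plane → 𝕜, ∀ n, ContDiff ℝ ∞ (g n) ∧ HasCompactSupport (g n) ∧
      eLpNorm (g n - f) (ENNReal.ofReal p) volume ≤ 2⁻¹ ^ n := by
  have h : ∀ n : ℕ, ∃ g : Plane → 𝕜, ContDiff ℝ ∞ g ∧ HasCompactSupport g ∧
      eLpNorm (g - f) (ENNReal.ofReal p) volume ≤ 2⁻¹ ^ n := fun n => by
    obtain ⟨g, h1, h2, h3⟩ := hf.exist_eLpNorm_sub_le ENNReal.ofReal_ne_top (by simpa using hp)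
      (ε := 2⁻¹ ^ n) (by positivity)
    refine ⟨g, h2, h1, ?_⟩
    rw [eLpNorm_sub_comm]
    refine h3.trans_eq ?_
    rw [ENNReal.ofReal_pow (by norm_num), ENNReal.ofReal_inv_of_pos two_pos]
    simp
  choose g hg using h
  exact ⟨g, hg⟩

theorem aestronglyMeasurable_gradPotential_apply {f : Plane → 𝕜}
    (hf : AEStronglyMeasurable f volume) (i : Fin 2) :
    AEStronglyMeasurable (fun x => gradPotential f x i) volume :=
  (aestronglyMeasurable_gradIntegrand hf i).integral_prod_right'.const_smul _

/-- Almost everywhere convergence of the gradients along rapidly converging sequences. -/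
theorem ae_tendsto_gradPotential {p q : ℝ} (hpq : q.HolderConjugate p) (hp2 : p < 2)
    {f : Plane → 𝕜} (hf : MemLp f (ENNReal.ofReal p) volume) {g : ℕ → Plane → 𝕜}
    (hgm : ∀ n, MemLp (g n) (ENNReal.ofReal p) volume)
    (hg : ∀ n, eLpNorm (g n - f) (ENNReal.ofReal p) volume ≤ 2⁻¹ ^ n) :
    ∀ᵐ x ∂(volume : Measure Plane), ∀ i,
      Tendsto (fun n => gradPotential (g n) x i) atTop (𝓝 (gradPotential f x i)) := by
  have hsum : ∑' n, eLpNorm (g n - f) (ENNReal.ofReal p) volume ≠ ⊤ := by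
    refine ne_top_of_le_ne_top ?_ (ENNReal.tsum_le_tsum hg)
    rw [ENNReal.tsum_geometric]
    simp
  filter_upwards [ae_tsum_rieszIntegral_ne_top hpq hp2 (fun n => (hgm n).1.sub hf.1) hsum,
    ae_integrable_gradIntegrand hpq hp2 hf,
    ae_all_iff.2 fun n => ae_integrable_gradIntegrand hpq hp2 (hgm n)] with x hx hxf hxg i
  have h0 := ENNReal.tendsto_atTop_zero_of_tsum_ne_top hx
  rw [tendsto_iff_edist_tendsto_0]
  refine tendsto_of_tendsto_of_tendsto_of_le_of_le tendsto_const_nhds h0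
    (fun n => zero_le) fun n => ?_
  simp only
  rw [edist_eq_enorm_sub]
  have e : gradPotential (g n) x i - gradPotential f x i =
      (-(1 / (2 * π)) : ℝ) • ∫ y, gradIntegrand (g n - f) i x y := by
    simp only [gradPotential]
    rw [← smul_sub, ← integral_sub (hxg n i) (hxf i)]
    simp only [gradIntegrand, Pi.sub_apply, smul_sub]
  rw [e, enorm_smul]
  calc _ ≤ 1 * ‖∫ y, gradIntegrand (g n - f) i x y‖ₑ := by
        gcongr; exact enorm_neg_one_div_two_pi_le
    _ ≤ ∫⁻ y, ‖gradIntegrand (g n - f) i x y‖ₑ := by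
        rw [one_mul]; exact enorm_integral_le_lintegral_enorm _
    _ ≤ _ := lintegral_mono fun y => enorm_gradIntegrand_le _ i x y

/-- The Hardy–Littlewood–Sobolev inequality for smooth approximations of `f`, and Fatou's lemma. -/
theorem memLp_gradPotential {p : ℝ} (hp : 1 < p) (hp2 : p < 2)
    {f : Plane → 𝕜} (hf : MemLp f (ENNReal.ofReal p) volume) :
    MemLp (gradPotential f) (ENNReal.ofReal (sobolevConj p)) volume := by
  have hpq := (Real.HolderConjugate.conjExponent hp).symm
  obtain ⟨C, hC, hHLS⟩ := exists_eLpNorm_kconv_gradLog_le (𝕜 := 𝕜) hp hp2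
  obtain ⟨g, hg⟩ := exists_contDiff_seq_eLpNorm_sub_le hp.le hf
  have hgm : ∀ n, MemLp (g n) (ENNReal.ofReal p) volume := fun n =>
    (hg n).1.continuous.memLp_of_hasCompactSupport (hg n).2.1
  have hp1 : 1 ≤ ENNReal.ofReal p := by simpa using hp.le
  refine MemLp.of_eval_piLp fun i => ⟨aestronglyMeasurable_gradPotential_apply hf.1 i, ?_⟩
  have hlim := Lp.eLpNorm_lim_le_liminf_eLpNorm (p := ENNReal.ofReal (sobolevConj p))
    (fun n => aestronglyMeasurable_gradPotential_apply (hgm n).1 i) _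
    ((ae_tendsto_gradPotential hpq hp2 hf hgm fun n => (hg n).2.2).mono fun x hx => hx i)
  refine hlim.trans_lt (lt_of_le_of_lt (b := C * (1 + eLpNorm f (ENNReal.ofReal p) volume)) ?_
    (ENNReal.mul_lt_top hC.lt_top (ENNReal.add_lt_top.2 ⟨ENNReal.one_lt_top, hf.2⟩)))
  refine liminf_le_of_le (by isBoundedDefault) fun b hb => ?_
  obtain ⟨n, hn⟩ := hb.exists
  refine hn.trans ?_
  simp only [gradPotential_apply_eq_kconv]
  have e := eLpNorm_const_smul (-(1 / (2 * π)) : ℝ) (kconv (gradLog i) (g n))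
    (ENNReal.ofReal (sobolevConj p)) volume
  have hgn : eLpNorm (g n) (ENNReal.ofReal p) volume ≤
      1 + eLpNorm f (ENNReal.ofReal p) volume := by
    calc eLpNorm (g n) (ENNReal.ofReal p) volume
        = eLpNorm ((g n - f) + f) (ENNReal.ofReal p) volume := by rw [sub_add_cancel]
      _ ≤ _ := eLpNorm_add_le ((hgm n).1.sub hf.1) hf.1 hp1
      _ ≤ _ := by
        gcongr
        exact (hg n).2.2.trans (pow_le_one₀ zero_le (by simp))
  calc _ = ‖(-(1 / (2 * π)) : ℝ)‖ₑ *
        eLpNorm (kconv (gradLog i) (g n)) (ENNReal.ofReal (sobolevConj p)) volume := e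
    _ ≤ 1 * (C * eLpNorm (g n) (ENNReal.ofReal p) volume) := by
        gcongr
        · exact enorm_neg_one_div_two_pi_le
        · exact hHLS _ (hg n).1 (hg n).2.1 i
    _ ≤ _ := by rw [one_mul]; gcongr

theorem hasWeakGradient_potential {p : ℝ} (hp : 1 < p) (hp2 : p < 2)
    {f : Plane → 𝕜} (hf : MemLp f (ENNReal.ofReal p) volume) :
    HasWeakGradient (potential f) (gradPotential f) := by
  have hpq := (Real.HolderConjugate.conjExponent hp).symm
  refine ⟨locallyIntegrable_potential hpq hp2 hf, (memLp_gradPotential hp hp2 hf).locallyIntegrable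
    ?_, fun i φ hφ hs => integral_partialDeriv_smul_potential hpq hp2 hf i hφ hs⟩
  rw [ENNReal.one_le_ofReal]
  linarith [lt_sobolevConj hp hp2]

/-! ### Decay at infinity -/

theorem tendsto_eLpNorm_restrict_norm_gt {F : Type*} [NormedAddCommGroup F] {G : Plane → F}
    {r : ℝ} (hr : 0 < r) (hG : MemLp G (ENNReal.ofReal r) volume) :
    Tendsto (fun R : ℝ => eLpNorm G (ENNReal.ofReal r)
      (volume.restrict {x : Plane | R < ‖x‖})) atTop (𝓝 0) := by
  have hr0 : ENNReal.ofReal r ≠ 0 := by simpa using hr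
  have hms : ∀ R : ℝ, MeasurableSet {x : Plane | R < ‖x‖} := fun R =>
    measurableSet_lt measurable_const measurable_norm
  have hfin := (eLpNorm_lt_top_iff_lintegral_rpow_enorm_lt_top hr0 ENNReal.ofReal_ne_top).1 hG.2
  rw [ENNReal.toReal_ofReal hr.le] at hfin
  have hlim := tendsto_measure_iInter_atTop
    (μ := volume.withDensity fun x => ‖G x‖ₑ ^ r) (s := fun R : ℝ => {x : Plane | R < ‖x‖})
    (fun R => (hms R).nullMeasurableSet) (fun a b hab x hx => lt_of_le_of_lt hab hx)
    ⟨0, ne_top_of_le_ne_top hfin.ne (by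
      rw [withDensity_apply _ (hms 0)]; exact setLIntegral_le_lintegral _ _)⟩
  have hempty : (⋂ R : ℝ, {x : Plane | R < ‖x‖}) = ∅ :=
    Set.eq_empty_of_forall_notMem fun x hx => lt_irrefl ‖x‖ (Set.mem_iInter.1 hx ‖x‖)
  rw [hempty, measure_empty] at hlim
  have h := (ENNReal.continuous_rpow_const (y := 1 / r)).tendsto 0 |>.comp hlim
  rw [ENNReal.zero_rpow_of_pos (by positivity)] at h
  refine h.congr fun R => ?_
  rw [eLpNorm_eq_lintegral_rpow_enorm_toReal hr0 ENNReal.ofReal_ne_top, ENNReal.toReal_ofReal hr.le]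
  simp only [Function.comp_apply]
  rw [withDensity_apply _ (hms R)]

theorem tendsto_measure_norm_gt {F : Type*} [NormedAddCommGroup F] {G : Plane → F}
    {r : ℝ} (hr : 0 < r) (hG : MemLp G (ENNReal.ofReal r) volume) {ε : ℝ} (hε : 0 < ε) :
    Tendsto (fun R : ℝ => volume {x : Plane | R < ‖x‖ ∧ ε < ‖G x‖}) atTop (𝓝 0) := by
  have hr0 : ENNReal.ofReal r ≠ 0 := by simpa using hr
  have hms : ∀ R : ℝ, MeasurableSet {x : Plane | R < ‖x‖} := fun R =>
    measurableSet_lt measurable_const measurable_norm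
  have h1 := (ENNReal.continuous_rpow_const (y := r)).tendsto 0 |>.comp
    (tendsto_eLpNorm_restrict_norm_gt hr hG)
  rw [ENNReal.zero_rpow_of_pos hr] at h1
  have h2 := ENNReal.Tendsto.const_mul (a := (ENNReal.ofReal ε)⁻¹ ^ r) h1 (Or.inr (by
    have : ENNReal.ofReal ε ≠ 0 := by simpa using hε
    finiteness))
  rw [mul_zero] at h2
  refine tendsto_of_tendsto_of_tendsto_of_le_of_le tendsto_const_nhds h2 (fun R => zero_le)
    fun R => ?_
  have h3 := meas_ge_le_mul_pow_eLpNorm_enorm (volume.restrict {x : Plane | R < ‖x‖}) hr0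
    ENNReal.ofReal_ne_top hG.1.restrict (ε := ENNReal.ofReal ε) (by simpa using hε)
    (fun h => absurd h ENNReal.ofReal_ne_top)
  rw [ENNReal.toReal_ofReal hr.le, Measure.restrict_apply' (hms R)] at h3
  refine le_trans (measure_mono ?_) h3
  rintro x ⟨hx1, hx2⟩
  refine ⟨?_, hx1⟩
  change ENNReal.ofReal ε ≤ ‖G x‖ₑ
  rw [← ofReal_norm]
  exact ENNReal.ofReal_le_ofReal hx2.le

/-! ### Growth of the potential of an integrable function -/

/-- In contrast to `log_norm_div_le`, the growing part is `log (1 + d)` with coefficient one. -/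
theorem log_norm_div_le_log_add {q : ℝ} (hq : 1 ≤ q) {v w : Plane} {d : ℝ} (hw : 0 < ‖w‖)
    (hvw : ‖w‖ ≤ ‖v‖) (hd : ‖v‖ ≤ ‖w‖ + d) :
    Real.log (‖v‖ / ‖w‖) ≤ Real.log (1 + d) + q * logMajorant q w := by
  have hq0 : 0 < q := by linarith
  have hd0 : 0 ≤ d := by linarith
  have hv : 0 < ‖v‖ := by linarith
  by_cases h : ‖w‖ < 1
  · have h1 : Real.log ‖w‖⁻¹ ≤ (‖w‖⁻¹) ^ (1 / q) / (1 / q) :=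
      Real.log_le_rpow_div (by positivity) (by positivity)
    rw [Real.log_inv, Real.inv_rpow hw.le, ← Real.rpow_neg hw.le, div_div_eq_mul_div, div_one,
      mul_comm] at h1
    rw [Real.log_div hv.ne' hw.ne', logMajorant, if_pos h]
    have h2 : Real.log ‖v‖ ≤ Real.log (1 + d) := Real.log_le_log hv (by linarith)
    linarith
  · push Not at h
    have h1 : Real.log (‖v‖ / ‖w‖) ≤ Real.log (1 + d) := by
      refine Real.log_le_log (by positivity) ?_
      rw [div_le_iff₀ hw]
      nlinarith
    have := mul_nonneg hq0.le (logMajorant_nonneg q w)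
    linarith

/-- The coefficient one of `log (1 + |x|)` gives the sharp constant in the growth of the potential:
the other terms lie in `L^q` with norms independent of `x`. -/
theorem abs_log_norm_sub_div_le_log_add {q : ℝ} (hq : 1 ≤ q) (x y : Plane) :
    |Real.log (‖x - y‖ / ‖y‖)| ≤
      Real.log (1 + ‖x‖) + q * (logMajorant q (x - y) + logMajorant q y) := by
  have hc : 0 ≤ Real.log (1 + ‖x‖) := Real.log_nonneg (by linarith [norm_nonneg x])
  have n1 := mul_nonneg (show 0 ≤ q by linarith) (logMajorant_nonneg q (x - y))
  have n2 := mul_nonneg (show 0 ≤ q by linarith) (logMajorant_nonneg q y)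
  rw [mul_add]
  rcases (norm_nonneg y).eq_or_lt with h | hy
  · simp only [← h, div_zero, Real.log_zero, abs_zero]
    linarith
  rcases (norm_nonneg (x - y)).eq_or_lt with h | hxy
  · simp only [← h, zero_div, Real.log_zero, abs_zero]
    linarith
  rcases le_total ‖y‖ ‖x - y‖ with h | h
  · have h1 := log_norm_div_le_log_add hq hy h (d := ‖x‖)
      (by have := norm_sub_le x y; linarith)
    rw [abs_of_nonneg (Real.log_nonneg (by rwa [le_div_iff₀ hy, one_mul]))]
    linarith
  · have h1 := log_norm_div_le_log_add hq hxy h (d := ‖x‖)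
      (by have := norm_sub_norm_le y (y - x); rw [norm_sub_rev y x] at this; simp at this; linarith)
    rw [← inv_div, Real.log_inv, abs_neg,
      abs_of_nonneg (Real.log_nonneg (by rwa [le_div_iff₀ hxy, one_mul]))]
    linarith

theorem log_one_add_norm_le (x : Plane) :
    Real.log (1 + ‖x‖) ≤ Real.log (bracket x) + Real.log 2 := by
  have hb : 0 < bracket x := Real.sqrt_pos.2 (by positivity)
  rw [← Real.log_mul hb.ne' two_ne_zero]
  refine Real.log_le_log (by positivity) ?_
  have h1 : 1 ≤ bracket x := Real.le_sqrt_of_sq_le (by nlinarith [sq_nonneg ‖x‖])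
  have h2 : ‖x‖ ≤ bracket x := Real.le_sqrt_of_sq_le (by linarith)
  linarith

theorem tendsto_log_bracket :
    Tendsto (fun x => Real.log (bracket x)) (Bornology.cobounded Plane) atTop := by
  refine Real.tendsto_log_atTop.comp
    (tendsto_atTop_mono (fun x => ?_) tendsto_norm_cobounded_atTop)
  exact Real.le_sqrt_of_sq_le (by linarith)

theorem limsup_potential_div_log_le {p q : ℝ} (hpq : q.HolderConjugate p) (hp2 : p < 2)
    {f : Plane → 𝕜} (hf : MemLp f (ENNReal.ofReal p) volume) (hf1 : MemLp f 1 volume) :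
    limsup (fun x => ENNReal.ofReal (‖potential f x‖ / Real.log (bracket x)))
      (Bornology.cobounded Plane) ≤ eLpNorm f 1 volume / ENNReal.ofReal (2 * π) := by
  have hq := two_lt_of_holderConjugate hpq hp2
  have hq0 := hpq.pos
  have hfi := memLp_one_iff_integrable.1 hf1
  set A : ℝ := ∫ y, ‖f y‖ with hA
  have hA0 : 0 ≤ A := integral_nonneg fun _ => norm_nonneg _
  have hN := memLp_logMajorant hq
  set D : ℝ≥0∞ := 2 * eLpNorm (logMajorant q) (ENNReal.ofReal q) volume *
    eLpNorm f (ENNReal.ofReal p) volume with hD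
  have hDt : D ≠ ⊤ := (ENNReal.mul_lt_top
    (ENNReal.mul_lt_top (by simp) hN.eLpNorm_lt_top) hf.eLpNorm_lt_top).ne
  set B : ℝ := q * D.toReal with hB
  have hbound : ∀ x, ‖potential f x‖ ≤ (Real.log (1 + ‖x‖) * A + B) / (2 * π) := by
    intro x
    have hl : 0 ≤ Real.log (1 + ‖x‖) := Real.log_nonneg (by linarith [norm_nonneg x])
    have hmaj : ∫⁻ y, ‖potentialIntegrand f x y‖ₑ ≤
        ENNReal.ofReal (Real.log (1 + ‖x‖) * A + B) := by
      have hN2 : ∀ v : Plane, 0 ≤ logMajorant q v := logMajorant_nonneg q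
      have hm1 : AEMeasurable (fun y => ‖f y‖ₑ) volume := hf.1.enorm
      set M : Plane → ℝ := (fun y => logMajorant q (x - y)) + logMajorant q with hM
      have hMm : AEStronglyMeasurable M volume :=
        (aestronglyMeasurable_comp_sub_left hN.1 x).add hN.1
      calc ∫⁻ y, ‖potentialIntegrand f x y‖ₑ
          ≤ ∫⁻ y, (ENNReal.ofReal (Real.log (1 + ‖x‖)) * ‖f y‖ₑ +
              ENNReal.ofReal q * (‖M y‖ₑ * ‖f y‖ₑ)) := by
            refine lintegral_mono fun y => ?_
            simp only [potentialIntegrand]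
            have hMy : 0 ≤ M y := add_nonneg (hN2 _) (hN2 _)
            rw [enorm_smul, ← mul_assoc, ← add_mul, Real.enorm_eq_ofReal hMy,
              ← ENNReal.ofReal_mul hq0.le, ← ENNReal.ofReal_add hl (by positivity), ← ofReal_norm]
            gcongr
            exact abs_log_norm_sub_div_le_log_add (by linarith) x y
        _ = ENNReal.ofReal (Real.log (1 + ‖x‖)) * (∫⁻ y, ‖f y‖ₑ) +
              ENNReal.ofReal q * ∫⁻ y, ‖M y‖ₑ * ‖f y‖ₑ := by
            rw [lintegral_add_left' (hm1.const_mul _), lintegral_const_mul'' _ hm1,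
              lintegral_const_mul' _ _ ENNReal.ofReal_ne_top]
        _ ≤ ENNReal.ofReal (Real.log (1 + ‖x‖)) * ENNReal.ofReal A + ENNReal.ofReal q * D := by
            gcongr
            · rw [hA, ofReal_integral_norm_eq_lintegral_enorm hfi]
            · refine (lintegral_enorm_mul_le hpq hMm hf.1).trans ?_
              rw [hD]
              gcongr
              refine (eLpNorm_add_le (aestronglyMeasurable_comp_sub_left hN.1 x) hN.1
                (by rw [ENNReal.one_le_ofReal]; linarith)).trans_eq ?_
              rw [eLpNorm_comp_sub_left hN.1, two_mul]
        _ = _ := by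
            rw [ENNReal.ofReal_add (by positivity) (by positivity), ENNReal.ofReal_mul hl, hB,
              ENNReal.ofReal_mul hq0.le, ENNReal.ofReal_toReal hDt]
    have h2 : ‖∫ y, potentialIntegrand f x y‖ ≤ Real.log (1 + ‖x‖) * A + B := by
      rw [← ENNReal.ofReal_le_ofReal_iff (by positivity), ofReal_norm]
      exact (enorm_integral_le_lintegral_enorm _).trans hmaj
    rw [potential, norm_smul, norm_neg, Real.norm_of_nonneg (by positivity), one_div,
      ← div_eq_inv_mul]
    gcongr
  have hlim : Tendsto (fun x => ENNReal.ofReal (A / (2 * π) +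
      ((Real.log 2 * A + B) / (2 * π)) / Real.log (bracket x)))
      (Bornology.cobounded Plane) (𝓝 (ENNReal.ofReal (A / (2 * π) + 0))) :=
    ENNReal.tendsto_ofReal ((tendsto_const_nhds.div_atTop tendsto_log_bracket).const_add _)
  have hval : ENNReal.ofReal (A / (2 * π) + 0) = eLpNorm f 1 volume / ENNReal.ofReal (2 * π) := by
    rw [add_zero, ENNReal.ofReal_div_of_pos (by positivity), hA,
      ofReal_integral_norm_eq_lintegral_enorm hfi, eLpNorm_one_eq_lintegral_enorm]
  rw [← hval, ← hlim.limsup_eq]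
  refine limsup_le_limsup ?_
  filter_upwards [tendsto_log_bracket.eventually_gt_atTop 0] with x hx
  apply ENNReal.ofReal_le_ofReal
  rw [div_le_iff₀ hx, add_mul, div_mul_cancel₀ _ hx.ne']
  refine (hbound x).trans ?_
  rw [div_mul_eq_mul_div, ← add_div]
  refine div_le_div_of_nonneg_right ?_ (by positivity)
  have h1 := mul_le_mul_of_nonneg_right (log_one_add_norm_le x) hA0
  rw [add_mul, mul_comm _ A] at h1
  linarith

/-! ### Smooth approximation together with the weak gradient -/

theorem kconv_congr_ae (k : Plane → ℝ) {f g : Plane → 𝕜} (h : f =ᵐ[volume] g) (x : Plane) :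
    kconv k f x = kconv k g x := by
  have h1 := (Measure.measurePreserving_sub_left (volume : Measure Plane)
    x).quasiMeasurePreserving.ae_eq_comp h
  refine integral_congr_ae (h1.mono fun y hy => ?_)
  have : f (x - y) = g (x - y) := hy
  simp only [this]

theorem eLpNorm_kconv_le {p : ℝ} (hp : 1 < p) {k : Plane → ℝ} (hk : Measurable k)
    {f : Plane → 𝕜} (hf : AEStronglyMeasurable f volume) :
    eLpNorm (kconv k f) (ENNReal.ofReal p) volume ≤
      (∫⁻ y, ‖k y‖ₑ) * eLpNorm f (ENNReal.ofReal p) volume := by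
  have hp0 : 0 < p := by linarith
  have hae := hf.ae_eq_mk
  have hfm : Measurable (hf.mk f) := hf.stronglyMeasurable_mk.measurable
  have e : kconv k f = kconv k (hf.mk f) := funext fun x => kconv_congr_ae k hae x
  rw [e, eLpNorm_congr_ae hae, eLpNorm_eq_lintegral_rpow_enorm_toReal (by simpa using hp0)
    ENNReal.ofReal_ne_top, eLpNorm_eq_lintegral_rpow_enorm_toReal (by simpa using hp0)
    ENNReal.ofReal_ne_top, ENNReal.toReal_ofReal hp0.le]
  calc _ ≤ (∫⁻ x, (∫⁻ y, ‖k y‖ₑ * ‖hf.mk f (x - y)‖ₑ) ^ p) ^ (1 / p) := by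
        gcongr with x
        refine (enorm_integral_le_lintegral_enorm _).trans_eq ?_
        simp only [enorm_smul]
    _ ≤ ((∫⁻ y, ‖k y‖ₑ) ^ p * ∫⁻ x, ‖hf.mk f x‖ₑ ^ p) ^ (1 / p) := by
        gcongr
        exact lintegral_conv_rpow_le hp (k := fun y => ‖k y‖ₑ) (F := fun y => ‖hf.mk f y‖ₑ)
          hk.enorm hfm.enorm
    _ = _ := by
        rw [ENNReal.mul_rpow_of_nonneg _ _ (by positivity), ← ENNReal.rpow_mul,
          mul_one_div_cancel hp0.ne', ENNReal.rpow_one]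

theorem enorm_kconv_le {p q : ℝ} (hpq : q.HolderConjugate p) {k : Plane → ℝ}
    (hk : AEStronglyMeasurable k volume) {f : Plane → 𝕜} (hf : AEStronglyMeasurable f volume)
    (x : Plane) : ‖kconv k f x‖ₑ ≤
      eLpNorm k (ENNReal.ofReal q) volume * eLpNorm f (ENNReal.ofReal p) volume := by
  refine (enorm_integral_le_lintegral_enorm _).trans ?_
  simp only [enorm_smul]
  refine (lintegral_enorm_mul_le hpq hk (aestronglyMeasurable_comp_sub_left hf x)).trans_eq ?_
  rw [eLpNorm_comp_sub_left hf]

/-- A standard mollifier supported in the ball of radius `1 / (n + 1)`. -/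
def mollifierBump (n : ℕ) : ContDiffBump (0 : Plane) where
  rIn := 1 / ((n : ℝ) + 1) / 2
  rOut := 1 / ((n : ℝ) + 1)
  rIn_pos := by positivity
  rIn_lt_rOut := half_lt_self (by positivity)

/-- The mollifier of unit mass associated with `mollifierBump n`. -/
def mollifier (n : ℕ) : Plane → ℝ := (mollifierBump n).normed volume

theorem contDiff_mollifier (n : ℕ) : ContDiff ℝ ∞ (mollifier n) :=
  (mollifierBump n).contDiff_normed

theorem hasCompactSupport_mollifier (n : ℕ) : HasCompactSupport (mollifier n) :=
  (mollifierBump n).hasCompactSupport_normed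

theorem lintegral_mollifier (n : ℕ) : ∫⁻ y, ‖mollifier n y‖ₑ = 1 := by
  have h1 : ∫ y, mollifier n y = 1 := (mollifierBump n).integral_normed
  have hi : Integrable (mollifier n) :=
    (contDiff_mollifier n).continuous.integrable_of_hasCompactSupport
      (hasCompactSupport_mollifier n)
  have h0 : ∀ y, 0 ≤ mollifier n y := (mollifierBump n).nonneg_normed
  rw [← ofReal_integral_norm_eq_lintegral_enorm hi]
  simp only [Real.norm_of_nonneg (h0 _)]
  rw [h1, ENNReal.ofReal_one]

theorem integrable_mollifier_smul (n : ℕ) {f : Plane → 𝕜} (hf : LocallyIntegrable f volume)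
    (x : Plane) : Integrable fun w => mollifier n w • f (x - w) :=
  (hasCompactSupport_mollifier n).convolutionExists_left (ContinuousLinearMap.lsmul ℝ ℝ)
    (contDiff_mollifier n).continuous hf x

theorem contDiff_kconv_mollifier (n : ℕ) {f : Plane → 𝕜} (hf : LocallyIntegrable f volume) :
    ContDiff ℝ ∞ (kconv (mollifier n) f) :=
  (hasCompactSupport_mollifier n).contDiff_convolution_left (n := (⊤ : ℕ∞))
    (ContinuousLinearMap.lsmul ℝ ℝ) (contDiff_mollifier n) hf

theorem norm_basisVec (i : Fin 2) : ‖basisVec i‖ = 1 := by simp [basisVec]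

theorem norm_partialDeriv_le (u : Plane → 𝕜) (i : Fin 2) (x : Plane) :
    ‖partialDeriv i u x‖ ≤ ‖fderiv ℝ u x‖ := by
  have := (fderiv ℝ u x).le_opNorm (basisVec i)
  rwa [norm_basisVec, mul_one] at this

/-- Mollification commutes with the weak gradient. -/
theorem partialDeriv_kconv_mollifier (n : ℕ) {f : Plane → 𝕜}
    {g : Plane → EuclideanSpace 𝕜 (Fin 2)} (hfg : HasWeakGradient f g) (i : Fin 2) :
    partialDeriv i (kconv (mollifier n) f) = kconv (mollifier n) fun y => g y i := by
  funext x
  have hρ1 : ContDiff ℝ 1 (mollifier n) := (contDiff_mollifier n).of_le (by simp)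
  have hρs := hasCompactSupport_mollifier n
  have h := hρs.hasFDerivAt_convolution_left (ContinuousLinearMap.lsmul ℝ ℝ : ℝ →L[ℝ] 𝕜 →L[ℝ] 𝕜)
    hρ1 hfg.1 x
  have hex := (hρs.fderiv (𝕜 := ℝ)).convolutionExists_left
    ((ContinuousLinearMap.lsmul ℝ ℝ : ℝ →L[ℝ] 𝕜 →L[ℝ] 𝕜).precompL Plane)
    (hρ1.continuous_fderiv one_ne_zero) hfg.1 x
  have h1 : partialDeriv i (kconv (mollifier n) f) x =
      ∫ t, partialDeriv i (mollifier n) t • f (x - t) := by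
    rw [partialDeriv, kconv_eq_convolution, h.fderiv, convolution,
      ContinuousLinearMap.integral_apply hex]
    rfl
  have hφ : ContDiff ℝ ∞ fun y => mollifier n (x - y) :=
    (contDiff_mollifier n).comp (contDiff_const.sub contDiff_id)
  have hφs : HasCompactSupport fun y => mollifier n (x - y) :=
    hρs.comp_homeomorph (Homeomorph.subLeft x)
  have h2 := hfg.2.2 i _ hφ hφs
  have h3 : ∀ y, partialDeriv i (fun y => mollifier n (x - y)) y =
      - partialDeriv i (mollifier n) (x - y) := fun y => by
    rw [partialDeriv, fderiv_comp_sub_left (hρ1.differentiable one_ne_zero)]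
    rfl
  simp only [h3, neg_smul, integral_neg, neg_inj] at h2
  have e1 := integral_sub_left_eq_self
    (fun t => partialDeriv i (mollifier n) t • f (x - t)) volume x
  have e2 := integral_sub_left_eq_self (fun t => mollifier n t • g (x - t) i) volume x
  simp only [sub_sub_cancel] at e1 e2
  rw [h1, kconv, ← e1, ← e2, h2]

theorem tendsto_eLpNorm_kconv_mollifier_sub_of_contDiff {p : ℝ} (hp : 0 < p) {h : Plane → 𝕜}
    (hh : ContDiff ℝ 1 h) (hs : HasCompactSupport h) :
    Tendsto (fun n => eLpNorm (kconv (mollifier n) h - h) (ENNReal.ofReal p) volume) atTop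
      (𝓝 0) := by
  obtain ⟨L, hL⟩ := hh.lipschitzWith_of_hasCompactSupport hs one_ne_zero
  obtain ⟨R, hR⟩ : ∃ R : ℝ, ∀ x, R ≤ ‖x‖ → h x = 0 := by
    obtain ⟨R, hR⟩ := hs.isCompact.isBounded.subset_ball 0
    refine ⟨R, fun x hx => ?_⟩
    by_contra h0
    have := hR (subset_tsupport h h0)
    rw [Metric.mem_ball, dist_zero_right] at this
    linarith
  set B := Metric.closedBall (0 : Plane) (R + 1)
  have hr : ∀ n, (mollifierBump n).rOut = 1 / ((n : ℝ) + 1) := fun n => rfl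
  have hr0 : ∀ n : ℕ, 0 < 1 / ((n : ℝ) + 1) := fun n => by positivity
  have hbound : ∀ n x, ‖(kconv (mollifier n) h - h) x‖ ≤
      B.indicator (fun _ => (L : ℝ) * (1 / ((n : ℝ) + 1))) x := by
    intro n x
    rw [Pi.sub_apply, ← dist_eq_norm, kconv_eq_convolution]
    refine ContDiffBump.dist_normed_convolution_le hh.continuous.aestronglyMeasurable
      fun y hy => ?_
    rw [hr, Metric.mem_ball] at hy
    by_cases hx : x ∈ B
    · rw [Set.indicator_of_mem hx]
      exact (hL.dist_le_mul y x).trans (by gcongr)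
    · rw [Set.indicator_of_notMem hx]
      have hx' : R + 1 < ‖x‖ := by simpa [B] using hx
      have hn1 : 1 / ((n : ℝ) + 1) ≤ 1 := by
        rw [div_le_one (by positivity)]; linarith [(Nat.cast_nonneg n : (0 : ℝ) ≤ n)]
      have hy' : R ≤ ‖y‖ := by
        have := norm_sub_norm_le x y
        rw [dist_comm, dist_eq_norm] at hy
        linarith
      rw [hR y hy', hR x (by linarith), dist_self]
  have hlim : Tendsto (fun n : ℕ => ENNReal.ofReal ((L : ℝ) * (1 / ((n : ℝ) + 1))) *
      volume B ^ (1 / p)) atTop (𝓝 (ENNReal.ofReal ((L : ℝ) * 0) * volume B ^ (1 / p))) := by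
    refine ENNReal.Tendsto.mul_const (ENNReal.tendsto_ofReal (tendsto_one_div_nat.const_mul _))
      (Or.inr ?_)
    have : volume B ≠ ⊤ := measure_closedBall_lt_top.ne
    finiteness
  rw [mul_zero, ENNReal.ofReal_zero, zero_mul] at hlim
  refine tendsto_of_tendsto_of_tendsto_of_le_of_le tendsto_const_nhds hlim (fun _ => zero_le)
    fun n => (eLpNorm_mono_real (hbound n)).trans_eq ?_
  rw [eLpNorm_indicator_const Metric.isClosed_closedBall.measurableSet (by simpa using hp)
    ENNReal.ofReal_ne_top, ENNReal.toReal_ofReal hp.le, Real.enorm_eq_ofReal (by positivity)]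

theorem tendsto_eLpNorm_kconv_mollifier_sub {p : ℝ} (hp : 1 < p) {f : Plane → 𝕜}
    (hf : MemLp f (ENNReal.ofReal p) volume) :
    Tendsto (fun n => eLpNorm (kconv (mollifier n) f - f) (ENNReal.ofReal p) volume) atTop
      (𝓝 0) := by
  have hp1 : 1 ≤ ENNReal.ofReal p := by simpa using hp.le
  rw [ENNReal.tendsto_atTop_zero]
  intro ε hε
  obtain ⟨δ, hδ0, hδε⟩ : ∃ δ : ℝ, 0 < δ ∧ 3 * ENNReal.ofReal δ ≤ ε := by
    rcases eq_or_ne ε ⊤ with rfl | ht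
    · exact ⟨1, one_pos, le_top⟩
    · have h0 : 0 < ε.toReal := ENNReal.toReal_pos hε.ne' ht
      refine ⟨ε.toReal / 3, by positivity, ?_⟩
      rw [ENNReal.ofReal_div_of_pos (by norm_num), ENNReal.ofReal_toReal ht]
      rw [show ENNReal.ofReal 3 = 3 by norm_num, ENNReal.mul_div_cancel (by norm_num)
        (by norm_num)]
  obtain ⟨h, hs, hh, hfh⟩ := hf.exist_eLpNorm_sub_le ENNReal.ofReal_ne_top hp1 hδ0
  have hhL : MemLp h (ENNReal.ofReal p) volume :=
    hh.continuous.memLp_of_hasCompactSupport hs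
  have hlim := tendsto_eLpNorm_kconv_mollifier_sub_of_contDiff (p := p) (by linarith)
    (hh.of_le (by simp)) hs
  rw [ENNReal.tendsto_atTop_zero] at hlim
  obtain ⟨N, hN⟩ := hlim (ENNReal.ofReal δ) (by simpa using hδ0)
  refine ⟨N, fun n hn => le_trans ?_ hδε⟩
  have hlf := hf.locallyIntegrable hp1
  have hlh := hhL.locallyIntegrable hp1
  have e : kconv (mollifier n) f - f =
      kconv (mollifier n) (f - h) + (kconv (mollifier n) h - h) + (h - f) := by
    funext x
    have : kconv (mollifier n) (f - h) x = kconv (mollifier n) f x - kconv (mollifier n) h x := by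
      simp only [kconv]
      rw [← integral_sub (integrable_mollifier_smul n hlf x) (integrable_mollifier_smul n hlh x)]
      simp only [Pi.sub_apply, smul_sub]
    simp only [Pi.add_apply, Pi.sub_apply, this]
    ring
  have m1 : AEStronglyMeasurable (kconv (mollifier n) (f - h)) volume :=
    (contDiff_kconv_mollifier n (hlf.sub hlh)).continuous.aestronglyMeasurable
  have m2 : AEStronglyMeasurable (kconv (mollifier n) h - h) volume :=
    ((contDiff_kconv_mollifier n hlh).continuous.sub hh.continuous).aestronglyMeasurable
  rw [e]
  calc _ ≤ eLpNorm (kconv (mollifier n) (f - h)) (ENNReal.ofReal p) volume +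
        eLpNorm (kconv (mollifier n) h - h) (ENNReal.ofReal p) volume +
        eLpNorm (h - f) (ENNReal.ofReal p) volume :=
        (eLpNorm_add_le (m1.add m2) (hhL.1.sub hf.1) hp1).trans
          (by gcongr; exact eLpNorm_add_le m1 m2 hp1)
    _ ≤ ENNReal.ofReal δ + ENNReal.ofReal δ + ENNReal.ofReal δ := by
        gcongr
        · refine (eLpNorm_kconv_le hp (contDiff_mollifier n).continuous.measurable
            (hf.1.sub hhL.1)).trans ?_
          rw [lintegral_mollifier, one_mul]
          exact hfh
        · exact hN n hn
        · rw [eLpNorm_sub_comm]; exact hfh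
    _ = _ := by ring

/-- Truncation by cutoff functions: the gradient of the cutoff at scale `R` costs `(M / R) ‖u‖_q`.
-/
theorem exists_hasCompactSupport_approx {p q : ℝ} (hp : 0 < p) (hq : 1 ≤ q) {u : Plane → 𝕜}
    (hu : ContDiff ℝ ∞ u) (hup : MemLp u (ENNReal.ofReal p) volume)
    (huq : MemLp u (ENNReal.ofReal q) volume)
    (hdu : ∀ i, MemLp (partialDeriv i u) (ENNReal.ofReal q) volume) {ε : ℝ≥0∞} (hε : 0 < ε) :
    ∃ h : Plane → 𝕜, ContDiff ℝ ∞ h ∧ HasCompactSupport h ∧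
      eLpNorm (h - u) (ENNReal.ofReal p) volume ≤ ε ∧
      ∀ i, eLpNorm (partialDeriv i h - partialDeriv i u) (ENNReal.ofReal q) volume ≤ ε := by
  have hq0 : 0 < q := by linarith
  have hq1 : 1 ≤ ENNReal.ofReal q := by simpa using hq
  obtain ⟨M, hM0, hM⟩ := exists_cutoff
  have hms : ∀ R : ℝ, MeasurableSet {x : Plane | R < ‖x‖} := fun R =>
    measurableSet_lt measurable_const measurable_norm
  have t1 := tendsto_eLpNorm_restrict_norm_gt hp hup
  have t2 : ∀ i, Tendsto (fun R : ℝ => eLpNorm (partialDeriv i u) (ENNReal.ofReal q)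
      (volume.restrict {x : Plane | R < ‖x‖}) +
      ENNReal.ofReal (M / R) * eLpNorm u (ENNReal.ofReal q) volume) atTop (𝓝 0) := fun i => by
    have h1 := tendsto_eLpNorm_restrict_norm_gt hq0 (hdu i)
    have h2 : Tendsto (fun R : ℝ => ENNReal.ofReal (M / R) * eLpNorm u (ENNReal.ofReal q) volume)
        atTop (𝓝 (ENNReal.ofReal 0 * eLpNorm u (ENNReal.ofReal q) volume)) :=
      ENNReal.Tendsto.mul_const (ENNReal.tendsto_ofReal
        (tendsto_const_nhds.div_atTop tendsto_id)) (Or.inr huq.eLpNorm_ne_top)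
    simpa using h1.add h2
  obtain ⟨R, hR1, hR2, hR0⟩ := ((t1.eventually (Iic_mem_nhds hε)).and
    ((eventually_all.2 fun i => (t2 i).eventually (Iic_mem_nhds hε)).and
      (eventually_gt_atTop 0))).exists
  obtain ⟨χ, hχs, hχc, hχb, hχ1, hχd, hχd0, -⟩ := hM R hR0
  have hud := hu.differentiable (by simp)
  have hχu : ∀ x, ‖χ x - 1‖ ≤ 1 := fun x => by
    rw [Real.norm_eq_abs, abs_le]; constructor <;> linarith [(hχb x).1, (hχb x).2]
  refine ⟨fun x => χ x • u x, hχs.smul hu, hχc.smul_right, le_trans ?_ hR1, fun i =>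
    le_trans ?_ (hR2 i)⟩
  · rw [← eLpNorm_indicator_eq_eLpNorm_restrict (hms R)]
    refine eLpNorm_mono fun x => ?_
    by_cases hx : R < ‖x‖
    · rw [Set.indicator_of_mem (show x ∈ {x : Plane | R < ‖x‖} from hx)]
      have : ((fun x => χ x • u x) - u) x = (χ x - 1) • u x := by
        simp [sub_smul]
      rw [this, norm_smul]
      exact mul_le_of_le_one_left (norm_nonneg _) (hχu x)
    · simp [hχ1 x (not_lt.1 hx)]
  · have hder : ∀ x, partialDeriv i (fun x => χ x • u x) x - partialDeriv i u x =
        (χ x - 1) • partialDeriv i u x + partialDeriv i χ x • u x := fun x => by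
      rw [partialDeriv, fderiv_fun_smul (hχs.differentiable (by simp) x) (hud x)]
      simp only [add_apply, _root_.smul_apply, ContinuousLinearMap.smulRight_apply, partialDeriv,
        sub_smul, one_smul]
      abel
    have hpt : ∀ x, ‖(partialDeriv i (fun x => χ x • u x) - partialDeriv i u) x‖ ≤
        ‖{x : Plane | R < ‖x‖}.indicator (partialDeriv i u) x‖ + ‖(M / R) • u x‖ := fun x => by
      rw [Pi.sub_apply, hder]
      refine (norm_add_le _ _).trans (add_le_add ?_ ?_)
      · by_cases hx : R < ‖x‖
        · rw [Set.indicator_of_mem (show x ∈ {x : Plane | R < ‖x‖} from hx), norm_smul]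
          exact mul_le_of_le_one_left (norm_nonneg _) (hχu x)
        · simp [hχ1 x (not_lt.1 hx)]
      · rw [norm_smul, norm_smul, Real.norm_of_nonneg (by positivity : 0 ≤ M / R)]
        gcongr
        exact (norm_partialDeriv_le χ i x).trans (hχd x)
    refine (eLpNorm_mono_real hpt).trans ((eLpNorm_add_le
      (((hdu i).1.indicator (hms R)).norm) ((huq.1.const_smul _).norm) hq1).trans_eq ?_)
    rw [eLpNorm_norm, eLpNorm_norm, eLpNorm_indicator_eq_eLpNorm_restrict (hms R)]
    congr 1
    have := eLpNorm_const_smul (M / R) u (ENNReal.ofReal q) volume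
    rw [Real.enorm_eq_ofReal (by positivity)] at this
    exact this

/-- An `L^p` function with weak gradient in `L^q` is approximated in these norms by smooth
functions of compact support: mollify, then truncate. The mollified function is bounded, hence in
`L^q`, which makes the gradient of the cutoff function harmless. -/
theorem exists_contDiff_approx_gradient {p q : ℝ} (hp : 1 < p) (hpq : p ≤ q) {f : Plane → 𝕜}
    (hf : MemLp f (ENNReal.ofReal p) volume) {g : Plane → EuclideanSpace 𝕜 (Fin 2)}
    (hfg : HasWeakGradient f g) (hg : MemLp g (ENNReal.ofReal q) volume) {ε : ℝ≥0∞}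
    (hε : 0 < ε) :
    ∃ h : Plane → 𝕜, ContDiff ℝ ∞ h ∧ HasCompactSupport h ∧
      eLpNorm (h - f) (ENNReal.ofReal p) volume ≤ ε ∧
      ∀ i, eLpNorm (partialDeriv i h - fun x => g x i) (ENNReal.ofReal q) volume ≤ ε := by
  have hp1 : 1 ≤ ENNReal.ofReal p := by simpa using hp.le
  have hq1 : 1 ≤ ENNReal.ofReal q := by simpa using hp.le.trans hpq
  have hε2 : 0 < ε / 2 := ENNReal.half_pos hε.ne'
  have hgi : ∀ i, MemLp (fun x => g x i) (ENNReal.ofReal q) volume := hg.eval_piLp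
  have hlf := hf.locallyIntegrable hp1
  obtain ⟨n, hn1, hn2⟩ := (((tendsto_eLpNorm_kconv_mollifier_sub hp hf).eventually
    (Iic_mem_nhds hε2)).and (eventually_all.2 fun i =>
      (tendsto_eLpNorm_kconv_mollifier_sub (by linarith) (hgi i)).eventually
        (Iic_mem_nhds hε2))).exists
  set u := kconv (mollifier n) f with hu
  have hus : ContDiff ℝ ∞ u := contDiff_kconv_mollifier n hlf
  have hρm := (contDiff_mollifier n).continuous.measurable
  have hup : MemLp u (ENNReal.ofReal p) volume :=
    ⟨hus.continuous.aestronglyMeasurable, (eLpNorm_kconv_le hp hρm hf.1).trans_lt (by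
      rw [lintegral_mollifier, one_mul]; exact hf.2)⟩
  have hhc := (Real.HolderConjugate.conjExponent hp).symm
  have hρL : MemLp (mollifier n) (ENNReal.ofReal p.conjExponent) volume :=
    (contDiff_mollifier n).continuous.memLp_of_hasCompactSupport (hasCompactSupport_mollifier n)
  set K := eLpNorm (mollifier n) (ENNReal.ofReal p.conjExponent) volume *
    eLpNorm f (ENNReal.ofReal p) volume with hK
  have hKt : K ≠ ⊤ := ENNReal.mul_ne_top hρL.eLpNorm_ne_top hf.eLpNorm_ne_top
  have huq : MemLp u (ENNReal.ofReal q) volume := by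
    refine memLp_of_le_exponent_of_bounded (by simpa using (by linarith : 0 < p))
      (ENNReal.ofReal_le_ofReal hpq) hup (C := K.toReal) fun x => ?_
    rw [← ENNReal.ofReal_le_ofReal_iff ENNReal.toReal_nonneg, ofReal_norm,
      ENNReal.ofReal_toReal hKt]
    exact enorm_kconv_le hhc hρL.1 hf.1 x
  have hdu : ∀ i, partialDeriv i u = kconv (mollifier n) fun y => g y i :=
    partialDeriv_kconv_mollifier n hfg
  have hduq : ∀ i, MemLp (partialDeriv i u) (ENNReal.ofReal q) volume := fun i =>
    ⟨(contDiff_partialDeriv hus i).continuous.aestronglyMeasurable, by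
      rw [hdu]
      refine (eLpNorm_kconv_le (by linarith) hρm (hgi i).1).trans_lt ?_
      rw [lintegral_mollifier, one_mul]; exact (hgi i).2⟩
  obtain ⟨h, hhs, hhc, hh1, hh2⟩ := exists_hasCompactSupport_approx (p := p) (q := q)
    (by linarith) (by linarith) hus hup huq hduq hε2
  have hhm : AEStronglyMeasurable h volume := hhs.continuous.aestronglyMeasurable
  have hhdm : ∀ i, AEStronglyMeasurable (partialDeriv i h) volume := fun i =>
    (contDiff_partialDeriv hhs i).continuous.aestronglyMeasurable
  refine ⟨h, hhs, hhc, ?_, fun i => ?_⟩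
  · calc eLpNorm (h - f) (ENNReal.ofReal p) volume
        = eLpNorm ((h - u) + (u - f)) (ENNReal.ofReal p) volume := by rw [sub_add_sub_cancel]
      _ ≤ ε / 2 + ε / 2 := (eLpNorm_add_le (hhm.sub hup.1) (hup.1.sub hf.1) hp1).trans
          (add_le_add hh1 hn1)
      _ = ε := ENNReal.add_halves ε
  · calc eLpNorm (partialDeriv i h - fun x => g x i) (ENNReal.ofReal q) volume
        = eLpNorm ((partialDeriv i h - partialDeriv i u) + (partialDeriv i u - fun x => g x i))
            (ENNReal.ofReal q) volume := by rw [sub_add_sub_cancel]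
      _ ≤ ε / 2 + ε / 2 := (eLpNorm_add_le ((hhdm i).sub (hduq i).1)
          ((hduq i).1.sub (hgi i).1) hq1).trans (add_le_add (hh2 i) (by rw [hdu]; exact hn2 i))
      _ = ε := ENNReal.add_halves ε

/-! ### Uniform estimates for potentials of smooth functions of compact support -/

/-- Interpolation between `L^p` and `L^∞`. -/
theorem eLpNorm_le_of_enorm_le {F : Type*} [NormedAddCommGroup F] {f : Plane → F} {p q : ℝ}
    (hp : 0 < p) (hpq : p ≤ q) {M : ℝ≥0∞} (hM : ∀ x, ‖f x‖ₑ ≤ M)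
    (hf : eLpNorm f (ENNReal.ofReal p) volume ≤ M) : eLpNorm f (ENNReal.ofReal q) volume ≤ M := by
  rcases eq_or_ne M ⊤ with rfl | hMt
  · exact le_top
  have hq : 0 < q := by linarith
  have hs : 0 ≤ q - p := by linarith
  rw [eLpNorm_eq_lintegral_rpow_enorm_toReal (by simpa using hp) ENNReal.ofReal_ne_top,
    ENNReal.toReal_ofReal hp.le, one_div, ENNReal.rpow_inv_le_iff hp] at hf
  rw [eLpNorm_eq_lintegral_rpow_enorm_toReal (by simpa using hq) ENNReal.ofReal_ne_top,
    ENNReal.toReal_ofReal hq.le, one_div, ENNReal.rpow_inv_le_iff hq]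
  calc ∫⁻ x, ‖f x‖ₑ ^ q = ∫⁻ x, ‖f x‖ₑ ^ (q - p) * ‖f x‖ₑ ^ p := by
        simp only [← ENNReal.rpow_add_of_nonneg _ _ hs hp.le, sub_add_cancel]
    _ ≤ ∫⁻ x, M ^ (q - p) * ‖f x‖ₑ ^ p := by
        gcongr with x
        exact hM x
    _ = M ^ (q - p) * ∫⁻ x, ‖f x‖ₑ ^ p := lintegral_const_mul' _ _ (by finiteness)
    _ ≤ M ^ (q - p) * M ^ p := by gcongr
    _ = M ^ q := by rw [← ENNReal.rpow_add_of_nonneg _ _ hs hp.le, sub_add_cancel]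

/-- The norm `‖h‖_p + ∑ᵢ ‖∂ᵢh‖_q`. -/
def mixedNorm (p q : ℝ) (h : Plane → 𝕜) : ℝ≥0∞ :=
  eLpNorm h (ENNReal.ofReal p) volume +
    ∑ i, eLpNorm (partialDeriv i h) (ENNReal.ofReal q) volume

/-- Values, and first, second and third derivatives of the potential are controlled by `mixedNorm`,
with one constant for all the estimates. The suprema come from Morrey's inequality: for the second
derivatives it is combined with the Calderón–Zygmund estimates in `L^p` and `L^q`, and for the
gradient with the Hardy–Littlewood–Sobolev inequality and the resulting `L^q` bound of the second
derivatives. -/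
theorem exists_potential_bounds {p q : ℝ} (hp : 1 < p) (hp2 : p < 2) (hq : 2 < q) :
    ∃ C : ℝ≥0∞, C ≠ ⊤ ∧ ∀ h : Plane → 𝕜, ContDiff ℝ ∞ h → HasCompactSupport h →
      (∀ x, ‖h x‖ₑ ≤ C * mixedNorm p q h) ∧
      (∀ i x, ‖kconv (gradLog i) h x‖ₑ ≤ C * mixedNorm p q h) ∧
      (∀ i j x, ‖kconv (gradLog i) (partialDeriv j h) x‖ₑ ≤ C * mixedNorm p q h) ∧
      (∀ i, eLpNorm (kconv (gradLog i) h) (ENNReal.ofReal (sobolevConj p)) volume ≤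
        C * mixedNorm p q h) ∧
      (∀ i j, eLpNorm (kconv (gradLog i) (partialDeriv j h)) (ENNReal.ofReal p) volume ≤
        C * mixedNorm p q h) ∧
      ∀ i j k, eLpNorm (partialDeriv k (kconv (gradLog i) (partialDeriv j h)))
        (ENNReal.ofReal q) volume ≤ C * mixedNorm p q h := by
  have hps := lt_sobolevConj hp hp2
  obtain ⟨A₁, hA₁, m₁⟩ := exists_enorm_le_eLpNorm_add (𝕜 := 𝕜) hp hq
  obtain ⟨A₂, hA₂, m₂⟩ := exists_enorm_le_eLpNorm_add (𝕜 := 𝕜)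
    (show 1 < sobolevConj p by linarith) hq
  obtain ⟨B₁, hB₁, c₁⟩ := exists_eLpNorm_kconv_gradLog_partialDeriv_le (𝕜 := 𝕜) hp
  obtain ⟨B₂, hB₂, c₂⟩ := exists_eLpNorm_kconv_gradLog_partialDeriv_le (𝕜 := 𝕜)
    (show 1 < q by linarith)
  obtain ⟨H, hH, s⟩ := exists_eLpNorm_kconv_gradLog_le (𝕜 := 𝕜) hp hp2
  set D := A₁ * (B₁ + 2 * B₂) + B₁ with hD
  have hDt : D ≠ ⊤ := by finiteness
  set C := A₁ + H + B₁ + B₂ + D + A₂ * (H + 2 * D) with hC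
  have leC : ∀ {a : ℝ≥0∞}, a ≤ C → ∀ {b N : ℝ≥0∞}, b ≤ a * N → b ≤ C * N :=
    fun ha _ _ hb => hb.trans (by gcongr)
  have cA₁ : A₁ ≤ C := by
    simp only [hC, add_assoc]; exact le_self_add
  have cH : H ≤ C := by
    rw [hC]; calc H ≤ A₁ + H := le_add_self
      _ ≤ _ := by simp only [add_assoc]; gcongr; exact le_self_add
  have cB₁ : B₁ ≤ C := by
    rw [hC]; calc B₁ ≤ A₁ + H + B₁ := le_add_self
      _ ≤ _ := by simp only [add_assoc]; gcongr; exact le_self_add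
  have cB₂ : B₂ ≤ C := by
    rw [hC]; calc B₂ ≤ A₁ + H + B₁ + B₂ := le_add_self
      _ ≤ _ := by simp only [add_assoc]; gcongr; exact le_self_add
  have cD : D ≤ C := by
    rw [hC]; calc D ≤ A₁ + H + B₁ + B₂ + D := le_add_self
      _ ≤ _ := le_self_add
  have cE : A₂ * (H + 2 * D) ≤ C := le_add_self
  refine ⟨C, by finiteness, fun h hh hs => ?_⟩
  set N := mixedNorm p q h with hN
  have hNp : eLpNorm h (ENNReal.ofReal p) volume ≤ N := le_self_add
  have hNq : ∀ i, eLpNorm (partialDeriv i h) (ENNReal.ofReal q) volume ≤ N := fun i =>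
    (Finset.single_le_sum (f := fun i => eLpNorm (partialDeriv i h) (ENNReal.ofReal q) volume)
      (fun _ _ => zero_le) (Finset.mem_univ i)).trans le_add_self
  have hdh := contDiff_partialDeriv hh
  have hds := hasCompactSupport_partialDeriv hs
  have hK := locallyIntegrable_gradLog
  have hU := fun i => contDiff_kconv (hK i) hh hs
  have hV := fun i j => contDiff_kconv (hK i) (hdh j) (hds j)
  have hUd : ∀ i j, partialDeriv j (kconv (gradLog i) h) = kconv (gradLog i) (partialDeriv j h) :=
    fun i j => partialDeriv_kconv (hK i) (hh.of_le (by simp)) hs j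
  have hVd : ∀ i j k, partialDeriv k (kconv (gradLog i) (partialDeriv j h)) =
      kconv (gradLog i) (partialDeriv k (partialDeriv j h)) := fun i j k =>
    partialDeriv_kconv (hK i) ((hdh j).of_le (by simp)) (hds j) k
  have b₁ : ∀ i j, eLpNorm (kconv (gradLog i) (partialDeriv j h)) (ENNReal.ofReal p) volume ≤
      B₁ * N := fun i j => (c₁ h hh hs i j).trans (by gcongr)
  have b₂ : ∀ i j k, eLpNorm (partialDeriv k (kconv (gradLog i) (partialDeriv j h)))
      (ENNReal.ofReal q) volume ≤ B₂ * N := fun i j k => by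
    rw [hVd]
    exact (c₂ _ (hdh j) (hds j) i k).trans (by gcongr; exact hNq j)
  have b₃ : ∀ i, eLpNorm (kconv (gradLog i) h) (ENNReal.ofReal (sobolevConj p)) volume ≤ H * N :=
    fun i => (s h hh hs i).trans (by gcongr)
  have b₄ : ∀ i j x, ‖kconv (gradLog i) (partialDeriv j h) x‖ₑ ≤ D * N := fun i j x => by
    refine (m₁ _ ((hV i j).of_le (by simp)) x).trans ?_
    calc _ ≤ A₁ * (B₁ * N + ∑ k : Fin 2, B₂ * N) := by
          gcongr with k
          · exact b₁ i j
          · exact b₂ i j k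
      _ = A₁ * (B₁ + 2 * B₂) * N := by
          rw [Fin.sum_univ_two]; ring
      _ ≤ _ := by rw [hD]; gcongr; exact le_self_add
  have b₅ : ∀ i j, eLpNorm (kconv (gradLog i) (partialDeriv j h)) (ENNReal.ofReal q) volume ≤
      D * N := fun i j =>
    eLpNorm_le_of_enorm_le (by linarith) (by linarith) (b₄ i j)
      ((b₁ i j).trans (by rw [hD]; gcongr; exact le_add_self))
  have b₆ : ∀ i x, ‖kconv (gradLog i) h x‖ₑ ≤ A₂ * (H + 2 * D) * N := fun i x => by
    refine (m₂ _ ((hU i).of_le (by simp)) x).trans ?_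
    calc _ ≤ A₂ * (H * N + ∑ k : Fin 2, D * N) := by
          gcongr with k
          · exact b₃ i
          · rw [hUd]; exact b₅ i k
      _ = A₂ * (H + 2 * D) * N := by
          rw [Fin.sum_univ_two]; ring
  exact ⟨fun x => leC cA₁ (m₁ h (hh.of_le (by simp)) x), fun i x => leC cE (b₆ i x),
    fun i j x => leC cD (b₄ i j x), fun i => leC cH (b₃ i), fun i j => leC cB₁ (b₁ i j),
    fun i j k => leC cB₂ (b₂ i j k)⟩

/-! ### The potential of a smooth function of compact support -/

theorem potential_eq_kconv_log {h : Plane → 𝕜} (hh : Continuous h) (hs : HasCompactSupport h)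
    (x : Plane) : potential h x = (-(1 / (2 * π)) : ℝ) •
      (kconv (fun w => Real.log ‖w‖) h x - kconv (fun w => Real.log ‖w‖) h 0) := by
  have hi : ∀ z, Integrable fun y => Real.log ‖z - y‖ • h y := fun z => by
    have := (integrable_smul_comp_sub locallyIntegrable_log_norm hh hs z).comp_sub_left z
    simpa using this
  have he : ∀ z, kconv (fun w => Real.log ‖w‖) h z = ∫ y, Real.log ‖z - y‖ • h y := fun z => by
    rw [kconv, ← integral_sub_left_eq_self _ volume z]
    simp only [sub_sub_cancel]
  rw [potential, he, he, ← integral_sub (hi x) (hi 0)]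
  congr 1
  refine integral_congr_ae ?_
  filter_upwards [compl_mem_ae_iff.2 (measure_singleton (μ := (volume : Measure Plane)) 0),
    compl_mem_ae_iff.2 (measure_singleton (μ := (volume : Measure Plane)) x)] with y hy hyx
  have h1 : ‖y‖ ≠ 0 := norm_ne_zero_iff.2 hy
  have h2 : ‖x - y‖ ≠ 0 := norm_ne_zero_iff.2 (sub_ne_zero.2 (Ne.symm hyx))
  simp only [potentialIntegrand]
  rw [Real.log_div h2 h1, sub_smul, zero_sub, norm_neg]

theorem partialDeriv_const_smul {u : Plane → 𝕜} (hu : Differentiable ℝ u) (c : ℝ) (i : Fin 2) :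
    partialDeriv i (c • u) = c • partialDeriv i u := by
  funext x
  rw [partialDeriv, fderiv_const_smul (hu x)]
  rfl

theorem contDiff_potential {h : Plane → 𝕜} (hh : ContDiff ℝ ∞ h) (hs : HasCompactSupport h) :
    ContDiff ℝ ∞ (potential h) := by
  rw [funext (potential_eq_kconv_log hh.continuous hs)]
  exact ((contDiff_kconv locallyIntegrable_log_norm hh hs).sub contDiff_const).const_smul _

theorem partialDeriv_potential {h : Plane → 𝕜} (hh : ContDiff ℝ ∞ h) (hs : HasCompactSupport h)
    (i : Fin 2) : partialDeriv i (potential h) =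
      (-(1 / (2 * π)) : ℝ) • kconv (gradLog i) h := by
  have hL := contDiff_kconv locallyIntegrable_log_norm hh hs
  have hL1 : Differentiable ℝ (kconv (fun w => Real.log ‖w‖) h) := hL.differentiable (by simp)
  have e : potential h = (-(1 / (2 * π)) : ℝ) • fun x =>
      (kconv (fun w => Real.log ‖w‖) h x - kconv (fun w => Real.log ‖w‖) h 0) :=
    funext (potential_eq_kconv_log hh.continuous hs)
  rw [e, partialDeriv_const_smul (hL1.sub_const _)]
  congr 1
  funext x
  rw [partialDeriv, fderiv_sub_const]
  have h1 := congrFun (partialDeriv_kconv locallyIntegrable_log_norm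
    (hh.of_le (by simp)) hs i) x
  rw [partialDeriv] at h1
  rw [h1]
  exact kconv_log_partialDeriv (hh.of_le (by simp)) hs i x

theorem partialDeriv_partialDeriv_potential {h : Plane → 𝕜} (hh : ContDiff ℝ ∞ h)
    (hs : HasCompactSupport h) (i j : Fin 2) :
    partialDeriv j (partialDeriv i (potential h)) =
      (-(1 / (2 * π)) : ℝ) • kconv (gradLog i) (partialDeriv j h) := by
  have hU := contDiff_kconv (locallyIntegrable_gradLog i) hh hs
  rw [partialDeriv_potential hh hs, partialDeriv_const_smul (hU.differentiable (by simp)),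
    partialDeriv_kconv (locallyIntegrable_gradLog i) (hh.of_le (by simp)) hs]

theorem kconv_sub {k : Plane → ℝ} (hk : LocallyIntegrable k volume) {f g : Plane → 𝕜}
    (hf : Continuous f) (hfs : HasCompactSupport f) (hg : Continuous g)
    (hgs : HasCompactSupport g) : kconv k (f - g) = kconv k f - kconv k g := by
  funext x
  simp only [kconv, Pi.sub_apply, smul_sub]
  exact integral_sub (integrable_smul_comp_sub hk hf hfs x) (integrable_smul_comp_sub hk hg hgs x)

theorem partialDeriv_sub {f g : Plane → 𝕜} (hf : Differentiable ℝ f) (hg : Differentiable ℝ g)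
    (i : Fin 2) : partialDeriv i (f - g) = partialDeriv i f - partialDeriv i g := by
  funext x
  rw [partialDeriv, fderiv_sub (hf x) (hg x)]
  rfl

/-! ### Limits of differentiable functions -/

theorem exists_tendstoUniformly_of_enorm_sub_le {w : ℕ → Plane → 𝕜} {δ : ℕ → ℝ≥0∞}
    (hδ : Tendsto δ atTop (𝓝 0)) (h : ∀ n m x, ‖w n x - w m x‖ₑ ≤ δ n + δ m) :
    ∃ W : Plane → 𝕜, TendstoUniformly w W atTop := by
  have hsmall : ∀ ε : ℝ≥0∞, 0 < ε → ∃ N, ∀ n ≥ N, δ n < ε := fun ε hε =>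
    eventually_atTop.1 (hδ.eventually (Iio_mem_nhds hε))
  have hc : ∀ x, CauchySeq fun n => w n x := fun x => by
    rw [EMetric.cauchySeq_iff]
    intro ε hε
    obtain ⟨N, hN⟩ := hsmall (ε / 2) (ENNReal.half_pos hε.ne')
    refine ⟨N, fun m hm n hn => ?_⟩
    rw [edist_eq_enorm_sub]
    calc _ ≤ δ m + δ n := h m n x
      _ < ε / 2 + ε / 2 := ENNReal.add_lt_add (hN m hm) (hN n hn)
      _ = ε := ENNReal.add_halves ε
  choose W hW using fun x => cauchySeq_tendsto_of_complete (hc x)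
  refine ⟨W, ?_⟩
  have hle : ∀ n x, edist (W x) (w n x) ≤ δ n := fun n x => by
    have h1 : Tendsto (fun m => edist (w m x) (w n x)) atTop (𝓝 (edist (W x) (w n x))) :=
      (hW x).edist tendsto_const_nhds
    have h2 : Tendsto (fun m => δ m + δ n) atTop (𝓝 (0 + δ n)) := hδ.add_const _
    rw [zero_add] at h2
    exact le_of_tendsto_of_tendsto' h1 h2 fun m => by
      rw [edist_eq_enorm_sub]; exact h m n x
  rw [EMetric.tendstoUniformly_iff]
  intro ε hε
  filter_upwards [hδ.eventually (Iio_mem_nhds hε)] with n hn x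
  exact (hle n x).trans_lt hn

theorem fderiv_eq_smulRightL_add (u : Plane → 𝕜) (x : Plane) :
    fderiv ℝ u x =
      ContinuousLinearMap.smulRightL ℝ Plane 𝕜 (EuclideanSpace.proj 0) (partialDeriv 0 u x) +
      ContinuousLinearMap.smulRightL ℝ Plane 𝕜 (EuclideanSpace.proj 1) (partialDeriv 1 u x) := by
  ext v
  have hv : v = v 0 • basisVec 0 + v 1 • basisVec 1 := by
    ext i; fin_cases i <;> simp [basisVec]
  conv_lhs => rw [hv]
  simp [partialDeriv]

theorem contDiff_one_of_tendstoUniformly {u : ℕ → Plane → 𝕜} (hu : ∀ n, ContDiff ℝ 1 (u n))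
    {U : Plane → 𝕜} {G : Fin 2 → Plane → 𝕜} (hU : ∀ x, Tendsto (fun n => u n x) atTop (𝓝 (U x)))
    (hG : ∀ i, TendstoUniformly (fun n => partialDeriv i (u n)) (G i) atTop) :
    ContDiff ℝ 1 U ∧ ∀ i, partialDeriv i U = G i := by
  have hGc : ∀ i, Continuous (G i) := fun i =>
    (hG i).continuous (Eventually.of_forall fun n => continuous_partialDeriv (hu n) i).frequently
  set T := fun i => ContinuousLinearMap.smulRightL ℝ Plane 𝕜
    (EuclideanSpace.proj i : Plane →L[ℝ] ℝ) with hT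
  have hunif : TendstoUniformly (fun n => fderiv ℝ (u n))
      (fun x => T 0 (G 0 x) + T 1 (G 1 x)) atTop := by
    have h1 := ((T 0).uniformContinuous.comp_tendstoUniformly (hG 0)).add
      ((T 1).uniformContinuous.comp_tendstoUniformly (hG 1))
    have e : (fun n => fderiv ℝ (u n)) = fun n x =>
        T 0 (partialDeriv 0 (u n) x) + T 1 (partialDeriv 1 (u n) x) :=
      funext fun n => funext fun x => fderiv_eq_smulRightL_add (u n) x
    rw [e]
    exact h1
  have hder := hasFDerivAt_of_tendstoUniformly hunif
    (fun n x => ((hu n).differentiable one_ne_zero x).hasFDerivAt) hU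
  have hfd : fderiv ℝ U = fun x => T 0 (G 0 x) + T 1 (G 1 x) := funext fun x => (hder x).fderiv
  refine ⟨contDiff_one_iff_fderiv.2 ⟨fun x => (hder x).differentiableAt, ?_⟩, fun i => ?_⟩
  · rw [hfd]
    exact ((T 0).continuous.comp (hGc 0)).add ((T 1).continuous.comp (hGc 1))
  · funext x
    rw [partialDeriv, hfd]
    fin_cases i <;> simp [hT, basisVec]

theorem contDiff_two_of_partialDeriv {u : Plane → 𝕜} (hu : ContDiff ℝ 1 u)
    (h : ∀ i, ContDiff ℝ 1 (partialDeriv i u)) : ContDiff ℝ 2 u := by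
  rw [show (2 : WithTop ℕ∞) = 1 + 1 from (one_add_one_eq_two).symm, contDiff_succ_iff_fderiv]
  refine ⟨hu.differentiable one_ne_zero, fun h => absurd h (by simp), ?_⟩
  rw [funext (fderiv_eq_smulRightL_add u)]
  exact ((ContinuousLinearMap.contDiff _).comp (h 0)).add
    ((ContinuousLinearMap.contDiff _).comp (h 1))

theorem laplacian_eq_sum_partialDeriv {u : Plane → 𝕜} (hu : ContDiff ℝ 2 u) (x : Plane) :
    Δ u x = ∑ i, partialDeriv i (partialDeriv i u) x := by
  rw [InnerProductSpace.laplacian_eq_iteratedFDeriv_orthonormalBasis u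
    (EuclideanSpace.basisFun (Fin 2) ℝ)]
  refine Finset.sum_congr rfl fun i _ => ?_
  have hd : DifferentiableAt ℝ (fderiv ℝ u) x :=
    ((hu.fderiv_right (m := 1) (by norm_num)).differentiable one_ne_zero) x
  have h := hd.hasFDerivAt.clm_apply (hasFDerivAt_const (basisVec i) x)
  rw [iteratedFDeriv_two_apply]
  change _ = fderiv ℝ (fun y => fderiv ℝ u y (basisVec i)) x (basisVec i)
  rw [h.fderiv]
  simp [basisVec]

/-! ### Weak gradients of limits -/

theorem integral_partialDeriv_smul_eq_neg {u : Plane → 𝕜} (hu : ContDiff ℝ 1 u) {φ : Plane → ℝ}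
    (hφ : ContDiff ℝ 1 φ) (hs : HasCompactSupport φ) (i : Fin 2) :
    ∫ x, partialDeriv i φ x • u x = - ∫ x, φ x • partialDeriv i u x := by
  have hφu : ContDiff ℝ 1 fun x => φ x • u x := hφ.smul hu
  have h0 := integral_partialDeriv_eq_zero hφu hs.smul_right i
  have e : ∀ x, partialDeriv i (fun x => φ x • u x) x =
      φ x • partialDeriv i u x + partialDeriv i φ x • u x := fun x => by
    rw [partialDeriv, fderiv_fun_smul (hφ.differentiable one_ne_zero x)
      (hu.differentiable one_ne_zero x)]
    rfl
  have i1 : Integrable fun x => φ x • partialDeriv i u x :=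
    (hφ.continuous.smul (continuous_partialDeriv hu i)).integrable_of_hasCompactSupport
      hs.smul_right
  have i2 : Integrable fun x => partialDeriv i φ x • u x :=
    ((continuous_partialDeriv hφ i).smul hu.continuous).integrable_of_hasCompactSupport
      (hasCompactSupport_partialDeriv hs i).smul_right
  simp only [e] at h0
  rw [integral_add i1 i2] at h0
  exact eq_neg_of_add_eq_zero_right h0

theorem hasWeakGradient_of_tendsto {q : ℝ} (hq : 1 < q) {u : ℕ → Plane → 𝕜}
    (hu : ∀ n, ContDiff ℝ 1 (u n)) {U : Plane → 𝕜} (hU : TendstoUniformly u U atTop)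
    {G : Fin 2 → Plane → 𝕜} (hG : ∀ i, MemLp (G i) (ENNReal.ofReal q) volume)
    (hlim : ∀ i, Tendsto (fun n => eLpNorm (partialDeriv i (u n) - G i) (ENNReal.ofReal q) volume)
      atTop (𝓝 0)) :
    HasWeakGradient U fun x => WithLp.toLp 2 fun i => G i x := by
  have hUc : Continuous U :=
    hU.continuous (Eventually.of_forall fun n => (hu n).continuous).frequently
  have hq1 : 1 ≤ ENNReal.ofReal q := by simpa using hq.le
  have hGv : MemLp (fun x => (WithLp.toLp 2 fun i => G i x : EuclideanSpace 𝕜 (Fin 2)))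
      (ENNReal.ofReal q) volume := MemLp.of_eval_piLp hG
  refine ⟨hUc.locallyIntegrable, hGv.locallyIntegrable hq1, fun i φ hφ hs => ?_⟩
  have hφ1 : ContDiff ℝ 1 φ := hφ.of_le (by simp)
  have hpc := continuous_partialDeriv hφ1 i
  have hps := hasCompactSupport_partialDeriv hs i
  have hhc := (Real.HolderConjugate.conjExponent hq).symm
  have hφL : MemLp φ (ENNReal.ofReal q.conjExponent) volume :=
    hφ.continuous.memLp_of_hasCompactSupport hs
  have l1 : Tendsto (fun n => ∫ x, partialDeriv i φ x • u n x) atTop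
      (𝓝 (∫ x, partialDeriv i φ x • U x)) := by
    refine tendsto_integral_filter_of_dominated_convergence
      (fun x => ‖partialDeriv i φ x‖ * (‖U x‖ + 1)) (Eventually.of_forall fun n =>
        (hpc.smul (hu n).continuous).aestronglyMeasurable) ?_ ?_ ?_
    · filter_upwards [Metric.tendstoUniformly_iff.1 hU 1 one_pos] with n hn
      refine Eventually.of_forall fun x => ?_
      rw [norm_smul]
      gcongr
      have h1 := hn x
      rw [dist_comm, dist_eq_norm] at h1
      have h2 := norm_sub_norm_le (u n x) (U x)
      linarith
    · exact (hpc.norm.mul (hUc.norm.add continuous_const)).integrable_of_hasCompactSupport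
        hps.norm.mul_right
    · exact Eventually.of_forall fun x => (hU.tendsto_at x).const_smul _
  have l2 : Tendsto (fun n => ∫ x, φ x • partialDeriv i (u n) x) atTop
      (𝓝 (∫ x, φ x • G i x)) := by
    have iφu : ∀ n, Integrable fun x => φ x • partialDeriv i (u n) x := fun n =>
      (hφ.continuous.smul (continuous_partialDeriv (hu n) i)).integrable_of_hasCompactSupport
        hs.smul_right
    have iφG : Integrable fun x => φ x • G i x := by
      refine ⟨hφL.1.smul (hG i).1, lt_of_le_of_lt ?_ (ENNReal.mul_lt_top hφL.2 (hG i).2)⟩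
      simp only [enorm_smul]
      exact lintegral_enorm_mul_le hhc hφL.1 (hG i).1
    rw [tendsto_iff_edist_tendsto_0]
    have h0 := ENNReal.Tendsto.const_mul (a := eLpNorm φ (ENNReal.ofReal q.conjExponent) volume)
      (hlim i) (Or.inr hφL.eLpNorm_ne_top)
    rw [mul_zero] at h0
    refine tendsto_of_tendsto_of_tendsto_of_le_of_le tendsto_const_nhds h0 (fun n => zero_le)
      fun n => ?_
    simp only
    rw [edist_eq_enorm_sub, ← integral_sub (iφu n) iφG]
    refine (enorm_integral_le_lintegral_enorm _).trans ?_
    simp only [← smul_sub, enorm_smul]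
    exact lintegral_enorm_mul_le hhc hφL.1
      ((continuous_partialDeriv (hu n) i).aestronglyMeasurable.sub (hG i).1)
  have l3 : Tendsto (fun n => ∫ x, partialDeriv i φ x • u n x) atTop
      (𝓝 (- ∫ x, φ x • G i x)) := by
    refine l2.neg.congr fun n => ?_
    exact (integral_partialDeriv_smul_eq_neg (hu n) hφ1 hs i).symm
  exact tendsto_nhds_unique l1 l3

/-! ### Convergence of the potentials of an approximating sequence -/

theorem mixedNorm_lt_top {h : Plane → 𝕜} (hh : ContDiff ℝ ∞ h) (hs : HasCompactSupport h)
    (p q : ℝ) : mixedNorm p q h < ⊤ :=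
  ENNReal.add_lt_top.2 ⟨(hh.continuous.memLp_of_hasCompactSupport hs).2,
    ENNReal.sum_lt_top.2 fun i _ =>
      ((contDiff_partialDeriv hh i).continuous.memLp_of_hasCompactSupport
      (hasCompactSupport_partialDeriv hs i)).2⟩

theorem mixedNorm_le_add {p q : ℝ} (hp : 1 ≤ p) (hq : 1 ≤ q) {f g : Plane → 𝕜}
    (hf : ContDiff ℝ ∞ f) (hg : ContDiff ℝ ∞ g) :
    mixedNorm p q f ≤ mixedNorm p q (f - g) + mixedNorm p q g := by
  have key : ∀ {r : ℝ}, 1 ≤ r → ∀ {a b : Plane → 𝕜}, Continuous a → Continuous b →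
      eLpNorm a (ENNReal.ofReal r) volume ≤
        eLpNorm (a - b) (ENNReal.ofReal r) volume + eLpNorm b (ENNReal.ofReal r) volume := by
    intro r hr a b ha hb
    have := eLpNorm_add_le (p := ENNReal.ofReal r) (μ := volume)
      (ha.sub hb).aestronglyMeasurable hb.aestronglyMeasurable (by simpa using hr)
    rwa [sub_add_cancel] at this
  simp only [mixedNorm]
  rw [add_add_add_comm, ← Finset.sum_add_distrib]
  refine add_le_add (key hp hf.continuous hg.continuous) (Finset.sum_le_sum fun i _ => ?_)
  rw [partialDeriv_sub (hf.differentiable (by simp)) (hg.differentiable (by simp))]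
  exact key hq (contDiff_partialDeriv hf i).continuous (contDiff_partialDeriv hg i).continuous

theorem exists_contDiff_seq_mixedNorm {p q : ℝ} (hp : 1 < p) (hpq : p ≤ q) {f : Plane → 𝕜}
    (hf : MemLp f (ENNReal.ofReal p) volume) {g : Plane → EuclideanSpace 𝕜 (Fin 2)}
    (hfg : HasWeakGradient f g) (hg : MemLp g (ENNReal.ofReal q) volume) :
    ∃ F : ℕ → Plane → 𝕜, (∀ n, ContDiff ℝ ∞ (F n)) ∧ (∀ n, HasCompactSupport (F n)) ∧
      (∀ n, eLpNorm (F n - f) (ENNReal.ofReal p) volume ≤ 2⁻¹ ^ n) ∧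
      ∀ n m, mixedNorm p q (F n - F m) ≤ 3 * 2⁻¹ ^ n + 3 * 2⁻¹ ^ m := by
  have hp1 : 1 ≤ ENNReal.ofReal p := by simpa using hp.le
  have hq1 : 1 ≤ ENNReal.ofReal q := by simpa using hp.le.trans hpq
  choose F hF hFs hFp hFq using fun n : ℕ => exists_contDiff_approx_gradient hp hpq hf hfg hg
    (ε := 2⁻¹ ^ n) (by simp [pos_iff_ne_zero])
  refine ⟨F, hF, hFs, hFp, fun n m => ?_⟩
  have key : ∀ {r : ℝ≥0∞}, 1 ≤ r → ∀ {a b c : Plane → 𝕜}, AEStronglyMeasurable a volume →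
      AEStronglyMeasurable b volume → AEStronglyMeasurable c volume →
      eLpNorm (a - c) r volume ≤ 2⁻¹ ^ n → eLpNorm (b - c) r volume ≤ 2⁻¹ ^ m →
      eLpNorm (a - b) r volume ≤ 2⁻¹ ^ n + 2⁻¹ ^ m := by
    intro r hr a b c ha hb hc h1 h2
    rw [← sub_sub_sub_cancel_right a b c]
    exact (eLpNorm_sub_le (ha.sub hc) (hb.sub hc) hr).trans (add_le_add h1 h2)
  have hm := fun n => (hF n).continuous.aestronglyMeasurable (μ := volume)
  have hdm := fun n i => (contDiff_partialDeriv (hF n) i).continuous.aestronglyMeasurable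
    (μ := volume)
  calc mixedNorm p q (F n - F m)
      ≤ (2⁻¹ ^ n + 2⁻¹ ^ m) + ∑ _i : Fin 2, (2⁻¹ ^ n + 2⁻¹ ^ m) := by
        refine add_le_add (key hp1 (hm n) (hm m) hf.1 (hFp n) (hFp m))
          (Finset.sum_le_sum fun i _ => ?_)
        rw [partialDeriv_sub ((hF n).differentiable (by simp)) ((hF m).differentiable (by simp))]
        exact key hq1 (hdm n i) (hdm m i) (hg.eval_piLp i).1 (hFq n i) (hFq m i)
    _ = _ := by rw [Fin.sum_univ_two]; ring

theorem tendsto_potential {p q : ℝ} (hpq : q.HolderConjugate p) (hp2 : p < 2)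
    {f : Plane → 𝕜} (hf : MemLp f (ENNReal.ofReal p) volume) {F : ℕ → Plane → 𝕜}
    (hF : ∀ n, MemLp (F n) (ENNReal.ofReal p) volume)
    (hlim : Tendsto (fun n => eLpNorm (F n - f) (ENNReal.ofReal p) volume) atTop (𝓝 0))
    (x : Plane) : Tendsto (fun n => potential (F n) x) atTop (𝓝 (potential f x)) := by
  have hq := two_lt_of_holderConjugate hpq hp2
  rw [tendsto_iff_edist_tendsto_0]
  have hD : 2 * eLpNorm (logMajorant q) (ENNReal.ofReal q) volume ≠ ⊤ :=
    ENNReal.mul_ne_top (by simp) (memLp_logMajorant hq).eLpNorm_ne_top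
  have h0 := ENNReal.Tendsto.const_mul (a := ENNReal.ofReal (‖x‖ + q * ‖x‖ ^ (1 / q)))
    (ENNReal.Tendsto.const_mul hlim (Or.inr hD)) (Or.inr ENNReal.ofReal_ne_top)
  rw [mul_zero, mul_zero] at h0
  refine tendsto_of_tendsto_of_tendsto_of_le_of_le tendsto_const_nhds h0 (fun n => zero_le)
    fun n => ?_
  have e : potential (F n) x - potential f x = potential (F n - f) x := by
    simp only [potential]
    rw [← smul_sub, ← integral_sub (integrable_potentialIntegrand hpq hp2 (hF n) x)
      (integrable_potentialIntegrand hpq hp2 hf x)]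
    simp only [potentialIntegrand, Pi.sub_apply, smul_sub]
  simp only
  rw [edist_eq_enorm_sub, e]
  exact enorm_potential_le hpq hp2 ((hF n).1.sub hf.1) x

theorem eq_of_tendstoUniformly_of_tendsto_eLpNorm {p : ℝ} {f : Plane → 𝕜}
    (hfc : Continuous f) (hp : 0 < p) {F : ℕ → Plane → 𝕜} (hF : ∀ n, Continuous (F n))
    (hlim : Tendsto (fun n => eLpNorm (F n - f) (ENNReal.ofReal p) volume) atTop (𝓝 0))
    {W : Plane → 𝕜} (hW : TendstoUniformly F W atTop) : W = f := by
  have hWc : Continuous W := hW.continuous (Eventually.of_forall hF).frequently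
  have h := Lp.eLpNorm_lim_le_liminf_eLpNorm (p := ENNReal.ofReal p) (μ := volume)
    (f := fun n => F n - f) (fun n => ((hF n).sub hfc).aestronglyMeasurable) (W - f)
    (Eventually.of_forall fun x => (hW.tendsto_at x).sub_const _)
  rw [hlim.liminf_eq, nonpos_iff_eq_zero, eLpNorm_eq_zero_iff
    (hWc.sub hfc).aestronglyMeasurable (by simpa using hp)] at h
  have h2 : W =ᵐ[volume] f := h.mono fun x hx => sub_eq_zero.1 hx
  exact (Continuous.ae_eq_iff_eq volume hWc hfc).1 h2

theorem memLp_of_tendstoUniformly {r : ℝ≥0∞} {w : ℕ → Plane → 𝕜} (hw : ∀ n, Continuous (w n))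
    {W : Plane → 𝕜} (hW : TendstoUniformly w W atTop) {K : ℝ≥0∞} (hK : K ≠ ⊤)
    (h : ∀ n, eLpNorm (w n) r volume ≤ K) : MemLp W r volume := by
  have hWc : Continuous W := hW.continuous (Eventually.of_forall hw).frequently
  refine ⟨hWc.aestronglyMeasurable, lt_of_le_of_lt ?_ hK.lt_top⟩
  refine (Lp.eLpNorm_lim_le_liminf_eLpNorm (fun n => (hw n).aestronglyMeasurable) W
    (Eventually.of_forall fun x => hW.tendsto_at x)).trans ?_
  refine liminf_le_of_le (by isBoundedDefault) fun b hb => ?_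
  obtain ⟨n, hn⟩ := hb.exists
  exact hn.trans (h n)

theorem norm_le_of_tendsto_of_enorm_le {w : ℕ → Plane → 𝕜} {W : Plane → 𝕜}
    (hW : TendstoUniformly w W atTop) {K : ℝ≥0∞} (hK : K ≠ ⊤) (h : ∀ n x, ‖w n x‖ₑ ≤ K)
    (x : Plane) : ‖W x‖ ≤ K.toReal := by
  refine le_of_tendsto (hW.tendsto_at x).norm (Eventually.of_forall fun n => ?_)
  rw [← ENNReal.ofReal_le_ofReal_iff ENNReal.toReal_nonneg, ofReal_norm, ENNReal.ofReal_toReal hK]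
  exact h n x

theorem tendsto_zero_of_tendstoUniformly {w : ℕ → Plane → 𝕜} {W : Plane → 𝕜}
    (hW : TendstoUniformly w W atTop) {l : Filter Plane} (h : ∀ n, Tendsto (w n) l (𝓝 0)) :
    Tendsto W l (𝓝 0) := by
  rw [Metric.tendsto_nhds]
  intro ε hε
  obtain ⟨n, hn⟩ := (Metric.tendstoUniformly_iff.1 hW (ε / 2) (half_pos hε)).exists
  filter_upwards [Metric.tendsto_nhds.1 (h n) (ε / 2) (half_pos hε)] with x hx
  linarith [dist_triangle (W x) (w n x) 0, hn x]

theorem tendsto_kconv_gradLog_cobounded {h : Plane → 𝕜} (hh : Continuous h)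
    (hs : HasCompactSupport h) (i : Fin 2) :
    Tendsto (kconv (gradLog i) h) (Bornology.cobounded Plane) (𝓝 0) := by
  obtain ⟨C, R₀, hC⟩ := exists_norm_kconv_gradLog_le hh hs i
  refine squeeze_zero_norm' (a := fun x => C / ‖x‖) ?_
    (tendsto_const_nhds.div_atTop tendsto_norm_cobounded_atTop)
  filter_upwards [tendsto_norm_cobounded_atTop.eventually_ge_atTop R₀] with x hx
  exact hC x hx

theorem norm_euclidean_le_add (v : EuclideanSpace 𝕜 (Fin 2)) : ‖v‖ ≤ ‖v 0‖ + ‖v 1‖ := by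
  rw [EuclideanSpace.norm_eq, Fin.sum_univ_two]
  refine Real.sqrt_le_iff.2 ⟨by positivity, ?_⟩
  nlinarith [mul_nonneg (norm_nonneg (v 0)) (norm_nonneg (v 1))]

theorem potential_zero (f : Plane → 𝕜) : potential f 0 = 0 := by
  have : ∀ y, potentialIntegrand f 0 y = 0 := fun y => by
    rw [potentialIntegrand, zero_sub, norm_neg]
    rcases eq_or_ne ‖y‖ 0 with h | h
    · simp [h]
    · rw [div_self h, Real.log_one, zero_smul]
  simp [potential, this]

/-- The classical regime: along an approximating sequence the first and second derivatives of the
potentials converge uniformly, and the third derivatives converge in `L^q`. -/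
theorem classical_potential {p q : ℝ} (hp : 1 < p) (hp2 : p < 2) (hq : 2 < q) {f : Plane → 𝕜}
    (hfc : Continuous f) (hf : MemLp f (ENNReal.ofReal p) volume)
    {g : Plane → EuclideanSpace 𝕜 (Fin 2)} (hfg : HasWeakGradient f g)
    (hg : MemLp g (ENNReal.ofReal q) volume) :
    IsClassicalSolution f (potential f) ∧
    (∀ i, MemLp (partialDeriv i (potential f)) (ENNReal.ofReal (sobolevConj p)) volume ∧
      ∃ C, ∀ x, ‖partialDeriv i (potential f) x‖ ≤ C) ∧
    (∀ i j, MemLp (partialDeriv j (partialDeriv i (potential f))) (ENNReal.ofReal p) volume ∧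
      ∃ C, ∀ x, ‖partialDeriv j (partialDeriv i (potential f)) x‖ ≤ C) ∧
    ∀ i j, ∃ h, HasWeakGradient (partialDeriv j (partialDeriv i (potential f))) h ∧
      MemLp h (ENNReal.ofReal q) volume := by
  have hpq := (Real.HolderConjugate.conjExponent hp).symm
  have hps := lt_sobolevConj hp hp2
  have hq1 : 1 ≤ ENNReal.ofReal q := by
    rw [ENNReal.one_le_ofReal]; linarith
  obtain ⟨C, hC, hb⟩ := exists_potential_bounds (𝕜 := 𝕜) hp hp2 hq
  obtain ⟨F, hF, hFs, hFp, hFm⟩ :=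
    exists_contDiff_seq_mixedNorm hp (by linarith : p ≤ q) hf hfg hg
  have hgeo : Tendsto (fun n : ℕ => (2⁻¹ : ℝ≥0∞) ^ n) atTop (𝓝 0) :=
    ENNReal.tendsto_pow_atTop_nhds_zero_of_lt_one (by simp)
  set δ : ℕ → ℝ≥0∞ := fun n => C * (3 * 2⁻¹ ^ n) with hδdef
  have hδ : Tendsto δ atTop (𝓝 0) := by
    have := ENNReal.Tendsto.const_mul (a := C)
      (ENNReal.Tendsto.const_mul (a := 3) hgeo (Or.inr (by simp))) (Or.inr hC)
    simpa using this
  have hCm : ∀ n m, C * mixedNorm p q (F n - F m) ≤ δ n + δ m := fun n m => by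
    rw [hδdef]; simp only; rw [← mul_add]; gcongr; exact hFm n m
  set K : ℝ≥0∞ := C * (6 + mixedNorm p q (F 0)) with hKdef
  have hK : K ≠ ⊤ := ENNReal.mul_ne_top hC
    (ENNReal.add_ne_top.2 ⟨by simp, (mixedNorm_lt_top (hF 0) (hFs 0) p q).ne⟩)
  have hCK : ∀ n, C * mixedNorm p q (F n) ≤ K := fun n => by
    rw [hKdef]
    gcongr
    refine (mixedNorm_le_add hp.le (by linarith) (hF n) (hF 0)).trans ?_
    gcongr
    refine (hFm n 0).trans ?_
    have : (2⁻¹ : ℝ≥0∞) ^ n ≤ 1 := pow_le_one₀ zero_le (by simp)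
    calc 3 * (2⁻¹ : ℝ≥0∞) ^ n + 3 * 2⁻¹ ^ 0 ≤ 3 * 1 + 3 * 1 := by
          gcongr; simp
      _ = 6 := by norm_num
  have hlim : Tendsto (fun n => eLpNorm (F n - f) (ENNReal.ofReal p) volume) atTop (𝓝 0) :=
    tendsto_of_tendsto_of_tendsto_of_le_of_le tendsto_const_nhds hgeo (fun _ => zero_le) hFp
  have hFL : ∀ n, MemLp (F n) (ENNReal.ofReal p) volume := fun n =>
    (hF n).continuous.memLp_of_hasCompactSupport (hFs n)
  have hK0 := locallyIntegrable_gradLog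
  have hdF := fun n j => contDiff_partialDeriv (hF n) j
  have hdFs := fun n j => hasCompactSupport_partialDeriv (hFs n) j
  have hD := fun n m => (hF n).sub (hF m)
  have hDs : ∀ n m, HasCompactSupport (F n - F m) := fun n m => (hFs n).sub (hFs m)
  -- multiplication by `-1 / (2π)` decreases norms
  set c : ℝ := -(1 / (2 * π)) with hc
  have hcn : ∀ v : 𝕜, ‖c • v‖ₑ ≤ ‖v‖ₑ := fun v => by
    rw [enorm_smul]; exact mul_le_of_le_one_left zero_le enorm_neg_one_div_two_pi_le
  have hcL : ∀ (v : Plane → 𝕜) (r : ℝ≥0∞), eLpNorm (c • v) r volume ≤ eLpNorm v r volume :=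
    fun v r => by
      rw [eLpNorm_const_smul]; exact mul_le_of_le_one_left zero_le enorm_neg_one_div_two_pi_le
  -- first and second derivatives of the approximating potentials
  have hP := fun n => contDiff_potential (hF n) (hFs n)
  have e1 := fun n i => partialDeriv_potential (hF n) (hFs n) i
  have e2 := fun n i j => partialDeriv_partialDeriv_potential (hF n) (hFs n) i j
  have hU := fun n i => contDiff_partialDeriv (hP n) i
  have hV := fun n i j => contDiff_partialDeriv (hU n i) j
  have hVsub : ∀ i j n m, kconv (gradLog i) (partialDeriv j (F n)) -
      kconv (gradLog i) (partialDeriv j (F m)) =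
        kconv (gradLog i) (partialDeriv j (F n - F m)) := fun i j n m => by
    rw [partialDeriv_sub ((hF n).differentiable (by simp)) ((hF m).differentiable (by simp)),
      kconv_sub (hK0 i) (hdF n j).continuous (hdFs n j) (hdF m j).continuous (hdFs m j)]
  obtain ⟨W, hW⟩ := exists_tendstoUniformly_of_enorm_sub_le (w := F) hδ fun n m x =>
    ((hb _ (hD n m) (hDs n m)).1 x).trans (hCm n m)
  have hWf : W = f := eq_of_tendstoUniformly_of_tendsto_eLpNorm hfc (by linarith)
    (fun n => (hF n).continuous) hlim hW
  rw [hWf] at hW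
  have hGex : ∀ i, ∃ G : Plane → 𝕜,
      TendstoUniformly (fun n => partialDeriv i (potential (F n))) G atTop := fun i => by
    refine exists_tendstoUniformly_of_enorm_sub_le hδ fun n m x => ?_
    rw [e1, e1, Pi.smul_apply, Pi.smul_apply, ← smul_sub, ← Pi.sub_apply (kconv _ _),
      ← kconv_sub (hK0 i) (hF n).continuous (hFs n) (hF m).continuous (hFs m)]
    exact (hcn _).trans (((hb _ (hD n m) (hDs n m)).2.1 i x).trans (hCm n m))
  choose G hG using hGex
  have hHex : ∀ i j, ∃ H : Plane → 𝕜, TendstoUniformly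
      (fun n => partialDeriv j (partialDeriv i (potential (F n)))) H atTop := fun i j => by
    refine exists_tendstoUniformly_of_enorm_sub_le hδ fun n m x => ?_
    rw [e2, e2, Pi.smul_apply, Pi.smul_apply, ← smul_sub, ← Pi.sub_apply (kconv _ _), hVsub]
    exact (hcn _).trans (((hb _ (hD n m) (hDs n m)).2.2.1 i j x).trans (hCm n m))
  choose H hH using hHex
  obtain ⟨hP1, hPd⟩ := contDiff_one_of_tendstoUniformly (fun n => (hP n).of_le (by simp))
    (tendsto_potential hpq hp2 hf hFL hlim) hG
  have hG1 := fun i => contDiff_one_of_tendstoUniformly (fun n => (hU n i).of_le (by simp))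
    (fun x => (hG i).tendsto_at x) (hH i)
  have hPdd : ∀ i j, partialDeriv j (partialDeriv i (potential f)) = H i j := fun i j => by
    rw [hPd]; exact (hG1 i).2 j
  have hP2 : ContDiff ℝ 2 (potential f) :=
    contDiff_two_of_partialDeriv hP1 fun i => by rw [hPd]; exact (hG1 i).1
  have hGb : ∀ i x, ‖G i x‖ ≤ K.toReal := fun i => norm_le_of_tendsto_of_enorm_le (hG i) hK
    fun n x => by
      rw [e1]; exact (hcn _).trans (((hb _ (hF n) (hFs n)).2.1 i x).trans (hCK n))
  have hHb : ∀ i j x, ‖H i j x‖ ≤ K.toReal := fun i j =>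
    norm_le_of_tendsto_of_enorm_le (hH i j) hK fun n x => by
      rw [e2]; exact (hcn _).trans (((hb _ (hF n) (hFs n)).2.2.1 i j x).trans (hCK n))
  have hG0 : ∀ i, Tendsto (G i) (Bornology.cobounded Plane) (𝓝 0) := fun i =>
    tendsto_zero_of_tendstoUniformly (hG i) fun n => by
      rw [e1]
      have := (tendsto_kconv_gradLog_cobounded (hF n).continuous (hFs n) i).const_smul c
      rwa [smul_zero] at this
  refine ⟨⟨hP2, fun x => ?_, ⟨K.toReal + K.toReal, fun x => ?_⟩, ?_, potential_zero f⟩,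
    fun i => ?_, fun i j => ?_, fun i j => ?_⟩
  · -- Poisson's equation holds in the limit
    rw [laplacian_eq_sum_partialDeriv hP2]
    simp only [hPdd]
    have l1 : Tendsto (fun n => ∑ i, partialDeriv i (partialDeriv i (potential (F n))) x) atTop
        (𝓝 (∑ i, H i i x)) := tendsto_finsetSum _ fun i _ => (hH i i).tendsto_at x
    have l2 : Tendsto (fun n => - F n x) atTop (𝓝 (- f x)) := (hW.tendsto_at x).neg
    have e3 : ∀ n, ∑ i, partialDeriv i (partialDeriv i (potential (F n))) x = - F n x := fun n => by
      simp only [e2, Pi.smul_apply]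
      rw [← Finset.smul_sum, sum_kconv_gradLog_partialDeriv
        (isTame_of_hasCompactSupport ((hF n).of_le (by simp)) (hFs n)), smul_smul, neg_mul,
        one_div, inv_mul_cancel₀ (by positivity), neg_one_smul]
    simp only [e3] at l1
    rw [tendsto_nhds_unique l1 l2, neg_neg]
  · refine (norm_euclidean_le_add _).trans (add_le_add ?_ ?_)
    · simp only [grad, hPd]; exact hGb 0 x
    · simp only [grad, hPd]; exact hGb 1 x
  · have h0 := (hG0 0).norm.add (hG0 1).norm
    rw [norm_zero, add_zero] at h0
    refine squeeze_zero (fun _ => norm_nonneg _) (fun x => ?_) h0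
    refine (norm_euclidean_le_add _).trans_eq ?_
    simp only [grad, hPd]
  · rw [hPd]
    refine ⟨memLp_of_tendstoUniformly (fun n => (hU n i).continuous) (hG i) hK fun n => ?_,
      K.toReal, hGb i⟩
    rw [e1]
    exact (hcL _ _).trans (((hb _ (hF n) (hFs n)).2.2.2.1 i).trans (hCK n))
  · rw [hPdd]
    refine ⟨memLp_of_tendstoUniformly (fun n => (hV n i j).continuous) (hH i j) hK fun n => ?_,
      K.toReal, hHb i j⟩
    rw [e2]
    exact (hcL _ _).trans (((hb _ (hF n) (hFs n)).2.2.2.2.1 i j).trans (hCK n))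
  · rw [hPdd]
    have hVk := fun n => contDiff_kconv (hK0 i) (hdF n j) (hdFs n j)
    have e3 : ∀ n k, partialDeriv k (partialDeriv j (partialDeriv i (potential (F n)))) =
        c • partialDeriv k (kconv (gradLog i) (partialDeriv j (F n))) := fun n k => by
      rw [e2, partialDeriv_const_smul ((hVk n).differentiable (by simp))]
    have hex : ∀ k, ∃ h : Plane → 𝕜, MemLp h (ENNReal.ofReal q) volume ∧
        Tendsto (fun n => eLpNorm
          (partialDeriv k (partialDeriv j (partialDeriv i (potential (F n)))) - h)
          (ENNReal.ofReal q) volume) atTop (𝓝 0) := fun k => by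
      refine Lp.cauchy_complete_eLpNorm hq1 (fun n => ⟨?_, ?_⟩)
        (B := fun N => (C * 6 + 1) * 2⁻¹ ^ N) ?_ fun N n m hn hm => ?_
      · exact (contDiff_partialDeriv (hV n i j) k).continuous.aestronglyMeasurable
      · rw [e3]
        exact (hcL _ _).trans_lt (((hb _ (hF n) (hFs n)).2.2.2.2.2 i j k).trans_lt
          ((hCK n).trans_lt hK.lt_top))
      · rw [ENNReal.tsum_mul_left, ENNReal.tsum_geometric]
        refine ENNReal.mul_ne_top (by finiteness) (by simp)
      · rw [e3, e3, ← smul_sub, ← partialDeriv_sub ((hVk n).differentiable (by simp))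
          ((hVk m).differentiable (by simp)), hVsub]
        have hpow : ∀ a, N ≤ a → (2⁻¹ : ℝ≥0∞) ^ a ≤ 2⁻¹ ^ N := fun a ha =>
          pow_le_pow_of_le_one zero_le (by simp) ha
        calc _ ≤ C * mixedNorm p q (F n - F m) :=
              (hcL _ _).trans ((hb _ (hD n m) (hDs n m)).2.2.2.2.2 i j k)
          _ ≤ C * (3 * 2⁻¹ ^ N + 3 * 2⁻¹ ^ N) := by
              gcongr
              refine (hFm n m).trans ?_
              exact add_le_add (mul_le_mul' le_rfl (hpow n hn)) (mul_le_mul' le_rfl (hpow m hm))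
          _ = (C * 6) * 2⁻¹ ^ N := by ring
          _ < (C * 6 + 1) * 2⁻¹ ^ N := by
              exact ENNReal.mul_lt_mul_left (by simp) (by finiteness)
                (ENNReal.lt_add_right (by finiteness) one_ne_zero)
    choose h hh hhlim using hex
    exact ⟨_, hasWeakGradient_of_tendsto (by linarith) (fun n => (hV n i j).of_le (by simp))
      (hH i j) hh hhlim, MemLp.of_eval_piLp hh⟩

/-! ### Uniqueness -/

/-- The real form of Liouville's theorem behind uniqueness: for a harmonic function `d` of the
plane, `∂₀ d - i ∂₁ d` is an entire function of `x₀ + i x₁`. -/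
theorem eq_zero_of_harmonic {d : Plane → ℝ} (hd : ContDiff ℝ 2 d)
    (hharm : ∀ x, ∑ i, partialDeriv i (partialDeriv i d) x = 0) {C : ℝ}
    (hb : ∀ i x, ‖partialDeriv i d x‖ ≤ C)
    (hlim : ∀ i, Tendsto (partialDeriv i d) (Bornology.cobounded Plane) (𝓝 0)) (h0 : d 0 = 0) :
    d = 0 := by
  have hd1 : ∀ i, ContDiff ℝ 1 (partialDeriv i d) := fun i =>
    (hd.fderiv_right (m := 1) (by norm_num)).clm_apply contDiff_const
  let L : ℂ ≃ₗᵢ[ℝ] Plane := Complex.orthonormalBasisOneI.repr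
  have hL1 : L 1 = basisVec 0 := by
    have := Complex.orthonormalBasisOneI.repr_self 0
    simpa [basisVec] using this
  have hLI : L Complex.I = basisVec 1 := by
    have := Complex.orthonormalBasisOneI.repr_self 1
    simpa [basisVec] using this
  let F : ℂ → ℂ := fun z =>
    ((partialDeriv 0 d (L z) : ℝ) : ℂ) - Complex.I * (partialDeriv 1 d (L z) : ℝ)
  have hcomp : ∀ i z, HasFDerivAt (fun z => ((partialDeriv i d (L z) : ℝ) : ℂ))
      (Complex.ofRealCLM.comp ((fderiv ℝ (partialDeriv i d) (L z)).comp
        (L.toContinuousLinearEquiv : ℂ →L[ℝ] Plane))) z := fun i z =>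
    Complex.ofRealCLM.hasFDerivAt.comp z
      ((((hd1 i).differentiable (by simp)) (L z)).hasFDerivAt.comp z
        L.toContinuousLinearEquiv.hasFDerivAt)
  have hF : ∀ z, HasFDerivAt F _ z := fun z =>
    (hcomp 0 z).sub ((hcomp 1 z).const_mul Complex.I)
  have hFd : Differentiable ℂ F := fun z => by
    rw [differentiableAt_complex_iff_differentiableAt_real]
    refine ⟨(hF z).differentiableAt, ?_⟩
    rw [(hF z).fderiv]
    have e1 := partialDeriv_comm hd 0 1
    have e2 : partialDeriv 1 (partialDeriv 1 d) (L z) =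
        - partialDeriv 0 (partialDeriv 0 d) (L z) := by
      have := hharm (L z); rw [Fin.sum_univ_two] at this; linarith
    have e3 := congrFun e1 (L z)
    simp only [partialDeriv] at e2 e3
    simp [hL1, hLI]
    rw [e2, e3]
    push_cast
    linear_combination ((fderiv ℝ (partialDeriv 0 d) (L z) (basisVec 1) : ℝ) : ℂ) * Complex.I_sq
  have hFb : Bornology.IsBounded (Set.range F) := by
    refine isBounded_iff_forall_norm_le.2 ⟨C + C, ?_⟩
    rintro _ ⟨z, rfl⟩
    refine (norm_sub_le _ _).trans (add_le_add ?_ ?_)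
    · simpa using hb 0 (L z)
    · simpa using hb 1 (L z)
  have hFlim : Tendsto F (Bornology.cobounded ℂ) (𝓝 0) := by
    have hLc : Tendsto L (Bornology.cobounded ℂ) (Bornology.cobounded Plane) :=
      L.antilipschitz.tendsto_cobounded
    have h := fun i => (Complex.continuous_ofReal.tendsto 0).comp ((hlim i).comp hLc)
    simpa [F, Function.comp_def] using (h 0).sub ((h 1).const_mul Complex.I)
  have hF0 : ∀ z, F z = 0 := fun z => by
    have : F = fun _ => F z := funext fun w => hFd.apply_eq_apply_of_bounded hFb w z
    rw [this] at hFlim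
    exact tendsto_nhds_unique tendsto_const_nhds hFlim
  have hp0 : ∀ x, partialDeriv 0 d x = 0 ∧ partialDeriv 1 d x = 0 := fun x => by
    have h := hF0 (L.symm x)
    simp only [F, LinearIsometryEquiv.apply_symm_apply] at h
    have hr := congrArg Complex.re h
    have hi := congrArg Complex.im h
    simp at hr hi
    exact ⟨hr, hi⟩
  have hfd : ∀ x, fderiv ℝ d x = 0 := fun x => by
    rw [fderiv_eq_smulRightL_add, (hp0 x).1, (hp0 x).2, map_zero, map_zero, add_zero]
  funext x
  rw [is_const_of_fderiv_eq_zero (hd.differentiable (by simp)) hfd x 0, h0]; rfl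

/-- The real and imaginary parts of the difference of two solutions are harmonic, with gradients
that tend to zero at infinity; Liouville's theorem applies to these gradients. -/
theorem IsClassicalSolution.unique {f P Q : Plane → 𝕜} (hP : IsClassicalSolution f P)
    (hQ : IsClassicalSolution f Q) : Q = P := by
  obtain ⟨C, hC⟩ := hP.grad_bounded
  obtain ⟨C', hC'⟩ := hQ.grad_bounded
  have hD : ContDiff ℝ 2 (Q - P) := hQ.contDiff.sub hP.contDiff
  have hd1 : ∀ {u : Plane → 𝕜}, ContDiff ℝ 2 u → ∀ i, ContDiff ℝ 1 (partialDeriv i u) :=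
    fun hu i => (hu.fderiv_right (m := 1) (by norm_num)).clm_apply contDiff_const
  have hpd : ∀ i, partialDeriv i (Q - P) = partialDeriv i Q - partialDeriv i P :=
    partialDeriv_sub (hQ.contDiff.differentiable (by simp)) (hP.contDiff.differentiable (by simp))
  have hgr : ∀ (u : Plane → 𝕜) i x, ‖partialDeriv i u x‖ ≤ ‖grad u x‖ := fun u i x =>
    PiLp.norm_apply_le (grad u x) i
  have hharm : ∀ x, ∑ i, partialDeriv i (partialDeriv i (Q - P)) x = 0 := fun x => by
    have h1 := hP.poisson x
    have h2 := hQ.poisson x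
    rw [laplacian_eq_sum_partialDeriv hP.contDiff] at h1
    rw [laplacian_eq_sum_partialDeriv hQ.contDiff] at h2
    simp only [hpd]
    simp only [partialDeriv_sub ((hd1 hQ.contDiff _).differentiable (by simp))
      ((hd1 hP.contDiff _).differentiable (by simp)), Pi.sub_apply, Finset.sum_sub_distrib]
    rw [neg_eq_iff_eq_neg.1 h1, neg_eq_iff_eq_neg.1 h2, sub_self]
  have hzero : ∀ L : 𝕜 →L[ℝ] ℝ, ∀ x, L ((Q - P) x) = 0 := fun L => by
    have hLp : ∀ i, partialDeriv i (fun x => L ((Q - P) x)) =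
        fun x => L (partialDeriv i (Q - P) x) := fun i =>
      partialDeriv_clm_comp (hD.of_le (by norm_num)) L i
    refine congrFun (eq_zero_of_harmonic (d := fun x => L ((Q - P) x)) (L.contDiff.comp hD)
      (fun x => ?_) (C := ‖L‖ * (C' + C)) (fun i x => ?_) (fun i => ?_) ?_)
    · simp only [hLp]
      simp only [partialDeriv_clm_comp (hd1 hD _) L]
      rw [← map_sum, hharm, map_zero]
    · rw [hLp]
      refine (L.le_opNorm _).trans (mul_le_mul_of_nonneg_left ?_ (norm_nonneg _))
      rw [hpd]
      exact (norm_sub_le _ _).trans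
        (add_le_add ((hgr Q i x).trans (hC' x)) ((hgr P i x).trans (hC x)))
    · rw [hLp, hpd]
      have h : ∀ {u : Plane → 𝕜}, Tendsto (fun x => ‖grad u x‖) (Bornology.cobounded Plane) (𝓝 0) →
          Tendsto (partialDeriv i u) (Bornology.cobounded Plane) (𝓝 0) := fun hu =>
        squeeze_zero_norm (hgr _ i) hu
      simpa [Function.comp_def] using (L.continuous.tendsto _).comp
        ((h hQ.grad_tendsto).sub (h hP.grad_tendsto))
    · simp [hQ.zero_at_origin, hP.zero_at_origin]
  funext x
  rw [← sub_eq_zero]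
  exact RCLike.ext (by simpa using hzero RCLike.reCLM x) (by simpa using hzero RCLike.imCLM x)

end

theorem theoremA1 {𝕜 : Type*} [RCLike 𝕜] (p₀ : ℝ) (hp₁ : 1 < p₀) (hp₂ : p₀ < 2)
    (f : Plane → 𝕜) (hf : MemLp f (ENNReal.ofReal p₀) volume) :
    -- the integral defining `P` converges absolutely at every point, and `P 0 = 0`
    (∀ x, Integrable (potentialIntegrand f x) volume) ∧
    potential f 0 = 0 ∧
    -- the weak gradient of `P` is the (almost everywhere absolutely convergent) integral
    (∀ᵐ x ∂(volume : Measure Plane), ∀ i, Integrable (gradIntegrand f i x) volume) ∧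
    HasWeakGradient (potential f) (gradPotential f) ∧
    MemLp (gradPotential f) (ENNReal.ofReal (sobolevConj p₀)) volume ∧
    -- weak form of `-Δ P = f`
    (∀ φ : 𝓢(Plane, 𝕜),
      ∫ x, ∑ i, gradPotential f x i * partialDeriv i φ x = ∫ x, f x * φ x) ∧
    -- `∇P → 0` at infinity, in `L^{p₀*}` and in measure
    Tendsto (fun R : ℝ => eLpNorm (gradPotential f) (ENNReal.ofReal (sobolevConj p₀))
      (volume.restrict {x : Plane | R < ‖x‖})) atTop (𝓝 0) ∧
    (∀ ε : ℝ, 0 < ε →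
      Tendsto (fun R : ℝ => volume {x : Plane | R < ‖x‖ ∧ ε < ‖gradPotential f x‖})
        atTop (𝓝 0)) ∧
    -- growth of `P`
    (MemLp f 1 volume →
      limsup (fun x => ENNReal.ofReal (‖potential f x‖ / Real.log (bracket x)))
        (Bornology.cobounded Plane) ≤ eLpNorm f 1 volume / ENNReal.ofReal (2 * π)) ∧
    -- the classical regime
    (∀ q₀ : ℝ, 2 < q₀ → Continuous f →
      (∃ g, HasWeakGradient f g ∧ MemLp g (ENNReal.ofReal q₀) volume) →
      IsClassicalSolution f (potential f) ∧
      (∀ Q : Plane → 𝕜, IsClassicalSolution f Q → Q = potential f) ∧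
      (∀ r : ℝ≥0∞, ENNReal.ofReal (sobolevConj p₀) ≤ r →
        MemLp (grad (potential f)) r volume) ∧
      (∀ p : ℝ≥0∞, ENNReal.ofReal p₀ ≤ p → ∀ j k,
        MemLp (partialDeriv j (partialDeriv k (potential f))) p volume) ∧
      (∀ j k, ∃ h, HasWeakGradient (partialDeriv j (partialDeriv k (potential f))) h ∧
        MemLp h (ENNReal.ofReal q₀) volume)) := by
  have hpq := (Real.HolderConjugate.conjExponent hp₁).symm
  have hstar := lt_sobolevConj hp₁ hp₂
  have hG := memLp_gradPotential hp₁ hp₂ hf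
  refine ⟨integrable_potentialIntegrand hpq hp₂ hf, potential_zero f,
    ae_integrable_gradIntegrand hpq hp₂ hf, hasWeakGradient_potential hp₁ hp₂ hf, hG,
    fun φ => integral_sum_gradPotential_mul_partialDeriv hpq hp₂ hf (isTame_schwartz φ),
    tendsto_eLpNorm_restrict_norm_gt (by linarith) hG,
    fun ε hε => tendsto_measure_norm_gt (by linarith) hG hε,
    limsup_potential_div_log_le hpq hp₂ hf, ?_⟩
  rintro q₀ hq hfc ⟨g, hfg, hg⟩
  obtain ⟨hsol, hgrad, hhess, hthird⟩ := classical_potential hp₁ hp₂ hq hfc hf hfg hg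
  refine ⟨hsol, fun Q hQ => hsol.unique hQ, fun r hr => MemLp.of_eval_piLp fun i => ?_,
    fun p hp j k => ?_, fun j k => hthird k j⟩
  · obtain ⟨hi, C, hC⟩ := hgrad i
    exact memLp_of_le_exponent_of_bounded (by simpa using by linarith) hr hi hC
  · obtain ⟨hi, C, hC⟩ := hhess k j
    exact memLp_of_le_exponent_of_bounded (by simpa using by linarith) hp hi hC
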